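/- Let $\mu$ be a nontrivial probability measure on the unit circle $\partial\mathbb{D}$ (i.e. a Borel probability measure that is not carried by a finite set), and write $d\mu=w\,\frac{d\theta}{2\pi}+d\mu_{\rm s}$ with $\mu_{\rm s}$ singular. Let $\Phi_n(z;\mu)$ be its monic orthogonal polynomials, $\varphi_n=\Phi_n/\|\Phi_n\|_{L^2(\mu)}$ the orthonormal ones, $P^*(z)=z^n\overline{P(1/\bar z)}$ for $P$ of degree $n$, and $\alpha_n=\alpha_n(\mu)=-\overline{\Phi_{n+1}(0;\mu)}$ the Verblunsky coefficients; put $\rho_0=\sqrt{1-|\alpha_0|^2}$. There is a nontrivial probability measure $\mu_1$ with $\alpha_j(\mu_1)=\alpha_{j+1}(\mu)$ for all $j\ge 0$; let $\mu_1$ be such a measure, with $d\mu_1=w_1\,\frac{d\theta}{2\pi}+d\mu_{1,\rm s}$. Let $f$ be the Schur function of $\mu$, that is, the analytic function on $\mathbb{D}$ with $F=\frac{1+zf}{1-zf}$, where $F(z)=\int\frac{e^{i\theta}+z}{e^{i\theta}-z}\,d\mu(\theta)$, let $f_1$ be the Schur function of $\mu_1$, and define the relative Szegő function $$(\delta_0D)(z)=\frac{1-\bar\alpha_0f(z)}{\rho_0}\,\frac{1-zf_1(z)}{1-zf(z)},\qquad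 z\in\mathbb{D}.$$ Then: (i) $\delta_0D$ is analytic and nonvanishing on $\mathbb{D}$. (ii) $\log(\delta_0D)$ (any analytic branch; branches exist) lies in $H^p(\mathbb{D})$ for every $p\in[1,\infty)$, where $H^p(\mathbb{D})$ is the space of analytic $g$ on $\mathbb{D}$ with $\sup_{0\le r<1}\int_0^{2\pi}|g(re^{i\theta})|^p\,\frac{d\theta}{2\pi}<\infty$. (iii) For a.e. $\theta$ one has $w(\theta)\ne0$ if and only if $w_1(\theta)\neq 0$. For a.e. $\theta$ with $w(\theta)\neq0$ the radial limit $(\delta_0D)(e^{i\theta})=\lim_{r\uparrow1}(\delta_0D)(re^{i\theta})$ exists in $\mathbb{C}$ and $$\frac{w(\theta)}{w_1(\theta)}=|(\delta_0D)(e^{i\theta})|^2 .$$ For all $p\in[1,\infty)$, $$\int_{w_1(\theta)\ne0}\left|\log\left(\frac{w(\theta)}{w_1(\theta)}\right)\right|^p\frac{d\theta}{2\pi}<\infty .$$ (iv) If $\sum_{j=0}^\infty|\alpha_j|^2<\infty$, then $w$ and $w_1$ are nonzero a.e., $\log w$ and $\log w_1$ are integrable with respect to $\frac{d\theta}{2\pi}$,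 and for all $z\in\mathbb{D}$ $$(\delta_0D)(z)=\frac{D(z;\mu)}{D(z;\mu_1)},\qquad\text{where}\quad D(z;\mu)=\exp\left(\int_0^{2\pi}\frac{e^{i\theta}+z}{e^{i\theta}-z}\,\log(w(\theta))\,\frac{d\theta}{4\pi}\right)$$ is the Szegő function, and $D(z;\mu_1)$ is defined in the same way from $w_1$. (v) For every $z\in\mathbb{D}$, $$\lim_{n\to\infty}\frac{\varphi_{n-1}^*(z;\mu_1)}{\varphi_n^*(z;\mu)}=(\delta_0D)(z).$$ -/

import Mathlib

open MeasureTheory Filter Topology Polynomial ComplexConjugate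

namespace OPUC

/-- The Borel σ-algebra on the unit circle. -/
noncomputable instance circleMeasurableSpace : MeasurableSpace Circle := borel Circle

instance circleBorelSpace : BorelSpace Circle := ⟨rfl⟩

/-- Normalized arc length `dθ / 2π` on the unit circle. -/
noncomputable def arc : Measure Circle :=
  (ENNReal.ofReal (2 * Real.pi))⁻¹ •
    (volume.restrict (Set.Ioc (0 : ℝ) (2 * Real.pi))).map Circle.exp

/-- Nontrivial probability measures on the unit circle: those that are not carried by a
finite set, i.e. that are not finite combinations of point masses. -/
structure IsNontrivialProb (μ : Measure Circle) : Prop where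
  isProb : IsProbabilityMeasure μ
  not_finite : ∀ s : Set Circle, s.Finite → μ sᶜ ≠ 0

/-- The inner product `⟨P, Q⟩ = ∫ conj (P ζ) * Q ζ dμ(ζ)` of polynomials in `L²(μ)`. -/
noncomputable def polyInner (μ : Measure Circle) (P Q : ℂ[X]) : ℂ :=
  ∫ ζ : Circle, conj (P.eval (ζ : ℂ)) * Q.eval (ζ : ℂ) ∂μ

/-- The monic orthogonal polynomials `Φₙ(z; μ)`, obtained from `1, z, z², …` by the
Gram–Schmidt process (without normalization) in `L²(μ)`. -/
noncomputable def monicOP (μ : Measure Circle) : ℕ → ℂ[X]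
  | n => X ^ n - ∑ k : Fin n,
      C (polyInner μ (monicOP μ k) (X ^ n) / polyInner μ (monicOP μ k) (monicOP μ k)) *
        monicOP μ k
  decreasing_by all_goals exact k.isLt

/-- The norm of a polynomial in `L²(μ)`. -/
noncomputable def polyNorm (μ : Measure Circle) (P : ℂ[X]) : ℝ :=
  Real.sqrt (∫ ζ : Circle, ‖P.eval (ζ : ℂ)‖ ^ 2 ∂μ)

/-- The orthonormal polynomials `φₙ = Φₙ / ‖Φₙ‖`. -/
noncomputable def orthoPoly (μ : Measure Circle) (n : ℕ) : ℂ[X] :=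
  C (((polyNorm μ (monicOP μ n))⁻¹ : ℝ) : ℂ) * monicOP μ n

/-- The reversed polynomial `P*(z) = zⁿ conj (P (1 / conj z))` of a polynomial of degree `n`:
the coefficients are conjugated and their order is reversed. -/
noncomputable def starPoly (n : ℕ) (P : ℂ[X]) : ℂ[X] :=
  (P.map (starRingEnd ℂ)).reflect n

/-- The Verblunsky coefficients `αₙ = - conj (Φₙ₊₁(0))`. -/
noncomputable def verblunsky (μ : Measure Circle) (n : ℕ) : ℂ :=
  -conj ((monicOP μ (n + 1)).eval 0)

/-- `μ₁` is the measure obtained from `μ` by removing the first Verblunsky coefficient: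
a nontrivial probability measure with `αⱼ(μ₁) = αⱼ₊₁(μ)` for all `j`. -/
structure IsStripped (μ μ₁ : Measure Circle) : Prop where
  nontrivial : IsNontrivialProb μ₁
  shift : ∀ j : ℕ, verblunsky μ₁ j = verblunsky μ (j + 1)

/-- The density `w` of the part of `μ` that is absolutely continuous with respect to
`dθ / 2π`. -/
noncomputable def weight (μ : Measure Circle) (ζ : Circle) : ℝ :=
  (μ.rnDeriv arc ζ).toReal

/-- The Carathéodory function `F(z) = ∫ (ζ + z) / (ζ - z) dμ(ζ)`. -/
noncomputable def caratheodory (μ : Measure Circle) (z : ℂ) : ℂ :=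
  ∫ ζ : Circle, ((ζ : ℂ) + z) / ((ζ : ℂ) - z) ∂μ

/-- The Schur function `f` of a probability measure, given by `F = (1 + z f) / (1 - z f)`,
i.e. `z f(z) = (F(z) - 1) / (F(z) + 1)`. The right-hand side vanishes at `0`, and `dslope`
divides it by `z`, with the value at `z = 0` filled in by the derivative. -/
noncomputable def schur (μ : Measure Circle) : ℂ → ℂ :=
  dslope (fun z => (caratheodory μ z - 1) / (caratheodory μ z + 1)) 0

/-- The relative Szegő function
`δ₀D(z) = (1 - conj α₀ f(z)) / ρ₀ * (1 - z f₁(z)) / (1 - z f(z))`, `ρ₀ = √(1 - |α₀|²)`, where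
`f` and `f₁` are the Schur functions of `μ` and `μ₁`. -/
noncomputable def relSzego (μ μ₁ : Measure Circle) (z : ℂ) : ℂ :=
  (1 - conj (verblunsky μ 0) * schur μ z) /
      ((Real.sqrt (1 - ‖verblunsky μ 0‖ ^ 2) : ℝ) : ℂ) *
    ((1 - z * schur μ₁ z) / (1 - z * schur μ z))

/-- The Hardy space `H^p(𝔻)`, for `0 < p < ∞`. -/
def MemHardy (p : ℝ) (g : ℂ → ℂ) : Prop :=
  AnalyticOnNhd ℂ g (Metric.ball 0 1) ∧
    ∃ K : ℝ, ∀ r : ℝ, 0 ≤ r → r < 1 → ∫ ζ : Circle, ‖g ((r : ℂ) * (ζ : ℂ))‖ ^ p ∂arc ≤ K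

/-- `∫ log w dθ/2π` converges absolutely; in particular `w` is nonzero almost everywhere. -/
def LogWeightIntegrable (μ : Measure Circle) : Prop :=
  (∀ᵐ ζ ∂arc, weight μ ζ ≠ 0) ∧ Integrable (fun ζ => Real.log (weight μ ζ)) arc

/-- The Szegő function `D(z) = exp (∫ (ζ + z) / (ζ - z) log w dθ/4π)`. -/
noncomputable def szego (μ : Measure Circle) (z : ℂ) : ℂ :=
  Complex.exp ((1 / 2 : ℂ) *
    ∫ ζ : Circle, ((ζ : ℂ) + z) / ((ζ : ℂ) - z) * ((Real.log (weight μ ζ) : ℝ) : ℂ) ∂arc)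

end OPUC

namespace OPUC

-- Arc length, Cauchy and Schwarz formulas on the circle

attribute [local simp] Circle.norm_coe

/-! Everything follows from one relation between the Schur functions `f` of `μ` and `f₁` of `μ₁`: `z
f₁ (1 - conj α₀ f) = f - α₀`, one step of the Schur algorithm. By Geronimus' theorem
(`geronimus_aux`) the Schur parameters of a measure are its Verblunsky coefficients: the ratio of
the Cauchy transforms of `ζ⁻⁽ⁿ⁺¹⁾ Φₙ*` and `ζ⁻ⁿ Φₙ` is the `n`-th Schur iterate, because Szegő
recursion and Schur algorithm are the same Möbius recursion. Since inverse Schur steps contract the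
pseudohyperbolic distance, a Schur function is determined by its parameters, so `f₁` must be the
Schur iterate of `f` (`IsStripped.eqOn_schur`). Conversely, Herglotz's theorem turns that iterate
into a measure, which gives existence of `μ₁`.

Each non-constant factor of `δ₀D` has the form `1 - u` with `|u| < 1`, hence positive real part; its
logarithm has imaginary part at most `π / 2` in absolute value. If `l` is such a logarithm, the mean
value property for `exp (± l / 2)` bounds `exp (|Re l| / 2)` in mean on all circles, which gives
every `H^p` (`memHardy_of_abs_im_le`).

On the boundary, Fatou's theorem and `Re F = (1 - |z f|²) / |1 - z f|²` give `w = (1 - |f|²) / |1 -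
ζ f|²` almost everywhere, and likewise for `w₁`. The disc automorphism identity turns the Schur
relation into `|1 - conj α₀ f|² (1 - |f₁|²) = (1 - |α₀|²) (1 - |f|²)` on the circle, so the quotient
of the weights is `|δ₀D|²`. Integrability of its logarithm is Fatou's lemma together with the `H^p`
bound.

For square summable coefficients, iterating the same identity and averaging logarithms bounds `∫ log
(1 - |f(rζ)|²)` below by `∑ log (1 - |αⱼ|²)`, uniformly in `r`; hence `log w` is integrable. A
function in `H²` is the Schwarz integral of the boundary values of its real part
(`MemHardy.eq_schwarz_integral`), and for `log δ₀D` these are `(log w - log w₁) / 2`.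

For the ratio asymptotics, `Φₙ₊₁(μ)` and `Φₙ(μ₁)` obey the same recursion with different initial
data. Its solution is a factor independent of the data, times a linear form in the data whose
coefficient is a Schur approximant of `f₁` (`szego_recursion_solution`). The factor cancels in the
ratio, and the approximants converge to `f₁`. -/

theorem continuous_coe : Continuous fun ζ : Circle => (ζ : ℂ) :=
  continuous_subtype_val

instance isProbabilityMeasure_arc : IsProbabilityMeasure arc := by
  constructor
  have h : 0 < 2 * Real.pi := by positivity
  rw [arc, Measure.smul_apply, Measure.map_apply Circle.exp.continuous.measurable .univ]
  simp only [Set.preimage_univ, Measure.restrict_apply_univ, Real.volume_Ioc, sub_zero, smul_eq_mul]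
  exact ENNReal.inv_mul_cancel (by simpa using Real.pi_pos) ENNReal.ofReal_ne_top

/-- Integrals over the circle are circle averages. -/
theorem integral_arc {E : Type*} [NormedAddCommGroup E] [NormedSpace ℝ E] {g : ℂ → E}
    (hg : Continuous fun ζ : Circle => g ζ) :
    ∫ ζ : Circle, g ζ ∂arc = Real.circleAverage g 0 1 := by
  have h : 0 < 2 * Real.pi := by positivity
  rw [arc, integral_smul_measure, integral_map Circle.exp.continuous.aemeasurable
    hg.aestronglyMeasurable, Real.circleAverage_def, intervalIntegral.integral_of_le h.le,
    ENNReal.toReal_inv, ENNReal.toReal_ofReal h.le]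
  simp [circleMap, Circle.coe_exp]

theorem continuous_circle_of_continuousOn {E : Type*} [TopologicalSpace E] {g : ℂ → E}
    (hg : ContinuousOn g (Metric.sphere 0 1)) : Continuous fun ζ : Circle => g ζ :=
  hg.comp_continuous continuous_coe fun ζ => by simp

theorem sub_ne_zero_of_mem_ball {z : ℂ} (hz : z ∈ Metric.ball (0 : ℂ) 1) (ζ : Circle) :
    (ζ : ℂ) - z ≠ 0 := by
  intro h
  rw [sub_eq_zero] at h
  rw [← h] at hz
  simp at hz

theorem continuous_herglotz {z : ℂ} (hz : z ∈ Metric.ball (0 : ℂ) 1) :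
    Continuous fun ζ : Circle => ((ζ : ℂ) + z) / ((ζ : ℂ) - z) :=
  (continuous_coe.add continuous_const).div (continuous_coe.sub continuous_const)
    (sub_ne_zero_of_mem_ball hz)

theorem continuous_circle_of_diffContOnCl {g : ℂ → ℂ} (hg : DiffContOnCl ℂ g (Metric.ball 0 1)) :
    Continuous fun ζ : Circle => g ζ :=
  continuous_circle_of_continuousOn
    (hg.continuousOn_ball.mono Metric.sphere_subset_closedBall)

theorem integrable_of_continuous {E : Type*} [NormedAddCommGroup E] {μ : Measure Circle}
    [IsFiniteMeasure μ] {g : Circle → E} (hg : Continuous g) : Integrable g μ := by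
  obtain ⟨C, hC⟩ := isCompact_univ.exists_bound_of_continuousOn hg.continuousOn
  exact Integrable.of_bound hg.aestronglyMeasurable C (.of_forall fun ζ => hC ζ trivial)

/-- Cauchy's formula on the unit circle. -/
theorem integral_cauchy {g : ℂ → ℂ} (hg : DiffContOnCl ℂ g (Metric.ball 0 1)) {z : ℂ}
    (hz : z ∈ Metric.ball (0 : ℂ) 1) :
    ∫ ζ : Circle, (ζ : ℂ) / ((ζ : ℂ) - z) * g ζ ∂arc = g z := by
  have := DiffContOnCl.circleAverage_smul_div (f := g) (c := 0) (R := 1) (w := z)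
    (by simpa using hg) (by simpa using hz)
  rw [← this]
  simp only [sub_zero, smul_eq_mul]
  refine integral_arc (g := fun ζ => ζ / (ζ - z) * g ζ) ?_
  exact (continuous_coe.div (continuous_coe.sub continuous_const)
    (sub_ne_zero_of_mem_ball hz)).mul (continuous_circle_of_diffContOnCl hg)

theorem integral_arc_eq_center {g : ℂ → ℂ} (hg : DiffContOnCl ℂ g (Metric.ball 0 1)) :
    ∫ ζ : Circle, g ζ ∂arc = g 0 := by
  rw [← integral_cauchy hg (Metric.mem_ball_self one_pos)]
  simp

/-- The Schwarz integral formula. -/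
theorem schwarz_formula {g : ℂ → ℂ} (hg : DiffContOnCl ℂ g (Metric.ball 0 1)) {z : ℂ}
    (hz : z ∈ Metric.ball (0 : ℂ) 1) :
    g z = (g 0).im * Complex.I +
      ∫ ζ : Circle, ((ζ : ℂ) + z) / ((ζ : ℂ) - z) * ((g ζ).re : ℂ) ∂arc := by
  have hgc := continuous_circle_of_diffContOnCl hg
  have hk : Continuous fun ζ : Circle => (ζ : ℂ) / ((ζ : ℂ) - z) :=
    continuous_coe.div (continuous_coe.sub continuous_const)
      (sub_ne_zero_of_mem_ball hz)
  have hz' : ‖z‖ < 1 := by simpa using hz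
  have h0 := integral_arc_eq_center hg
  have h1 := integral_cauchy hg hz
  -- On the circle the kernel is the conjugate of `1 / (1 - conj z * ζ)`, which is holomorphic in
  -- the disc, so the conjugated integral is a value at the centre.
  have h2 : ∫ ζ : Circle, (ζ : ℂ) / ((ζ : ℂ) - z) * conj (g ζ) ∂arc = conj (g 0) := by
    have hne : ∀ w ∈ Metric.closedBall (0 : ℂ) 1, 1 - conj z * w ≠ 0 := by
      intro w hw h
      rw [sub_eq_zero] at h
      have h3 : ‖conj z * w‖ < 1 := by
        rw [norm_mul, RCLike.norm_conj]
        have : ‖w‖ ≤ 1 := by simpa using hw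
        nlinarith [norm_nonneg z, norm_nonneg w]
      rw [← h] at h3
      simp at h3
    have hd : DiffContOnCl ℂ (fun w => (1 - conj z * w)⁻¹ * g w) (Metric.ball 0 1) := by
      refine DiffContOnCl.smul (f := g) (c := fun w => (1 - conj z * w)⁻¹) ?_ hg
      refine DiffContOnCl.inv ?_ ?_
      · exact (Differentiable.diffContOnCl (by fun_prop))
      · intro w hw
        exact hne w (by rwa [closure_ball _ one_ne_zero] at hw)
    have h4 := integral_arc_eq_center hd
    simp only [mul_zero, sub_zero, inv_one, one_mul] at h4
    rw [← h4, ← integral_conj]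
    congr 1
    ext ζ
    have h5 : (ζ : ℂ) * conj (ζ : ℂ) = 1 := by
      rw [Complex.mul_conj]; simp
    have h6 := sub_ne_zero_of_mem_ball hz ζ
    have h7 := hne ζ (by simp)
    have h8 : conj (1 - conj z * (ζ : ℂ)) ≠ 0 := (_root_.map_ne_zero _).2 h7
    simp only [map_mul, map_inv₀, map_sub, map_one, Complex.conj_conj] at h8 ⊢
    congr 1
    rw [div_eq_iff h6, eq_inv_mul_iff_mul_eq₀ h8]
    linear_combination -z * h5
  have hconj : Continuous fun ζ : Circle => conj (g ζ) := Complex.continuous_conj.comp hgc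
  have h3 : ∫ ζ : Circle, conj (g ζ) ∂arc = conj (g 0) := by
    rw [← h0, ← integral_conj]
  -- Herglotz kernel = twice the Cauchy kernel minus one, and `Re g` is the mean of `g` and its
  -- conjugate.
  have h4 : ∀ ζ : Circle, ((ζ : ℂ) + z) / ((ζ : ℂ) - z) * ((g ζ).re : ℂ) =
      ((ζ : ℂ) / ((ζ : ℂ) - z) * g ζ + (ζ : ℂ) / ((ζ : ℂ) - z) * conj (g ζ)) -
        (1 / 2 : ℂ) * (g ζ + conj (g ζ)) := by
    intro ζ
    have h6 := sub_ne_zero_of_mem_ball hz ζ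
    rw [Complex.re_eq_add_conj]
    field_simp
    ring
  have hi1 : Integrable (fun ζ : Circle => (ζ : ℂ) / ((ζ : ℂ) - z) * g ζ) arc :=
    integrable_of_continuous (hk.mul hgc)
  have hi2 : Integrable (fun ζ : Circle => (ζ : ℂ) / ((ζ : ℂ) - z) * conj (g ζ)) arc :=
    integrable_of_continuous (hk.mul hconj)
  have hi3 : Integrable (fun ζ : Circle => (1 / 2 : ℂ) * (g ζ + conj (g ζ))) arc :=
    integrable_of_continuous (continuous_const.mul (hgc.add hconj))
  rw [integral_congr_ae (.of_forall h4), integral_sub (hi1.fun_add hi2) hi3, integral_add hi1 hi2,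
    integral_const_mul, integral_add (integrable_of_continuous hgc)
      (integrable_of_continuous hconj), h0, h1, h2, h3]
  have h5 := Complex.re_add_im (g 0)
  have h6 := Complex.re_eq_add_conj (g 0)
  linear_combination -(1 : ℂ) * h5 + h6

theorem smul_mem_ball {r : ℝ} (hr0 : 0 ≤ r) (hr : r < 1) {z : ℂ} (hz : ‖z‖ ≤ 1) :
    (r : ℂ) * z ∈ Metric.ball (0 : ℂ) 1 := by
  simp only [mem_ball_zero_iff, norm_mul, Complex.norm_real, Real.norm_eq_abs, abs_of_nonneg hr0]
  nlinarith

theorem smul_circle_mem_ball {r : ℝ} (hr0 : 0 ≤ r) (hr : r < 1) (ζ : Circle) :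
    (r : ℂ) * (ζ : ℂ) ∈ Metric.ball (0 : ℂ) 1 :=
  smul_mem_ball hr0 hr (by simp)

theorem diffContOnCl_dilate {g : ℂ → ℂ} (hg : DifferentiableOn ℂ g (Metric.ball 0 1)) {r : ℝ}
    (hr0 : 0 ≤ r) (hr : r < 1) : DiffContOnCl ℂ (fun z => g (r * z)) (Metric.ball 0 1) := by
  have hmap : Set.MapsTo (fun z : ℂ => (r : ℂ) * z) (Metric.closedBall 0 1) (Metric.ball 0 1) :=
    fun z hz => smul_mem_ball hr0 hr (by simpa using hz)
  constructor
  · exact hg.comp (by fun_prop) (hmap.mono_left Metric.ball_subset_closedBall)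
  · rw [closure_ball _ one_ne_zero]
    exact hg.continuousOn.comp (by fun_prop) hmap

theorem continuous_dilate {E : Type*} [TopologicalSpace E] {g : ℂ → E}
    (hg : ContinuousOn g (Metric.ball 0 1)) {r : ℝ} (hr0 : 0 ≤ r) (hr : r < 1) :
    Continuous fun ζ : Circle => g (r * ζ) :=
  hg.comp_continuous (continuous_const.mul continuous_coe)
    fun ζ => smul_circle_mem_ball hr0 hr ζ

/-- The mean value property on circles of radius less than one. -/
theorem integral_dilate {g : ℂ → ℂ} (hg : DifferentiableOn ℂ g (Metric.ball 0 1)) {r : ℝ}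
    (hr0 : 0 ≤ r) (hr : r < 1) : ∫ ζ : Circle, g (r * ζ) ∂arc = g 0 := by
  simpa using integral_arc_eq_center (diffContOnCl_dilate hg hr0 hr)

/-- The mean value property for real parts. -/
theorem integral_re_dilate {g : ℂ → ℂ} (hg : DifferentiableOn ℂ g (Metric.ball 0 1)) {r : ℝ}
    (hr0 : 0 ≤ r) (hr : r < 1) : ∫ ζ : Circle, (g (r * ζ)).re ∂arc = (g 0).re := by
  rw [← integral_dilate hg hr0 hr]
  exact integral_re (integrable_of_continuous (continuous_dilate hg.continuousOn hr0 hr))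

/-! ### Herglotz kernel and Carathéodory functions -/

theorem re_herglotz {z : ℂ} (ζ : Circle) :
    (((ζ : ℂ) + z) / ((ζ : ℂ) - z)).re = (1 - ‖z‖ ^ 2) / ‖(ζ : ℂ) - z‖ ^ 2 := by
  have := congrFun (poissonKernel_eq_re_herglotzRieszKernel (c := 0) (w := z)) (ζ : ℂ)
  simp only [poissonKernel, Function.comp_apply, herglotzRieszKernel, sub_zero] at this
  rw [← this]
  simp

/-- Cauchy integrals over the circle are holomorphic in the disc. -/
theorem differentiableOn_cauchy_integral {μ : Measure Circle} [IsFiniteMeasure μ]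
    {g : Circle → ℂ} (hg : Continuous g) :
    DifferentiableOn ℂ (fun z => ∫ ζ : Circle, g ζ / ((ζ : ℂ) - z) ∂μ) (Metric.ball 0 1) := by
  intro z₀ hz₀
  have hz : ‖z₀‖ < 1 := by simpa using hz₀
  obtain ⟨C, hC⟩ := isCompact_univ.exists_bound_of_continuousOn hg.continuousOn
  -- Half the distance to the circle: for `z` in the `ε`-ball the denominators stay at least `ε`.
  set ε := (1 - ‖z₀‖) / 2 with hε
  have hε0 : 0 < ε := by rw [hε]; linarith
  have hball : Metric.ball z₀ ε ⊆ Metric.ball 0 1 := by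
    intro z hz1
    have h1 : ‖z - z₀‖ < ε := by simpa [dist_eq_norm] using hz1
    have h2 := norm_le_norm_add_norm_sub' z z₀
    rw [mem_ball_zero_iff]
    linarith
  have hcont : ∀ z ∈ Metric.ball (0 : ℂ) 1, Continuous fun ζ : Circle => g ζ / ((ζ : ℂ) - z) :=
    fun z hz => hg.div (continuous_coe.sub continuous_const) (sub_ne_zero_of_mem_ball hz)
  have := (hasDerivAt_integral_of_dominated_loc_of_deriv_le (μ := μ) (x₀ := z₀)
    (F := fun z (ζ : Circle) => g ζ / ((ζ : ℂ) - z))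
    (F' := fun z (ζ : Circle) => g ζ / ((ζ : ℂ) - z) ^ 2)
    (bound := fun _ => C / ε ^ 2)
    (Metric.ball_mem_nhds z₀ hε0) ?_ ?_ ?_ ?_ ?_ ?_).2
  · exact this.differentiableAt.differentiableWithinAt
  · filter_upwards [Metric.ball_mem_nhds z₀ hε0] with z hz
    exact (hcont z (hball hz)).aestronglyMeasurable
  · exact integrable_of_continuous (hcont z₀ hz₀)
  · exact (hg.div ((continuous_coe.sub continuous_const).pow 2)
      fun ζ => pow_ne_zero 2 (sub_ne_zero_of_mem_ball hz₀ ζ)).aestronglyMeasurable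
  · refine .of_forall fun ζ z hz1 => ?_
    have h1 : ‖z - z₀‖ < ε := by simpa [dist_eq_norm] using hz1
    have h2 := norm_le_norm_add_norm_sub' z z₀
    have h3 := norm_sub_norm_le (ζ : ℂ) z
    rw [Circle.norm_coe] at h3
    rw [norm_div, norm_pow]
    have h4 : ε ≤ ‖(ζ : ℂ) - z‖ := by linarith
    have h5 := hC ζ trivial
    have h6 : 0 ≤ C := (norm_nonneg _).trans h5
    gcongr
  · exact integrable_const _
  · refine .of_forall fun ζ z hz1 => ?_
    have h6 := sub_ne_zero_of_mem_ball (hball hz1) ζ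
    have h7 := ((hasDerivAt_id z).const_sub (ζ : ℂ)).inv h6
    have h8 := h7.const_mul (g ζ)
    simp only [neg_neg, id_eq, div_eq_mul_inv, one_mul] at h8 ⊢
    exact h8

theorem herglotz_eq {z : ℂ} (hz : z ∈ Metric.ball (0 : ℂ) 1) (ζ : Circle) :
    ((ζ : ℂ) + z) / ((ζ : ℂ) - z) = 2 * ((ζ : ℂ) / ((ζ : ℂ) - z)) - 1 := by
  have := sub_ne_zero_of_mem_ball hz ζ
  field_simp
  ring

theorem caratheodory_eq {μ : Measure Circle} [IsProbabilityMeasure μ] {z : ℂ}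
    (hz : z ∈ Metric.ball (0 : ℂ) 1) :
    caratheodory μ z = 2 * ∫ ζ : Circle, (ζ : ℂ) / ((ζ : ℂ) - z) ∂μ - 1 := by
  have hk : Continuous fun ζ : Circle => (ζ : ℂ) / ((ζ : ℂ) - z) :=
    continuous_coe.div (continuous_coe.sub continuous_const)
      (sub_ne_zero_of_mem_ball hz)
  rw [caratheodory]
  simp_rw [herglotz_eq hz]
  rw [integral_sub ((integrable_of_continuous hk).const_mul 2) (integrable_const _),
    integral_const_mul]
  simp

theorem differentiableOn_caratheodory (μ : Measure Circle) [IsProbabilityMeasure μ] :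
    DifferentiableOn ℂ (caratheodory μ) (Metric.ball 0 1) :=
  (((differentiableOn_cauchy_integral (μ := μ) continuous_coe).const_mul 2).sub_const
    1).congr fun _ hz => caratheodory_eq hz

theorem caratheodory_zero (μ : Measure Circle) [IsProbabilityMeasure μ] :
    caratheodory μ 0 = 1 := by
  simp [caratheodory]

theorem re_caratheodory (μ : Measure Circle) [IsProbabilityMeasure μ] {z : ℂ}
    (hz : z ∈ Metric.ball (0 : ℂ) 1) :
    (caratheodory μ z).re = ∫ ζ : Circle, (1 - ‖z‖ ^ 2) / ‖(ζ : ℂ) - z‖ ^ 2 ∂μ := by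
  simp_rw [← re_herglotz]
  exact (integral_re (integrable_of_continuous (continuous_herglotz hz))).symm

theorem continuous_poisson {z : ℂ} (hz : z ∈ Metric.ball (0 : ℂ) 1) :
    Continuous fun ζ : Circle => (1 - ‖z‖ ^ 2) / ‖(ζ : ℂ) - z‖ ^ 2 := by
  simp_rw [← re_herglotz]
  exact Complex.continuous_re.comp (continuous_herglotz hz)

theorem re_caratheodory_pos (μ : Measure Circle) [IsProbabilityMeasure μ] {z : ℂ}
    (hz : z ∈ Metric.ball (0 : ℂ) 1) : 0 < (caratheodory μ z).re := by
  have hz' : ‖z‖ < 1 := by simpa using hz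
  have hpos : ∀ ζ : Circle, 0 < (1 - ‖z‖ ^ 2) / ‖(ζ : ℂ) - z‖ ^ 2 := fun ζ =>
    div_pos (by nlinarith [norm_nonneg z]) (by
      have := sub_ne_zero_of_mem_ball hz ζ
      positivity)
  rw [re_caratheodory μ hz, integral_pos_iff_support_of_nonneg (fun ζ => (hpos ζ).le)
    (integrable_of_continuous (continuous_poisson hz))]
  have : (Function.support fun ζ : Circle => (1 - ‖z‖ ^ 2) / ‖(ζ : ℂ) - z‖ ^ 2) = Set.univ :=
    Set.eq_univ_of_forall fun ζ => (hpos ζ).ne'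
  rw [this]
  simp

theorem integral_poisson_arc {z : ℂ} (hz : z ∈ Metric.ball (0 : ℂ) 1) :
    ∫ ζ : Circle, (1 - ‖z‖ ^ 2) / ‖(ζ : ℂ) - z‖ ^ 2 ∂arc = 1 := by
  rw [← re_caratheodory arc hz]
  have := schwarz_formula (g := fun _ => 1) diffContOnCl_const hz
  simp only [Complex.one_im, Complex.one_re] at this
  rw [caratheodory]
  simp at this
  rw [← this]
  simp

/-! ### Lengths of arcs and differentiation of measures -/

theorem dist_circle (ζ η : Circle) : dist ζ η = ‖(ζ : ℂ) - (η : ℂ)‖ :=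
  (Subtype.dist_eq ζ η).trans (dist_eq_norm _ _)

/-- The preimage under the exponential is `2π`-periodic, so any fundamental window will do. This
allows windows centred at the argument of a given point. -/
theorem arc_apply_window {S : Set Circle} (hS : MeasurableSet S) (t : ℝ) :
    arc S = (ENNReal.ofReal (2 * Real.pi))⁻¹ *
      volume (Circle.exp ⁻¹' S ∩ Set.Ioc t (t + 2 * Real.pi)) := by
  have h2 : 0 < 2 * Real.pi := by positivity
  have hm : MeasurableSet (Circle.exp ⁻¹' S) := Circle.exp.continuous.measurable hS
  rw [arc, Measure.smul_apply, Measure.map_apply Circle.exp.continuous.measurable hS,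
    Measure.restrict_apply hm, smul_eq_mul]
  congr 1
  have h0 := isAddFundamentalDomain_Ioc h2 0 volume
  rw [zero_add] at h0
  refine IsAddFundamentalDomain.measure_set_eq h0 (isAddFundamentalDomain_Ioc h2 t volume) hm ?_
  rintro ⟨g, hg⟩
  obtain ⟨k, rfl⟩ := AddSubgroup.mem_zmultiples_iff.1 hg
  ext x
  simp only [Set.mem_preimage, AddSubgroup.vadd_def, vadd_eq_add, Circle.exp_add,
    Circle.exp_zsmul, Circle.exp_two_pi, one_zpow, one_mul]

theorem dist_exp (θ t : ℝ) : dist (Circle.exp θ) (Circle.exp t) = 2 * |Real.sin ((θ - t) / 2)| := by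
  rw [dist_circle]
  have h : (Circle.exp θ : ℂ) - Circle.exp t =
      (Circle.exp t : ℂ) * (Complex.exp (Complex.I * (θ - t : ℝ)) - 1) := by
    rw [Circle.coe_exp, Circle.coe_exp, mul_sub, ← Complex.exp_add]
    push_cast
    ring_nf
  rw [h, norm_mul, Circle.norm_coe, one_mul, Complex.norm_exp_I_mul_ofReal_sub_one, norm_mul]
  simp

/-- Jordan's inequality `|sin x| ≥ 2 |x| / π` confines the ball to angles within `π s / 2`. -/
theorem arc_closedBall_le (ζ : Circle) (s : ℝ) :
    arc (Metric.closedBall ζ s) ≤ (ENNReal.ofReal (2 * Real.pi))⁻¹ *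
      ENNReal.ofReal (Real.pi * s) := by
  obtain ⟨t, rfl⟩ : ∃ t, Circle.exp t = ζ := ⟨_, Circle.exp_arg ζ⟩
  rw [arc_apply_window Metric.isClosed_closedBall.measurableSet (t - Real.pi)]
  gcongr
  refine (measure_mono (t := Set.Icc (t - Real.pi * s / 2) (t + Real.pi * s / 2)) ?_).trans ?_
  · rintro θ ⟨h1, h2, h3⟩
    rw [Set.mem_preimage, Metric.mem_closedBall, dist_exp] at h1
    have h4 : |(θ - t) / 2| ≤ Real.pi / 2 := by
      rw [abs_le]; constructor <;> linarith
    have h5 := Real.mul_abs_le_abs_sin h4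
    have h6 : 2 / Real.pi * |(θ - t) / 2| * Real.pi = |θ - t| := by
      rw [abs_div, abs_of_pos (two_pos : (0 : ℝ) < 2)]
      field_simp
    have h7 : |θ - t| ≤ Real.pi * s / 2 := by
      rw [← h6]
      nlinarith [Real.pi_pos]
    rw [abs_le] at h7
    constructor <;> linarith
  · rw [Real.volume_Icc]
    apply ENNReal.ofReal_le_ofReal
    linarith

/-- A chord is no longer than its arc; `s < π` keeps the arc inside one window. -/
theorem le_arc_closedBall (ζ : Circle) {s : ℝ} (hs : s < Real.pi) :
    (ENNReal.ofReal (2 * Real.pi))⁻¹ * ENNReal.ofReal (2 * s) ≤ arc (Metric.closedBall ζ s) := by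
  obtain ⟨t, rfl⟩ : ∃ t, Circle.exp t = ζ := ⟨_, Circle.exp_arg ζ⟩
  rw [arc_apply_window Metric.isClosed_closedBall.measurableSet (t - Real.pi)]
  gcongr
  refine le_trans ?_ (measure_mono (s := Set.Icc (t - s) (t + s)) ?_)
  · rw [Real.volume_Icc]
    apply ENNReal.ofReal_le_ofReal
    linarith
  · rintro θ ⟨h1, h2⟩
    refine ⟨?_, by linarith, by linarith⟩
    rw [Set.mem_preimage, Metric.mem_closedBall, dist_exp]
    have h3 := Real.abs_sin_le_abs (x := (θ - t) / 2)
    have h4 : |θ - t| ≤ s := by rw [abs_le]; constructor <;> linarith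
    rw [abs_div, abs_of_pos (two_pos : (0 : ℝ) < 2)] at h3
    linarith

theorem arc_closedBall_pos (ζ : Circle) {s : ℝ} (hs0 : 0 < s) (hs : s < Real.pi) :
    arc (Metric.closedBall ζ s) ≠ 0 := by
  have := le_arc_closedBall ζ hs
  intro h
  rw [h] at this
  rw [nonpos_iff_eq_zero, mul_eq_zero, ENNReal.inv_eq_zero, ENNReal.ofReal_eq_zero] at this
  rcases this with h1 | h1
  · exact ENNReal.ofReal_ne_top h1
  · linarith

/-- The constant `π` is the quotient of the upper bound at radius `2 s` and the lower bound at
radius `s`. Doubling provides the Vitali family used for differentiation. -/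
instance isUnifLocDoublingMeasure_arc : IsUnifLocDoublingMeasure arc := by
  refine ⟨⟨Real.toNNReal Real.pi, ?_⟩⟩
  filter_upwards [Ioo_mem_nhdsGT Real.pi_pos] with s hs ζ
  refine (arc_closedBall_le ζ _).trans ?_
  refine le_trans ?_ (mul_le_mul_right (le_arc_closedBall ζ hs.2) _)
  rw [show ((Real.toNNReal Real.pi : NNReal) : ENNReal) = ENNReal.ofReal Real.pi
    from rfl, mul_left_comm (ENNReal.ofReal Real.pi), ← ENNReal.ofReal_mul Real.pi_pos.le]

/-- Lebesgue differentiation of measures on the circle. -/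
theorem ae_tendsto_closedBall_div (μ : Measure Circle) [IsFiniteMeasure μ] :
    ∀ᵐ ζ ∂arc, Tendsto (fun s : ℝ => μ (Metric.closedBall ζ s) / arc (Metric.closedBall ζ s))
      (𝓝[>] 0) (𝓝 (μ.rnDeriv arc ζ)) := by
  filter_upwards [(IsUnifLocDoublingMeasure.vitaliFamily arc 1).ae_tendsto_rnDeriv μ] with ζ hζ
  refine hζ.comp (IsUnifLocDoublingMeasure.tendsto_closedBall_filterAt arc (fun _ => ζ) id
    tendsto_id ?_)
  filter_upwards [self_mem_nhdsWithin] with s hs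
  simpa using (Set.mem_Ioi.1 hs).le

/-! ### Poisson kernel and Fatou's theorem -/

/-- Shows that the Poisson kernel is a decreasing function of the distance from `η` to `ζ`, which
makes its superlevel sets balls. -/
theorem norm_sub_smul_sq (ζ η : Circle) (r : ℝ) :
    ‖(η : ℂ) - r * ζ‖ ^ 2 = (1 - r) ^ 2 + r * dist η ζ ^ 2 := by
  have h1 := Circle.normSq_coe ζ
  have h2 := Circle.normSq_coe η
  rw [dist_circle, ← Complex.normSq_eq_norm_sq, ← Complex.normSq_eq_norm_sq]
  rw [Complex.normSq_apply] at *
  rw [Complex.normSq_apply]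
  simp only [Complex.sub_re, Complex.sub_im, Complex.mul_re, Complex.mul_im, Complex.ofReal_re,
    Complex.ofReal_im]
  linear_combination (r ^ 2 - r) * h1 + (1 - r) * h2

/-- The Poisson kernel. -/
noncomputable def poisson (r : ℝ) (ζ η : Circle) : ℝ :=
  (1 - r ^ 2) / ‖(η : ℂ) - r * ζ‖ ^ 2

theorem norm_smul_circle {r : ℝ} (hr : 0 ≤ r) (ζ : Circle) : ‖(r : ℂ) * (ζ : ℂ)‖ = r := by
  rw [norm_mul, Circle.norm_coe, mul_one, Complex.norm_real, Real.norm_of_nonneg hr]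

theorem continuous_poisson' {r : ℝ} (hr0 : 0 ≤ r) (hr : r < 1) (ζ : Circle) :
    Continuous (poisson r ζ) := by
  have := continuous_poisson (smul_circle_mem_ball hr0 hr ζ)
  rwa [norm_smul_circle hr0] at this

theorem poisson_nonneg {r : ℝ} (hr0 : 0 ≤ r) (hr : r < 1) (ζ η : Circle) : 0 ≤ poisson r ζ η :=
  div_nonneg (by nlinarith) (by positivity)

theorem lintegral_poisson (μ : Measure Circle) [IsProbabilityMeasure μ] {r : ℝ} (hr0 : 0 ≤ r)
    (hr : r < 1) (ζ : Circle) :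
    ∫⁻ η, ENNReal.ofReal (poisson r ζ η) ∂μ = ENNReal.ofReal (caratheodory μ (r * ζ)).re := by
  rw [re_caratheodory μ (smul_circle_mem_ball hr0 hr ζ), norm_smul_circle hr0,
    ← ofReal_integral_eq_lintegral_ofReal
      (integrable_of_continuous (continuous_poisson' hr0 hr ζ))
      (.of_forall (poisson_nonneg hr0 hr ζ))]
  rfl

theorem lintegral_poisson_arc {r : ℝ} (hr0 : 0 ≤ r) (hr : r < 1) (ζ : Circle) :
    ∫⁻ η, ENNReal.ofReal (poisson r ζ η) ∂arc = 1 := by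
  rw [lintegral_poisson arc hr0 hr, re_caratheodory arc (smul_circle_mem_ball hr0 hr ζ),
    integral_poisson_arc (smul_circle_mem_ball hr0 hr ζ), ENNReal.ofReal_one]

/-- Superlevel sets of the Poisson kernel are balls. -/
theorem poisson_superlevel {r t : ℝ} (hr0 : 0 < r) (hr : r < 1) (ht : 0 < t) (ζ : Circle) :
    {η | t ≤ poisson r ζ η} = {η | dist η ζ ^ 2 ≤ ((1 - r ^ 2) / t - (1 - r) ^ 2) / r} := by
  ext η
  have h0 : 0 < ‖(η : ℂ) - r * ζ‖ ^ 2 := by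
    have := sub_ne_zero_of_mem_ball (smul_circle_mem_ball hr0.le hr ζ) η
    positivity
  rw [Set.mem_ofPred_eq, Set.mem_ofPred_eq, poisson, le_div_iff₀ h0, le_div_iff₀ hr0,
    norm_sub_smul_sq, mul_comm t, ← le_div_iff₀ ht]
  constructor <;> intro h <;> linarith

/-- If `μ ≤ a • ν` on small balls around `ζ`, then the same holds for superlevel sets of the Poisson
kernel above a small threshold. -/
theorem lintegral_poisson_le {μ ν : Measure Circle} [IsProbabilityMeasure μ] {a b : ENNReal}
    {δ r : ℝ} {ζ : Circle}
    (h : ∀ s ∈ Set.Ioo 0 δ, a * μ (Metric.closedBall ζ s) ≤ b * ν (Metric.closedBall ζ s))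
    (hδ : 0 < δ) (hr0 : 0 < r) (hr : r < 1) (ha : a ≠ ⊤) (hb : b ≠ ⊤) :
    a * ∫⁻ η, ENNReal.ofReal (poisson r ζ η) ∂μ ≤
      a * ENNReal.ofReal ((1 - r ^ 2) / (r * δ ^ 2)) +
        b * ∫⁻ η, ENNReal.ofReal (poisson r ζ η) ∂ν := by
  have hmeas := (continuous_poisson' hr0.le hr ζ).aemeasurable (μ := μ)
  have hmeas' := (continuous_poisson' hr0.le hr ζ).aemeasurable (μ := ν)
  rw [lintegral_eq_lintegral_meas_le μ (.of_forall (poisson_nonneg hr0.le hr ζ)) hmeas,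
    lintegral_eq_lintegral_meas_le ν (.of_forall (poisson_nonneg hr0.le hr ζ)) hmeas']
  -- Above height `T` the superlevel balls have radius less than `δ`, so the hypothesis applies; the
  -- layers below `T` cost at most `T` because `μ` has mass one.
  set T := (1 - r ^ 2) / (r * δ ^ 2) with hT
  have h1r : 0 < 1 - r ^ 2 := by nlinarith
  have hT0 : 0 < T := by positivity
  rw [← Set.Ioc_union_Ioi_eq_Ioi hT0.le, lintegral_union measurableSet_Ioi
    (Set.Ioc_disjoint_Ioi le_rfl), mul_add]
  gcongr ?_ + ?_
  · calc a * ∫⁻ t in Set.Ioc 0 T, μ {η | t ≤ poisson r ζ η}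
        ≤ a * ∫⁻ t in Set.Ioc 0 T, 1 := by gcongr; exact prob_le_one
      _ = a * ENNReal.ofReal T := by simp
  · rw [← lintegral_const_mul' _ _ ha, ← lintegral_const_mul' _ _ hb]
    refine le_trans ?_ (lintegral_mono_set (Set.Ioi_subset_Ioi hT0.le) |>.trans
      (by rw [Set.Ioc_union_Ioi_eq_Ioi hT0.le]))
    refine lintegral_mono_ae ?_
    -- The maximum of the kernel: there the superlevel set is the single point `ζ`, which is not a
    -- ball of positive radius.
    have hne : ∀ᵐ t : ℝ ∂volume, t ≠ (1 - r ^ 2) / (1 - r) ^ 2 := by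
      rw [ae_iff]
      simp
    filter_upwards [ae_restrict_of_ae hne, ae_restrict_mem measurableSet_Ioi] with t ht htT
    have ht0 : 0 < t := hT0.trans htT
    rw [poisson_superlevel hr0 hr ht0]
    set c := ((1 - r ^ 2) / t - (1 - r) ^ 2) / r with hc
    rcases lt_trichotomy c 0 with hc0 | hc0 | hc0
    · have : {η : Circle | dist η ζ ^ 2 ≤ c} = ∅ := by
        ext η
        simp only [Set.mem_ofPred_eq, Set.mem_empty_iff_false, iff_false, not_le]
        exact hc0.trans_le (by positivity)
      simp [this]
    · exfalso
      apply ht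
      have h1 : (1 - r ^ 2) / t - (1 - r) ^ 2 = 0 := by
        rcases div_eq_zero_iff.1 hc0 with h | h
        · exact h
        · exact absurd h hr0.ne'
      have h2 : (1 - r) ^ 2 ≠ 0 := by
        have : 1 - r ≠ 0 := by linarith
        positivity
      rw [sub_eq_zero, div_eq_iff ht0.ne'] at h1
      rw [eq_div_iff h2, h1, mul_comm]
    · have : {η : Circle | dist η ζ ^ 2 ≤ c} = Metric.closedBall ζ (√c) := by
        ext η
        rw [Set.mem_ofPred_eq, Metric.mem_closedBall, ← Real.sqrt_le_sqrt_iff hc0.le, Real.sqrt_sq dist_nonneg]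
      rw [this]
      refine h _ ⟨Real.sqrt_pos.2 hc0, ?_⟩
      rw [Real.sqrt_lt' hδ, hc, div_lt_iff₀ hr0]
      have h1 : (1 - r ^ 2) / t < δ ^ 2 * r := by
        rw [div_lt_iff₀ ht0]
        have := (div_lt_iff₀ (by positivity)).1 (hT ▸ htT : (1 - r ^ 2) / (r * δ ^ 2) < t)
        linarith
      nlinarith [sq_nonneg (1 - r)]

/-- The contribution of the low layers disappears as the kernel concentrates. -/
theorem tendsto_poisson_threshold {δ : ℝ} (hδ : 0 < δ) (a : ENNReal) (ha : a ≠ ⊤) :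
    Tendsto (fun r : ℝ => a * ENNReal.ofReal ((1 - r ^ 2) / (r * δ ^ 2))) (𝓝[<] 1) (𝓝 0) := by
  have h1 : ContinuousAt (fun r : ℝ => (1 - r ^ 2) / (r * δ ^ 2)) 1 :=
    ContinuousAt.div (by fun_prop) (by fun_prop) (by positivity)
  have h2 := ENNReal.Tendsto.const_mul (a := a)
    (ENNReal.tendsto_ofReal (h1.tendsto.mono_left (nhdsWithin_le_nhds (s := Set.Iio 1)))) (.inr ha)
  simpa using h2

theorem eventually_Ioo_nhdsLT_one : ∀ᶠ r : ℝ in 𝓝[<] 1, 0 < r ∧ r < 1 :=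
  Ioo_mem_nhdsLT zero_lt_one

/-- Fatou's theorem: the Poisson integral of a measure has radial limits almost everywhere, given by
the density of the measure. -/
theorem ae_tendsto_re_caratheodory (μ : Measure Circle) [IsProbabilityMeasure μ] :
    ∀ᵐ ζ : Circle ∂arc, Tendsto (fun r : ℝ => (caratheodory μ (r * ζ)).re) (𝓝[<] 1) (𝓝 (weight μ ζ)) := by
  filter_upwards [ae_tendsto_closedBall_div μ, Measure.rnDeriv_lt_top μ arc] with ζ hζ hlt
  have key : Tendsto (fun r : ℝ => ENNReal.ofReal (caratheodory μ (r * ζ)).re) (𝓝[<] 1)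
      (𝓝 (μ.rnDeriv arc ζ)) := by
    have hsmall : ∀ᶠ s : ℝ in 𝓝[>] 0, s ∈ Set.Ioo 0 Real.pi := Ioo_mem_nhdsGT Real.pi_pos
    -- An intermediate value `b` between `a` and the density bounds the ball ratios near `ζ`.
    -- Comparing `μ` with `b • arc` leaves an error smaller than the gap between `a` and `b`.
    refine tendsto_order.2 ⟨fun a ha => ?_, fun a ha => ?_⟩
    · obtain ⟨b, hab, hb⟩ := exists_between ha
      have hb' : b ≠ ⊤ := (hb.trans hlt).ne
      obtain ⟨δ, hδ, hsub⟩ := mem_nhdsGT_iff_exists_Ioo_subset.1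
        ((hζ.eventually (lt_mem_nhds hb)).and hsmall)
      have hδ0 : 0 < δ := hδ
      have h1 : ∀ s ∈ Set.Ioo 0 δ,
          b * arc (Metric.closedBall ζ s) ≤ 1 * μ (Metric.closedBall ζ s) := by
        intro s hs
        obtain ⟨h2, h3⟩ := hsub hs
        rw [one_mul]
        exact ((ENNReal.le_div_iff_mul_le (.inl (arc_closedBall_pos ζ h3.1 h3.2))
          (.inl (measure_ne_top _ _))).1 h2.le)
      have h2 := (tendsto_poisson_threshold hδ0 b hb').eventually
        (gt_mem_nhds (tsub_pos_of_lt hab))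
      filter_upwards [h2, eventually_Ioo_nhdsLT_one] with r hr hr'
      have h3 := lintegral_poisson_le h1 hδ0 hr'.1 hr'.2 hb' ENNReal.one_ne_top
      rw [lintegral_poisson_arc hr'.1.le hr'.2, mul_one, one_mul,
        lintegral_poisson μ hr'.1.le hr'.2] at h3
      by_contra! hcon
      have h4 : b ≤ b * ENNReal.ofReal ((1 - r ^ 2) / (r * δ ^ 2)) + a := h3.trans (by gcongr)
      exact absurd (h4.trans_lt ((ENNReal.add_lt_add_right (hab.trans_le le_top).ne hr))) (by
        rw [tsub_add_cancel_of_le hab.le]; exact lt_irrefl _)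
    · obtain ⟨b, hb, hab⟩ := exists_between ha
      have hb' : b ≠ ⊤ := (hab.trans_le le_top).ne
      obtain ⟨δ, hδ, hsub⟩ := mem_nhdsGT_iff_exists_Ioo_subset.1
        ((hζ.eventually (gt_mem_nhds hb)).and hsmall)
      have hδ0 : 0 < δ := hδ
      have h1 : ∀ s ∈ Set.Ioo 0 δ,
          1 * μ (Metric.closedBall ζ s) ≤ b * arc (Metric.closedBall ζ s) := by
        intro s hs
        obtain ⟨h2, h3⟩ := hsub hs
        rw [one_mul]
        exact ((ENNReal.div_le_iff_le_mul (.inl (arc_closedBall_pos ζ h3.1 h3.2))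
          (.inl (measure_ne_top _ _))).1 h2.le)
      have h2 := (tendsto_poisson_threshold hδ0 1 ENNReal.one_ne_top).eventually
        (gt_mem_nhds (tsub_pos_of_lt hab))
      filter_upwards [h2, eventually_Ioo_nhdsLT_one] with r hr hr'
      have h3 := lintegral_poisson_le h1 hδ0 hr'.1 hr'.2 ENNReal.one_ne_top hb'
      rw [lintegral_poisson_arc hr'.1.le hr'.2, mul_one, one_mul,
        lintegral_poisson μ hr'.1.le hr'.2] at h3
      refine h3.trans_lt ?_
      refine (ENNReal.add_lt_add_right hb' hr).trans_le ?_
      rw [tsub_add_cancel_of_le hab.le]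
  have h1 := (ENNReal.tendsto_toReal hlt.ne).comp key
  refine h1.congr' ?_
  filter_upwards [eventually_Ioo_nhdsLT_one] with r hr
  exact ENNReal.toReal_ofReal (re_caratheodory_pos μ (smul_circle_mem_ball hr.1.le hr.2 ζ)).le

/-! ### Herglotz representation and radial limits -/

/-- A sequence of radii increasing to one. -/
noncomputable def radius (n : ℕ) : ℝ := n / (n + 1)

theorem radius_nonneg (n : ℕ) : 0 ≤ radius n := by unfold radius; positivity

theorem radius_lt_one (n : ℕ) : radius n < 1 := by
  unfold radius
  rw [div_lt_one (by positivity)]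
  linarith

theorem tendsto_radius : Tendsto radius atTop (𝓝[<] 1) :=
  tendsto_nhdsWithin_iff.2 ⟨tendsto_natCast_div_add_atTop 1, .of_forall radius_lt_one⟩

theorem tendsto_dilate {g : ℂ → ℂ} (hg : ContinuousOn g (Metric.ball 0 1)) {z : ℂ}
    (hz : z ∈ Metric.ball (0 : ℂ) 1) :
    Tendsto (fun n => g (radius n * z)) atTop (𝓝 (g z)) := by
  have h1 : ContinuousAt g z := hg.continuousAt (Metric.isOpen_ball.mem_nhds hz)
  refine h1.tendsto.comp ?_
  have h2 : Tendsto (fun n => (radius n : ℂ)) atTop (𝓝 ((1 : ℝ) : ℂ)) :=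
    (Complex.continuous_ofReal.tendsto 1).comp (tendsto_nhdsWithin_iff.1 tendsto_radius).1
  simpa using h2.mul_const z

/-- Herglotz's representation theorem. -/
theorem exists_caratheodory_eq {F : ℂ → ℂ} (hF : DifferentiableOn ℂ F (Metric.ball 0 1))
    (hpos : ∀ z ∈ Metric.ball (0 : ℂ) 1, 0 ≤ (F z).re) (h0 : F 0 = 1) :
    ∃ μ : Measure Circle, IsProbabilityMeasure μ ∧
      ∀ z ∈ Metric.ball (0 : ℂ) 1, caratheodory μ z = F z := by
  have hcont : ∀ n, Continuous fun ζ : Circle => (F (radius n * ζ)).re := fun n =>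
    Complex.continuous_re.comp
      (continuous_dilate hF.continuousOn (radius_nonneg n) (radius_lt_one n))
  have hnn : ∀ n (ζ : Circle), 0 ≤ (F (radius n * ζ)).re := fun n ζ =>
    hpos _ (smul_circle_mem_ball (radius_nonneg n) (radius_lt_one n) ζ)
  have hprob : ∀ n, IsProbabilityMeasure
      (arc.withDensity fun ζ : Circle => ENNReal.ofReal (F (radius n * ζ)).re) := by
    intro n
    constructor
    rw [withDensity_apply _ .univ, Measure.restrict_univ,
      ← ofReal_integral_eq_lintegral_ofReal (integrable_of_continuous (hcont n))
        (.of_forall (hnn n)), integral_re_dilate hF (radius_nonneg n) (radius_lt_one n), h0]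
    simp
  let ν : ℕ → ProbabilityMeasure Circle := fun n => ⟨_, hprob n⟩
  -- Weak limit of the densities `Re F(rₙ ζ)` by compactness; a limit along an ultrafilter replaces
  -- a convergent subsequence.
  obtain ⟨μ, -, hμ⟩ := isCompact_univ.ultrafilter_le_nhds ((Ultrafilter.of atTop).map ν)
    (by simp)
  have hμ' : Tendsto ν (Ultrafilter.of (atTop : Filter ℕ)) (𝓝 μ) := hμ
  refine ⟨μ, inferInstance, fun z hz => ?_⟩
  have h1 := (ProbabilityMeasure.tendsto_iff_forall_integral_rclike_tendsto ℂ).1 hμ'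
    (BoundedContinuousFunction.mkOfCompact ⟨_, continuous_herglotz hz⟩)
  have h2 : ∀ n, ∫ ζ, (BoundedContinuousFunction.mkOfCompact ⟨_, continuous_herglotz hz⟩) ζ
      ∂(ν n : Measure Circle) = F (radius n * z) := by
    intro n
    have h3 := schwarz_formula (diffContOnCl_dilate hF (radius_nonneg n) (radius_lt_one n)) hz
    simp only [mul_zero, h0, Complex.one_im, Complex.ofReal_zero, zero_mul, zero_add] at h3
    rw [h3]
    change ∫ ζ, _ ∂(arc.withDensity _) = _
    rw [integral_withDensity_eq_integral_toReal_smul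
      (hcont n).measurable.ennreal_ofReal (.of_forall fun _ => ENNReal.ofReal_lt_top)]
    congr 1
    ext ζ
    rw [ENNReal.toReal_ofReal (hnn n ζ), Complex.real_smul, mul_comm]
    rfl
  simp_rw [h2] at h1
  exact tendsto_nhds_unique h1 ((tendsto_dilate hF.continuousOn hz).mono_left (Ultrafilter.of_le _))

/-- The real part of an analytic function with positive real part has radial limits almost
everywhere. -/
theorem ae_exists_tendsto_re {g : ℂ → ℂ} (hg : DifferentiableOn ℂ g (Metric.ball 0 1))
    (hpos : ∀ z ∈ Metric.ball (0 : ℂ) 1, 0 < (g z).re) :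
    ∀ᵐ ζ : Circle ∂arc, ∃ b : ℝ, Tendsto (fun r : ℝ => (g (r * ζ)).re) (𝓝[<] 1) (𝓝 b) := by
  set c := (g 0).re with hc
  have hc0 : 0 < c := hpos 0 (Metric.mem_ball_self one_pos)
  have hre : ∀ z, ((g z - (g 0).im * Complex.I) / (c : ℂ)).re = (g z).re / c := by
    intro z
    rw [Complex.div_ofReal_re]
    simp
  obtain ⟨μ, hμ, hμF⟩ := exists_caratheodory_eq
    (F := fun z => (g z - (g 0).im * Complex.I) / (c : ℂ))
    ((hg.sub_const _).div_const _)
    (fun z hz => by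
      rw [hre]
      exact (div_pos (hpos z hz) hc0).le)
    (by
      have h1 := Complex.re_add_im (g 0)
      rw [div_eq_one_iff_eq (by exact_mod_cast hc0.ne')]
      rw [sub_eq_iff_eq_add, hc, h1])
  filter_upwards [ae_tendsto_re_caratheodory μ] with ζ hζ
  refine ⟨weight μ ζ * c, (hζ.mul_const c).congr' ?_⟩
  filter_upwards [eventually_Ioo_nhdsLT_one] with r hr
  rw [hμF _ (smul_circle_mem_ball hr.1.le hr.2 ζ), hre, div_mul_cancel₀ _ hc0.ne']

/-- Bounded analytic functions have radial limits almost everywhere. -/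
theorem ae_exists_radial_limit {f : ℂ → ℂ} (hf : DifferentiableOn ℂ f (Metric.ball 0 1))
    (hb : ∀ z ∈ Metric.ball (0 : ℂ) 1, ‖f z‖ ≤ 1) :
    ∀ᵐ ζ : Circle ∂arc, ∃ b : ℂ, Tendsto (fun r : ℝ => f (r * ζ)) (𝓝[<] 1) (𝓝 b) := by
  -- Adding `2` makes the real part positive; multiplication by `-I` treats the imaginary part the
  -- same way.
  have h1 := ae_exists_tendsto_re (g := fun z => f z + 2) (hf.add_const 2) (fun z hz => by
    have := (abs_le.1 ((Complex.abs_re_le_norm _).trans (hb z hz))).1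
    simp only [Complex.add_re, Complex.re_ofNat]
    linarith)
  have h2 := ae_exists_tendsto_re (g := fun z => -Complex.I * f z + 2)
    ((hf.const_mul _).add_const 2) (fun z hz => by
    have := (abs_le.1 ((Complex.abs_im_le_norm _).trans (hb z hz))).1
    simp only [neg_mul, Complex.add_re, Complex.neg_re, Complex.mul_re, Complex.I_re, zero_mul,
      Complex.I_im, one_mul, zero_sub, neg_neg, Complex.re_ofNat]
    linarith)
  filter_upwards [h1, h2] with ζ ⟨a, ha⟩ ⟨b, hb⟩
  refine ⟨((a - 2 : ℝ) : ℂ) + ((b - 2 : ℝ) : ℂ) * Complex.I, ?_⟩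
  have h3 := (Complex.continuous_ofReal.tendsto _).comp (ha.sub_const 2)
  have h4 := ((Complex.continuous_ofReal.tendsto _).comp (hb.sub_const 2)).mul_const Complex.I
  refine (h3.add h4).congr fun r => ?_
  simp only [Function.comp_apply, neg_mul, Complex.add_re, Complex.neg_re, Complex.mul_re,
    Complex.I_re, zero_mul, Complex.I_im, one_mul, zero_sub, neg_neg, Complex.re_ofNat,
    add_sub_cancel_right]
  exact Complex.re_add_im _

/-! ### Consequences of Fatou's lemma -/

section Fatou

variable {α : Type*} [MeasurableSpace α] {ν : Measure α}

theorem lintegral_liminf_ne_top {h : ℕ → α → ℝ} (hm : ∀ n, AEMeasurable (h n) ν)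
    {C : ENNReal} (hC : C ≠ ⊤) (hle : ∀ n, ∫⁻ x, ENNReal.ofReal (h n x) ∂ν ≤ C) :
    ∫⁻ x, liminf (fun n => ENNReal.ofReal (h n x)) atTop ∂ν ≠ ⊤ := by
  refine ne_top_of_le_ne_top hC ((lintegral_liminf_le' fun n => (hm n).ennreal_ofReal).trans ?_)
  exact liminf_le_of_le (by isBoundedDefault) fun b hb => by
    obtain ⟨n, hn⟩ := hb.exists
    exact hn.trans (hle n)

/-- Applied to logarithms, this excludes vanishing boundary values outside a null set. -/
theorem ae_not_tendsto_atTop {h : ℕ → α → ℝ} (hm : ∀ n, Measurable (h n))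
    {C : ENNReal} (hC : C ≠ ⊤) (hle : ∀ n, ∫⁻ x, ENNReal.ofReal (h n x) ∂ν ≤ C) :
    ∀ᵐ x ∂ν, ¬ Tendsto (fun n => h n x) atTop atTop := by
  have h1 := ae_lt_top (.liminf fun n => (hm n).ennreal_ofReal)
    (lintegral_liminf_ne_top (fun n => (hm n).aemeasurable) hC hle)
  filter_upwards [h1] with x hx ht
  have := (ENNReal.tendsto_ofReal_atTop.comp ht).liminf_eq
  exact hx.ne this

theorem integrable_of_tendsto_ae {h : ℕ → α → ℝ} {g : α → ℝ} (hm : ∀ n, AEMeasurable (h n) ν)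
    (h0 : ∀ n x, 0 ≤ h n x)
    {C : ENNReal} (hC : C ≠ ⊤) (hle : ∀ n, ∫⁻ x, ENNReal.ofReal (h n x) ∂ν ≤ C)
    (ht : ∀ᵐ x ∂ν, Tendsto (fun n => h n x) atTop (𝓝 (g x))) : Integrable g ν := by
  refine ⟨aestronglyMeasurable_of_tendsto_ae atTop (fun n => (hm n).aestronglyMeasurable) ht, ?_⟩
  have hg : 0 ≤ᵐ[ν] g := by
    filter_upwards [ht] with x hx
    exact ge_of_tendsto' hx fun n => h0 n x
  rw [hasFiniteIntegral_iff_ofReal hg]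
  refine lt_of_le_of_lt (lintegral_mono_ae ?_) (lintegral_liminf_ne_top hm hC hle).lt_top
  filter_upwards [ht] with x hx
  exact (ENNReal.tendsto_ofReal hx).liminf_eq.ge

/-- An `L²` bound makes the sequence uniformly integrable. Concretely, a difference `d` satisfies
`|d| ≤ min |d| M + d² / M`: the first term tends to zero in mean by dominated convergence, the
second is small in mean for large `M`. -/
theorem tendsto_integral_abs_sub [IsFiniteMeasure ν] {h : ℕ → α → ℝ} {g : α → ℝ}
    (hi : ∀ n, Integrable (h n) ν) (hi2 : ∀ n, Integrable (fun x => h n x ^ 2) ν) {K : ℝ}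
    (hK : ∀ n, ∫ x, h n x ^ 2 ∂ν ≤ K)
    (ht : ∀ᵐ x ∂ν, Tendsto (fun n => h n x) atTop (𝓝 (g x))) :
    Integrable g ν ∧ Tendsto (fun n => ∫ x, |h n x - g x| ∂ν) atTop (𝓝 0) := by
  have hgm : AEStronglyMeasurable g ν :=
    aestronglyMeasurable_of_tendsto_ae atTop (fun n => (hi n).aestronglyMeasurable) ht
  have hg2 : Integrable (fun x => g x ^ 2) ν := by
    refine integrable_of_tendsto_ae (h := fun n x => h n x ^ 2)
      (fun n => (hi2 n).aemeasurable) (fun n x => sq_nonneg _) (C := ENNReal.ofReal K)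
      ENNReal.ofReal_ne_top (fun n => ?_) (ht.mono fun x hx => hx.pow 2)
    rw [← ofReal_integral_eq_lintegral_ofReal (hi2 n) (.of_forall fun x => sq_nonneg _)]
    exact ENNReal.ofReal_le_ofReal (hK n)
  have hg : Integrable g ν :=
    ((memLp_two_iff_integrable_sq hgm).2 hg2).integrable (by norm_num)
  refine ⟨hg, ?_⟩
  set K' := 2 * K + 2 * ∫ x, g x ^ 2 ∂ν with hK'
  have hd : ∀ n, Integrable (fun x => |h n x - g x|) ν := fun n => ((hi n).sub hg).abs
  have hdi : ∀ n, Integrable (fun x => 2 * h n x ^ 2 + 2 * g x ^ 2) ν := fun n =>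
    ((hi2 n).const_mul 2).add (hg2.const_mul 2)
  have hsq : ∀ n, ∫ x, (2 * h n x ^ 2 + 2 * g x ^ 2) ∂ν ≤ K' := by
    intro n
    rw [integral_add ((hi2 n).const_mul 2) (hg2.const_mul 2), integral_const_mul,
      integral_const_mul]
    linarith [hK n]
  have hK0 : 0 ≤ K' := (integral_nonneg fun x => by positivity).trans (hsq 0)
  rw [Metric.tendsto_atTop]
  intro ε hε
  -- Chosen so that `K' / M < ε / 2`, also when `K' = 0`.
  set M := (2 * K' + 1) / ε with hM
  have hM0 : 0 < M := by positivity
  have hmin : Tendsto (fun n => ∫ x, min |h n x - g x| M ∂ν) atTop (𝓝 0) := by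
    rw [← integral_zero α ℝ (μ := ν)]
    refine tendsto_integral_of_dominated_convergence (fun _ => M)
      (fun n => ((hd n).aestronglyMeasurable.inf aestronglyMeasurable_const))
      (integrable_const _) (fun n => .of_forall fun x => ?_) ?_
    · rw [Real.norm_of_nonneg (le_min (abs_nonneg _) hM0.le)]
      exact min_le_right _ _
    · filter_upwards [ht] with x hx
      have h1 : Tendsto (fun n => |h n x - g x|) atTop (𝓝 0) := by
        simpa using (hx.sub_const (g x)).abs
      simpa [hM0.le] using h1.min (tendsto_const_nhds (x := M))
  obtain ⟨N, hN⟩ := (Metric.tendsto_atTop.1 hmin) (ε / 2) (half_pos hε)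
  refine ⟨N, fun n hn => ?_⟩
  rw [dist_zero_right, Real.norm_of_nonneg (integral_nonneg fun x => abs_nonneg _)]
  have h1 := (le_abs_self _).trans_lt (by simpa using hN n hn)
  have hmi : Integrable (fun x => min |h n x - g x| M) ν := (hd n).inf (integrable_const M)
  have h2 : ∫ x, |h n x - g x| ∂ν ≤
      ∫ x, (min |h n x - g x| M + M⁻¹ * (2 * h n x ^ 2 + 2 * g x ^ 2)) ∂ν := by
    refine integral_mono (hd n) (hmi.add ((hdi n).const_mul _)) fun x => ?_
    rcases le_total |h n x - g x| M with h3 | h3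
    · simp only [min_eq_left h3]
      have : 0 ≤ M⁻¹ * (2 * h n x ^ 2 + 2 * g x ^ 2) := by positivity
      linarith
    · have h4 : |h n x - g x| ≤ M⁻¹ * (2 * h n x ^ 2 + 2 * g x ^ 2) := by
        rw [inv_mul_eq_div, le_div_iff₀ hM0]
        calc |h n x - g x| * M ≤ |h n x - g x| * |h n x - g x| := by gcongr
          _ = (h n x - g x) ^ 2 := by rw [← sq, sq_abs]
          _ ≤ _ := by nlinarith [sq_nonneg (h n x + g x)]
      have h5 : 0 ≤ min |h n x - g x| M := le_min (abs_nonneg _) hM0.le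
      simp only
      linarith
  rw [integral_add hmi ((hdi n).const_mul _), integral_const_mul] at h2
  have h3 : M⁻¹ * ∫ x, (2 * h n x ^ 2 + 2 * g x ^ 2) ∂ν < ε / 2 := by
    rw [inv_mul_eq_div, div_lt_iff₀ hM0]
    have : ε / 2 * M = K' + 1 / 2 := by rw [hM]; field_simp
    linarith [hsq n]
  linarith

end Fatou

/-! ### Hardy spaces and logarithms -/

/-- The `p`-th power of `y ≤ exp y` at `y = x / (2 p)`. It lets a single exponential moment control
all powers. -/
theorem rpow_le_mul_exp_half {p x : ℝ} (hp : 0 < p) (hx : 0 ≤ x) :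
    x ^ p ≤ (2 * p) ^ p * Real.exp (x / 2) := by
  have h1 : x / (2 * p) ≤ Real.exp (x / (2 * p)) := by
    linarith [Real.add_one_le_exp (x / (2 * p))]
  have h2 : x = 2 * p * (x / (2 * p)) := by field_simp
  calc x ^ p = (2 * p * (x / (2 * p))) ^ p := by rw [← h2]
    _ ≤ (2 * p * Real.exp (x / (2 * p))) ^ p := by gcongr
    _ = (2 * p) ^ p * Real.exp (x / 2) := by
      rw [Real.mul_rpow (by positivity) (by positivity), ← Real.exp_mul]
      congr 2
      field_simp

theorem norm_add_rpow_le {p : ℝ} (hp : 0 ≤ p) (a b : ℂ) :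
    ‖a + b‖ ^ p ≤ 2 ^ p * (‖a‖ ^ p + ‖b‖ ^ p) := by
  have h1 : ‖a + b‖ ≤ 2 * max ‖a‖ ‖b‖ := by
    linarith [norm_add_le a b, le_max_left ‖a‖ ‖b‖, le_max_right ‖a‖ ‖b‖]
  calc ‖a + b‖ ^ p ≤ (2 * max ‖a‖ ‖b‖) ^ p := by gcongr
    _ = 2 ^ p * max ‖a‖ ‖b‖ ^ p := by rw [Real.mul_rpow two_pos.le (by positivity)]
    _ ≤ 2 ^ p * (‖a‖ ^ p + ‖b‖ ^ p) := by
      gcongr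
      rcases max_choice ‖a‖ ‖b‖ with h | h <;> rw [h]
      · linarith [Real.rpow_nonneg (norm_nonneg b) p]
      · linarith [Real.rpow_nonneg (norm_nonneg a) p]

theorem continuous_norm_rpow_dilate {g : ℂ → ℂ} (hg : AnalyticOnNhd ℂ g (Metric.ball 0 1))
    {p : ℝ} (hp : 0 ≤ p) {r : ℝ} (hr0 : 0 ≤ r) (hr : r < 1) :
    Continuous fun ζ : Circle => ‖g (r * ζ)‖ ^ p :=
  (continuous_dilate hg.continuousOn hr0 hr).norm.rpow_const fun _ => .inr hp

theorem MemHardy.add {p : ℝ} (hp : 0 ≤ p) {f g : ℂ → ℂ} (hf : MemHardy p f) (hg : MemHardy p g) :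
    MemHardy p fun z => f z + g z := by
  obtain ⟨hfa, K, hK⟩ := hf
  obtain ⟨hga, K', hK'⟩ := hg
  refine ⟨hfa.add hga, 2 ^ p * (K + K'), fun r hr0 hr => ?_⟩
  have h1 := integrable_of_continuous (μ := arc) (continuous_norm_rpow_dilate hfa hp hr0 hr)
  have h2 := integrable_of_continuous (μ := arc) (continuous_norm_rpow_dilate hga hp hr0 hr)
  refine (integral_mono (integrable_of_continuous
    (continuous_norm_rpow_dilate (hfa.add hga) hp hr0 hr)) ((h1.add h2).const_mul (2 ^ p))
    fun ζ => norm_add_rpow_le hp _ _).trans ?_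
  simp only [Pi.add_apply]
  rw [integral_const_mul, integral_add h1 h2]
  gcongr
  · exact hK r hr0 hr
  · exact hK' r hr0 hr

theorem MemHardy.const (p : ℝ) (c : ℂ) : MemHardy p fun _ => c :=
  ⟨analyticOnNhd_const, ‖c‖ ^ p, fun r _ _ => by simp⟩

theorem MemHardy.neg {p : ℝ} {f : ℂ → ℂ} (hf : MemHardy p f) : MemHardy p fun z => -f z := by
  obtain ⟨hfa, K, hK⟩ := hf
  exact ⟨hfa.neg, K, fun r hr0 hr => by simpa using hK r hr0 hr⟩

theorem MemHardy.congr {p : ℝ} {f g : ℂ → ℂ} (hf : MemHardy p f)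
    (h : Set.EqOn f g (Metric.ball 0 1)) : MemHardy p g := by
  obtain ⟨hfa, K, hK⟩ := hf
  refine ⟨hfa.congr Metric.isOpen_ball h, K, fun r hr0 hr => ?_⟩
  convert hK r hr0 hr using 5 with ζ
  exact (h (smul_circle_mem_ball hr0 hr ζ)).symm

/-- An analytic function whose imaginary part is at most `π / 2` in absolute value belongs to all
Hardy spaces. -/
theorem memHardy_of_abs_im_le {l : ℂ → ℂ} (hl : DifferentiableOn ℂ l (Metric.ball 0 1))
    (him : ∀ z ∈ Metric.ball (0 : ℂ) 1, |(l z).im| ≤ Real.pi / 2) {p : ℝ} (hp : 0 < p) :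
    MemHardy p l := by
  have hla := hl.analyticOnNhd Metric.isOpen_ball
  -- The argument of `exp (c l)` stays within `π / 3`, where the cosine is at least `1 / 2`. So `exp
  -- (c Re l) ≤ 2 Re exp (c l)`, and the right side has a mean value independent of `r`.
  have hexp : ∀ c : ℝ, |c| ≤ 1 / 2 → ∀ r : ℝ, 0 ≤ r → r < 1 →
      ∫ ζ : Circle, Real.exp (c * (l (r * ζ)).re) ∂arc ≤ 2 * (Complex.exp (c * l 0)).re := by
    intro c hc r hr0 hr
    have hd : DifferentiableOn ℂ (fun z => Complex.exp (c * l z)) (Metric.ball 0 1) :=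
      (hl.const_mul _).cexp
    rw [← integral_re_dilate hd hr0 hr, ← integral_const_mul]
    have hcl := continuous_dilate hl.continuousOn hr0 hr
    refine integral_mono (integrable_of_continuous ?_) (integrable_of_continuous ?_) fun ζ => ?_
    · exact Real.continuous_exp.comp (continuous_const.mul (Complex.continuous_re.comp hcl))
    · exact continuous_const.mul (Complex.continuous_re.comp
        (Complex.continuous_exp.comp (continuous_const.mul hcl)))
    · simp only [Complex.exp_re, Complex.re_ofReal_mul, Complex.im_ofReal_mul]
      have h1 := him _ (smul_circle_mem_ball hr0 hr ζ)
      have h2 : |c * (l (r * ζ)).im| ≤ Real.pi / 3 := by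
        rw [abs_mul]
        nlinarith [abs_nonneg c, abs_nonneg (l (r * ζ)).im, Real.pi_pos]
      have h3 : 1 / 2 ≤ Real.cos (c * (l (r * ζ)).im) := by
        rw [← Real.cos_abs, ← Real.cos_pi_div_three]
        exact Real.cos_le_cos_of_nonneg_of_le_pi (abs_nonneg _) (by linarith [Real.pi_pos]) h2
      nlinarith [Real.exp_pos (c * (l (r * ζ)).re)]
  have h1 := hexp (1 / 2) (by norm_num)
  have h2 := hexp (-(1 / 2)) (by norm_num)
  refine ⟨hla, (2 * p) ^ p * Real.exp (Real.pi / 4) * (2 * (Complex.exp ((1 / 2 : ℝ) * l 0)).re +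
    2 * (Complex.exp ((-(1 / 2) : ℝ) * l 0)).re), fun r hr0 hr => ?_⟩
  have hcl := continuous_dilate hl.continuousOn hr0 hr
  have hi : ∀ c : ℝ, Integrable (fun ζ : Circle => Real.exp (c * (l (r * ζ)).re)) arc := fun c =>
    integrable_of_continuous
      (Real.continuous_exp.comp (continuous_const.mul (Complex.continuous_re.comp hcl)))
  refine (integral_mono (integrable_of_continuous (continuous_norm_rpow_dilate hla hp.le hr0 hr))
    (((hi (1 / 2)).add (hi (-(1 / 2)))).const_mul ((2 * p) ^ p * Real.exp (Real.pi / 4)))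
    fun ζ => ?_).trans ?_
  · simp only [Pi.add_apply]
    refine (rpow_le_mul_exp_half hp (norm_nonneg _)).trans ?_
    rw [mul_assoc]
    gcongr
    have h3 := him _ (smul_circle_mem_ball hr0 hr ζ)
    have h4 := Complex.norm_le_abs_re_add_abs_im (l (r * ζ))
    calc Real.exp (‖l (r * ζ)‖ / 2)
        ≤ Real.exp (Real.pi / 4 + |(l (r * ζ)).re| / 2) := by
          apply Real.exp_le_exp.2
          linarith
      _ = Real.exp (Real.pi / 4) * Real.exp (|(l (r * ζ)).re| / 2) := Real.exp_add _ _
      _ ≤ _ := by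
        gcongr
        rcases abs_choice (l (r * ζ)).re with h | h <;> rw [h]
        · rw [div_eq_inv_mul, inv_eq_one_div]
          linarith [Real.exp_pos (-(1 / 2) * (l (r * ζ)).re)]
        · rw [show -(l (r * ζ)).re / 2 = -(1 / 2) * (l (r * ζ)).re by ring]
          linarith [Real.exp_pos ((1 / 2) * (l (r * ζ)).re)]
  · simp only [Pi.add_apply]
    rw [integral_const_mul, integral_add (hi _) (hi _)]
    gcongr
    · exact h1 r hr0 hr
    · exact h2 r hr0 hr

theorem memHardy_log {g : ℂ → ℂ} (hg : DifferentiableOn ℂ g (Metric.ball 0 1))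
    (hpos : ∀ z ∈ Metric.ball (0 : ℂ) 1, 0 < (g z).re) {p : ℝ} (hp : 0 < p) :
    MemHardy p fun z => Complex.log (g z) := by
  refine memHardy_of_abs_im_le (hg.clog fun z hz => .inl (hpos z hz)) (fun z hz => ?_) hp
  rw [Complex.log_im, Complex.abs_arg_le_pi_div_two_iff]
  exact (hpos z hz).le

/-- The bound defining a Hardy space, along the sequence of radii. -/
theorem MemHardy.exists_lintegral_le {p : ℝ} (hp : 0 ≤ p) {g : ℂ → ℂ} (hg : MemHardy p g) :
    ∃ C : ENNReal, C ≠ ⊤ ∧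
      ∀ n, ∫⁻ ζ : Circle, ENNReal.ofReal (‖g (radius n * ζ)‖ ^ p) ∂arc ≤ C := by
  obtain ⟨hga, K, hK⟩ := hg
  refine ⟨ENNReal.ofReal K, ENNReal.ofReal_ne_top, fun n => ?_⟩
  rw [← ofReal_integral_eq_lintegral_ofReal (integrable_of_continuous
    (continuous_norm_rpow_dilate hga hp (radius_nonneg n) (radius_lt_one n)))
    (.of_forall fun _ => by positivity)]
  exact ENNReal.ofReal_le_ofReal (hK _ (radius_nonneg n) (radius_lt_one n))

/-- Radial limits of an analytic function with positive real part do not vanish, up to a null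
set. -/
theorem ae_radial_limit_ne_zero {g : ℂ → ℂ} (hg : DifferentiableOn ℂ g (Metric.ball 0 1))
    (hpos : ∀ z ∈ Metric.ball (0 : ℂ) 1, 0 < (g z).re) :
    ∀ᵐ ζ : Circle ∂arc, ¬ Tendsto (fun r : ℝ => g (r * ζ)) (𝓝[<] 1) (𝓝 0) := by
  have hH := memHardy_log hg hpos one_pos
  obtain ⟨C, hC, hle⟩ := hH.exists_lintegral_le zero_le_one
  have h1 := ae_not_tendsto_atTop (ν := arc)
    (h := fun n (ζ : Circle) => ‖Complex.log (g (radius n * ζ))‖ ^ (1 : ℝ))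
    (fun n => (continuous_norm_rpow_dilate hH.1 zero_le_one (radius_nonneg n)
      (radius_lt_one n)).measurable) hC hle
  filter_upwards [h1] with ζ hζ ht
  apply hζ
  have hne : ∀ n, g (radius n * ζ) ≠ 0 := fun n h => by
    have := hpos _ (smul_circle_mem_ball (radius_nonneg n) (radius_lt_one n) ζ)
    rw [h] at this
    exact lt_irrefl _ this
  have h2 : Tendsto (fun n => ‖g (radius n * ζ)‖) atTop (𝓝[>] 0) := by
    refine tendsto_nhdsWithin_iff.2 ⟨?_, .of_forall fun n => norm_pos_iff.2 (hne n)⟩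
    simpa using (ht.comp tendsto_radius).norm
  have h3 : Tendsto (fun n => -Real.log ‖g (radius n * ζ)‖) atTop atTop :=
    tendsto_neg_atBot_atTop.comp (Real.tendsto_log_nhdsGT_zero.comp h2)
  refine tendsto_atTop_mono (fun n => ?_) h3
  rw [Real.rpow_one, ← Complex.log_re]
  exact (neg_le_abs _).trans (Complex.abs_re_le_norm _)

/-- Differentiating the equality of exponentials gives `L' = M'`, and the disc is connected. Hence
membership in `H^p` need only be checked for one branch. -/
theorem log_unique {L M : ℂ → ℂ} (hL : AnalyticOnNhd ℂ L (Metric.ball 0 1))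
    (hM : AnalyticOnNhd ℂ M (Metric.ball 0 1))
    (h : ∀ z ∈ Metric.ball (0 : ℂ) 1, Complex.exp (L z) = Complex.exp (M z)) :
    ∃ c : ℂ, ∀ z ∈ Metric.ball (0 : ℂ) 1, L z = M z + c := by
  refine ⟨L 0 - M 0, fun z hz => ?_⟩
  have hd : DifferentiableOn ℂ (fun z => L z - M z) (Metric.ball 0 1) :=
    hL.differentiableOn.sub hM.differentiableOn
  have hconst := Metric.isOpen_ball.is_const_of_deriv_eq_zero
    (convex_ball (0 : ℂ) 1).isPreconnected hd (fun w hw => ?_) hz (Metric.mem_ball_self one_pos)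
  · rw [← hconst]
    ring
  · have h1 := ((hL w hw).differentiableAt).hasDerivAt
    have h2 := ((hM w hw).differentiableAt).hasDerivAt
    have h3 : (fun z => Complex.exp (L z)) =ᶠ[𝓝 w] fun z => Complex.exp (M z) := by
      filter_upwards [Metric.isOpen_ball.mem_nhds hw] with z hz using h z hz
    have h4 := (h1.cexp.congr_of_eventuallyEq h3.symm).unique h2.cexp
    rw [h w hw] at h4
    have h5 := mul_left_cancel₀ (Complex.exp_ne_zero _) h4
    rw [(h1.fun_sub h2).deriv, h5, sub_self]
    rfl

/-! ### Schur functions and the Schur algorithm -/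

/-- Schur functions: analytic functions from the disc to the closed disc. -/
structure IsSchur (f : ℂ → ℂ) : Prop where
  diff : DifferentiableOn ℂ f (Metric.ball 0 1)
  norm_le : ∀ z ∈ Metric.ball (0 : ℂ) 1, ‖f z‖ ≤ 1

theorem zero_mem_disc : (0 : ℂ) ∈ Metric.ball (0 : ℂ) 1 := Metric.mem_ball_self one_pos

theorem differentiableOn_dslope_disc {g : ℂ → ℂ} (hg : DifferentiableOn ℂ g (Metric.ball 0 1)) :
    DifferentiableOn ℂ (dslope g 0) (Metric.ball 0 1) :=
  (Complex.differentiableOn_dslope (Metric.isOpen_ball.mem_nhds zero_mem_disc)).2 hg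

/-- This is the Schwarz lemma. -/
theorem IsSchur.dslope {g : ℂ → ℂ} (hg : IsSchur g) (h0 : g 0 = 0) : IsSchur (dslope g 0) := by
  refine ⟨differentiableOn_dslope_disc hg.diff, fun z hz => ?_⟩
  simpa using Complex.norm_dslope_le_div_of_mapsTo_ball (R₂ := 1) hg.diff
    (fun w hw => by simpa [h0] using hg.norm_le w hw) hz

theorem mul_dslope_zero {g : ℂ → ℂ} (h0 : g 0 = 0) (z : ℂ) : z * dslope g 0 z = g z := by
  have := sub_smul_dslope g 0 z
  simpa [h0] using this

/-- Identities obtained by cancelling a factor `z` extend to the origin by continuity. -/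
theorem eqOn_disc_of_ne_zero {f g : ℂ → ℂ} (hf : ContinuousOn f (Metric.ball 0 1))
    (hg : ContinuousOn g (Metric.ball 0 1))
    (hne : ∀ z ∈ Metric.ball (0 : ℂ) 1, z ≠ 0 → f z = g z) : Set.EqOn f g (Metric.ball 0 1) := by
  intro z hz
  by_cases hz0 : z = 0
  · subst hz0
    have hc1 := hf.continuousAt (Metric.isOpen_ball.mem_nhds hz)
    have hc2 := hg.continuousAt (Metric.isOpen_ball.mem_nhds hz)
    refine tendsto_nhds_unique (hc1.tendsto.mono_left (nhdsWithin_le_nhds (s := {0}ᶜ))) ?_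
    refine (hc2.tendsto.mono_left nhdsWithin_le_nhds).congr' ?_
    filter_upwards [self_mem_nhdsWithin, nhdsWithin_le_nhds (Metric.isOpen_ball.mem_nhds hz)]
      with w hw0 hw
    exact (hne w hw hw0).symm
  · exact hne z hz hz0

theorem re_one_sub_pos {w : ℂ} (hw : ‖w‖ < 1) : 0 < (1 - w).re := by
  have := (le_abs_self w.re).trans (Complex.abs_re_le_norm w)
  simp only [Complex.sub_re, Complex.one_re]
  linarith

theorem one_sub_ne_zero {w : ℂ} (hw : ‖w‖ < 1) : 1 - w ≠ 0 := fun h => by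
  have := re_one_sub_pos hw
  rw [h] at this
  exact lt_irrefl _ this

theorem one_add_ne_zero {w : ℂ} (hw : ‖w‖ < 1) : 1 + w ≠ 0 := by
  have := one_sub_ne_zero (w := -w) (by rwa [norm_neg])
  rwa [sub_neg_eq_add] at this

theorem norm_mul_lt_one {z w : ℂ} (hz : ‖z‖ < 1) (hw : ‖w‖ ≤ 1) : ‖z * w‖ < 1 := by
  rw [norm_mul]
  nlinarith [norm_nonneg z, norm_nonneg w]

theorem norm_conj_mul_lt_one {a w : ℂ} (ha : ‖a‖ < 1) (hw : ‖w‖ ≤ 1) : ‖conj a * w‖ < 1 :=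
  norm_mul_lt_one (by rwa [RCLike.norm_conj]) hw

/-- The fundamental identity for disc automorphisms. -/
theorem norm_moebius_identity (a w : ℂ) :
    ‖1 - conj a * w‖ ^ 2 - ‖w - a‖ ^ 2 = (1 - ‖a‖ ^ 2) * (1 - ‖w‖ ^ 2) := by
  rw [← Complex.normSq_eq_norm_sq, ← Complex.normSq_eq_norm_sq, ← Complex.normSq_eq_norm_sq,
    ← Complex.normSq_eq_norm_sq]
  simp only [Complex.normSq_apply, Complex.sub_re, Complex.sub_im, Complex.mul_re, Complex.mul_im,
    Complex.conj_re, Complex.conj_im, Complex.one_re, Complex.one_im]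
  ring

theorem norm_moebius_le_one {a w : ℂ} (ha : ‖a‖ < 1) (hw : ‖w‖ ≤ 1) :
    ‖(w - a) / (1 - conj a * w)‖ ≤ 1 := by
  have h1 := norm_moebius_identity a w
  have h2 : 0 < ‖1 - conj a * w‖ :=
    norm_pos_iff.2 (one_sub_ne_zero (norm_conj_mul_lt_one ha hw))
  rw [norm_div, div_le_one h2]
  have h3 : 0 ≤ (1 - ‖a‖ ^ 2) * (1 - ‖w‖ ^ 2) :=
    mul_nonneg (by nlinarith [norm_nonneg a]) (by nlinarith [norm_nonneg w])
  exact le_of_sq_le_sq (by linarith) h2.le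

/-- The Schur algorithm. -/
noncomputable def schurStep (f : ℂ → ℂ) : ℂ → ℂ :=
  _root_.dslope (fun z => (f z - f 0) / (1 - conj (f 0) * f z)) 0

theorem IsSchur.step {f : ℂ → ℂ} (hf : IsSchur f) (h0 : ‖f 0‖ < 1) : IsSchur (schurStep f) := by
  refine IsSchur.dslope ⟨?_, fun z hz => norm_moebius_le_one h0 (hf.norm_le z hz)⟩ (by simp)
  exact (hf.diff.sub_const _).div ((hf.diff.const_mul _).const_sub 1)
    fun z hz => one_sub_ne_zero (norm_conj_mul_lt_one h0 (hf.norm_le z hz))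

theorem mul_schurStep (f : ℂ → ℂ) (z : ℂ) :
    z * schurStep f z = (f z - f 0) / (1 - conj (f 0) * f z) :=
  mul_dslope_zero (g := fun z => (f z - f 0) / (1 - conj (f 0) * f z)) (by simp) z

theorem IsSchur.mul_step {f : ℂ → ℂ} (hf : IsSchur f) (h0 : ‖f 0‖ < 1) {z : ℂ}
    (hz : z ∈ Metric.ball (0 : ℂ) 1) :
    z * schurStep f z * (1 - conj (f 0) * f z) = f z - f 0 := by
  rw [mul_schurStep, div_mul_cancel₀ _
    (one_sub_ne_zero (norm_conj_mul_lt_one h0 (hf.norm_le z hz)))]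

theorem IsSchur.norm_mul_lt {f : ℂ → ℂ} (hf : IsSchur f) {z : ℂ}
    (hz : z ∈ Metric.ball (0 : ℂ) 1) : ‖z * f z‖ < 1 :=
  norm_mul_lt_one (by simpa using hz) (hf.norm_le z hz)

/-- `f` is recovered from its Schur iterate. -/
theorem IsSchur.eq_inv_step {f : ℂ → ℂ} (hf : IsSchur f) (h0 : ‖f 0‖ < 1) {z : ℂ}
    (hz : z ∈ Metric.ball (0 : ℂ) 1) :
    f z = (f 0 + z * schurStep f z) / (1 + conj (f 0) * (z * schurStep f z)) := by
  have h1 := hf.mul_step h0 hz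
  have h2 : 1 + conj (f 0) * (z * schurStep f z) ≠ 0 :=
    one_add_ne_zero (norm_conj_mul_lt_one h0 ((hf.step h0).norm_mul_lt hz).le)
  rw [eq_div_iff h2]
  linear_combination -h1

section Measure

variable (μ : Measure Circle) [IsProbabilityMeasure μ]

theorem caratheodory_add_one_ne_zero {z : ℂ} (hz : z ∈ Metric.ball (0 : ℂ) 1) :
    caratheodory μ z + 1 ≠ 0 := fun h => by
  have h1 := re_caratheodory_pos μ hz
  have h2 := congrArg Complex.re h
  simp only [Complex.add_re, Complex.one_re, Complex.zero_re] at h2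
  linarith

/-- The Cayley transform sends the right half-plane, where `F` takes its values, into the disc; the
Schwarz lemma then permits division by `z`. -/
theorem isSchur_schur : IsSchur (schur μ) := by
  refine IsSchur.dslope ⟨?_, fun z hz => ?_⟩ (by simp [caratheodory_zero])
  · exact ((differentiableOn_caratheodory μ).sub_const 1).div
      ((differentiableOn_caratheodory μ).add_const 1)
      fun z hz => caratheodory_add_one_ne_zero μ hz
  · have h1 := re_caratheodory_pos μ hz
    rw [norm_div, div_le_one (norm_pos_iff.2 (caratheodory_add_one_ne_zero μ hz))]
    refine le_of_sq_le_sq ?_ (norm_nonneg _)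
    rw [← Complex.normSq_eq_norm_sq, ← Complex.normSq_eq_norm_sq]
    simp only [Complex.normSq_apply, Complex.sub_re, Complex.sub_im, Complex.add_re,
      Complex.add_im, Complex.one_re, Complex.one_im]
    nlinarith

theorem mul_schur (z : ℂ) : z * schur μ z = (caratheodory μ z - 1) / (caratheodory μ z + 1) :=
  mul_dslope_zero (g := fun z => (caratheodory μ z - 1) / (caratheodory μ z + 1))
    (by simp [caratheodory_zero]) z

theorem caratheodory_mul {z : ℂ} (hz : z ∈ Metric.ball (0 : ℂ) 1) :
    caratheodory μ z * (1 - z * schur μ z) = 1 + z * schur μ z := by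
  have h1 := caratheodory_add_one_ne_zero μ hz
  rw [mul_schur]
  field_simp
  ring

/-- In the radial limit this becomes the formula for the weight in terms of the boundary values of
the Schur function. -/
theorem re_caratheodory_eq {z : ℂ} (hz : z ∈ Metric.ball (0 : ℂ) 1) :
    (caratheodory μ z).re = (1 - ‖z * schur μ z‖ ^ 2) / ‖1 - z * schur μ z‖ ^ 2 := by
  have h1 := one_sub_ne_zero ((isSchur_schur μ).norm_mul_lt hz)
  rw [eq_div_iff_mul_eq h1 |>.2 (caratheodory_mul μ hz), Complex.div_re, ← add_div]
  rw [← Complex.normSq_eq_norm_sq, ← Complex.normSq_eq_norm_sq]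
  congr 1
  simp only [Complex.normSq_apply, Complex.sub_re, Complex.sub_im, Complex.add_re,
      Complex.add_im, Complex.one_re, Complex.one_im]
  ring

end Measure

/-- A probability measure is constructed from its Schur function. -/
theorem IsSchur.exists_measure {f : ℂ → ℂ} (hf : IsSchur f) :
    ∃ μ : Measure Circle, IsProbabilityMeasure μ ∧
      Set.EqOn (schur μ) f (Metric.ball 0 1) := by
  have hzf : DifferentiableOn ℂ (fun z => z * f z) (Metric.ball 0 1) :=
    differentiableOn_id.mul hf.diff
  obtain ⟨μ, hμ, hF⟩ := exists_caratheodory_eq (F := fun z => (1 + z * f z) / (1 - z * f z))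
    ((hzf.const_add 1).div (hzf.const_sub 1) fun z hz => one_sub_ne_zero (hf.norm_mul_lt hz))
    (fun z hz => by
      have h1 := hf.norm_mul_lt hz
      rw [Complex.div_re, ← add_div]
      refine div_nonneg ?_ (Complex.normSq_nonneg _)
      have h2 : Complex.normSq (z * f z) ≤ 1 := by
        rw [Complex.normSq_eq_norm_sq]
        nlinarith [norm_nonneg (z * f z)]
      rw [Complex.normSq_apply] at h2
      simp only [Complex.sub_re, Complex.sub_im, Complex.add_re, Complex.add_im, Complex.one_re,
        Complex.one_im]
      nlinarith)
    (by simp)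
  refine ⟨μ, hμ, ?_⟩
  have hne : ∀ z ∈ Metric.ball (0 : ℂ) 1, z ≠ 0 → schur μ z = f z := by
    intro z hz hz0
    have h1 := one_sub_ne_zero (hf.norm_mul_lt hz)
    have h2 := mul_schur μ z
    rw [hF z hz] at h2
    have h3 : (1 + z * f z) / (1 - z * f z) + 1 = 2 / (1 - z * f z) := by
      field_simp
      ring
    have h4 : (1 + z * f z) / (1 - z * f z) - 1 = 2 * (z * f z) / (1 - z * f z) := by
      field_simp
      ring
    rw [h3, h4, div_div_div_cancel_right₀ h1, mul_div_cancel_left₀ _ two_ne_zero] at h2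
    exact mul_left_cancel₀ hz0 h2
  exact eqOn_disc_of_ne_zero (isSchur_schur μ).diff.continuousOn hf.diff.continuousOn hne

theorem conj_mul_self_circle (ζ : Circle) : conj (ζ : ℂ) * ζ = 1 := by
  rw [mul_comm, Complex.mul_conj, Circle.normSq_coe, Complex.ofReal_one]

/-! ### Inner product of polynomials -/

section Inner

variable {μ : Measure Circle}

theorem continuous_eval (P : ℂ[X]) : Continuous fun ζ : Circle => P.eval (ζ : ℂ) :=
  P.continuous.comp continuous_coe

theorem continuous_conj_eval_mul (P Q : ℂ[X]) :
    Continuous fun ζ : Circle => conj (P.eval (ζ : ℂ)) * Q.eval (ζ : ℂ) :=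
  (Complex.continuous_conj.comp (continuous_eval P)).mul (continuous_eval Q)

theorem polyInner_add_right [IsFiniteMeasure μ] (P Q R : ℂ[X]) :
    polyInner μ P (Q + R) = polyInner μ P Q + polyInner μ P R := by
  simp only [polyInner, eval_add, mul_add]
  exact integral_add (integrable_of_continuous (continuous_conj_eval_mul P Q))
    (integrable_of_continuous (continuous_conj_eval_mul P R))

theorem polyInner_C_mul_right (P Q : ℂ[X]) (c : ℂ) :
    polyInner μ P (C c * Q) = c * polyInner μ P Q := by
  simp only [polyInner, eval_mul, eval_C, mul_left_comm _ c]
  exact integral_const_mul _ _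

theorem polyInner_sub_right [IsFiniteMeasure μ] (P Q R : ℂ[X]) :
    polyInner μ P (Q - R) = polyInner μ P Q - polyInner μ P R := by
  simp only [polyInner, eval_sub, mul_sub]
  exact integral_sub (integrable_of_continuous (continuous_conj_eval_mul P Q))
    (integrable_of_continuous (continuous_conj_eval_mul P R))

theorem polyInner_sum_right [IsFiniteMeasure μ] {ι : Type*} (s : Finset ι) (P : ℂ[X]) (Q : ι → ℂ[X]) :
    polyInner μ P (∑ i ∈ s, Q i) = ∑ i ∈ s, polyInner μ P (Q i) := by
  simp only [polyInner, eval_finsetSum, Finset.mul_sum]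
  exact integral_finsetSum _ fun i _ => integrable_of_continuous (continuous_conj_eval_mul P (Q i))

theorem polyInner_conj_symm (P Q : ℂ[X]) : conj (polyInner μ P Q) = polyInner μ Q P := by
  rw [polyInner, polyInner, ← integral_conj]
  congr 1
  ext ζ
  simp [mul_comm]

theorem polyInner_self (P : ℂ[X]) : polyInner μ P P = ((polyNorm μ P ^ 2 : ℝ) : ℂ) := by
  rw [polyNorm, Real.sq_sqrt (integral_nonneg fun ζ => by positivity), polyInner]
  refine Eq.trans ?_ integral_ofReal
  congr 1
  ext ζ
  rw [mul_comm, Complex.mul_conj, Complex.normSq_eq_norm_sq]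
  rfl

theorem polyInner_X_mul (P Q : ℂ[X]) : polyInner μ (X * P) (X * Q) = polyInner μ P Q := by
  rw [polyInner, polyInner]
  congr 1
  ext ζ
  simp only [eval_mul, eval_X, map_mul]
  linear_combination conj (P.eval (ζ : ℂ)) * Q.eval (ζ : ℂ) * conj_mul_self_circle ζ

theorem ae_eval_eq_zero [IsFiniteMeasure μ] {P : ℂ[X]} (h : polyNorm μ P = 0) : 
    ∀ᵐ ζ : Circle ∂μ, P.eval (ζ : ℂ) = 0 := by
  have hnn : ∀ ζ : Circle, 0 ≤ ‖P.eval (ζ : ℂ)‖ ^ 2 := fun ζ => by positivity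
  rw [polyNorm, Real.sqrt_eq_zero (integral_nonneg hnn)] at h
  have h1 := (integral_eq_zero_iff_of_nonneg hnn
    (integrable_of_continuous ((continuous_eval P).norm.pow 2))).1 h
  filter_upwards [h1] with ζ hζ
  simpa using hζ

theorem polyInner_eq_zero_of_ae {P Q : ℂ[X]} (h : ∀ᵐ ζ : Circle ∂μ, Q.eval (ζ : ℂ) = 0) :
    polyInner μ P Q = 0 := by
  rw [polyInner, integral_eq_zero_of_ae]
  filter_upwards [h] with ζ hζ
  simp [hζ]

end Inner

/-! ### Reversed polynomials -/

section Star

theorem eval_map_conj (P : ℂ[X]) (z : ℂ) :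
    (P.map (starRingEnd ℂ)).eval (conj z) = conj (P.eval z) := by
  rw [eval_map, eval₂_at_apply]

/-- On the circle, `P*(ζ) = ζⁿ conj (P ζ)`. -/
theorem eval_starPoly {n : ℕ} {P : ℂ[X]} (hP : P.natDegree ≤ n) (ζ : Circle) :
    (starPoly n P).eval (ζ : ℂ) = (ζ : ℂ) ^ n * conj (P.eval (ζ : ℂ)) := by
  have h1 := conj_mul_self_circle ζ
  -- Reflection is evaluated at an inverse, and on the circle `ζ` is the inverse of its conjugate.
  let _ : Invertible (conj (ζ : ℂ)) := ⟨ζ, by rw [mul_comm, h1], h1⟩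
  have h2 := eval₂_reflect_mul_pow (RingHom.id ℂ) (conj (ζ : ℂ)) n (P.map (starRingEnd ℂ))
    (natDegree_map_le.trans hP)
  have h3 : ⅟ (conj (ζ : ℂ)) = ζ := rfl
  rw [h3, ← eval, ← eval, eval_map_conj] at h2
  rw [starPoly, ← h2, mul_left_comm, ← mul_pow, mul_comm (ζ : ℂ), h1, one_pow, mul_one]

theorem natDegree_starPoly_le {n : ℕ} {P : ℂ[X]} (hP : P.natDegree ≤ n) :
    (starPoly n P).natDegree ≤ n := by
  rw [natDegree_le_iff_coeff_eq_zero]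
  intro k hk
  rw [starPoly, coeff_reflect, revAt_eq_self_of_lt hk, coeff_map,
    coeff_eq_zero_of_natDegree_lt (hP.trans_lt hk), map_zero]

theorem starPoly_X_mul {n : ℕ} {P : ℂ[X]} (hP : P.natDegree ≤ n) :
    starPoly (n + 1) (X * P) = starPoly n P := by
  have h1 : reflect 1 (X : ℂ[X]) = 1 := by
    simp
  rw [starPoly, Polynomial.map_mul, map_X, add_comm,
    reflect_mul _ _ natDegree_X_le (natDegree_map_le.trans hP), h1, one_mul, starPoly]

/-- Reversal at order `n` is an involution; the second reversal, at order one higher, leaves an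
extra factor `X`. -/
theorem starPoly_starPoly_succ {n : ℕ} {P : ℂ[X]} (hP : P.natDegree ≤ n) :
    starPoly (n + 1) (starPoly n P) = X * P := by
  have h1 : reflect 1 (1 : ℂ[X]) = X := by
    simp
  have h2 : (starPoly n P).map (starRingEnd ℂ) = reflect n P := by
    rw [starPoly, ← reflect_map, Polynomial.map_map]
    simp
  have h3 : reflect n (reflect n P) = P := by
    ext k
    rw [coeff_reflect, coeff_reflect, revAt_invol]
  have h4 : (reflect n P).natDegree ≤ n := by
    rw [natDegree_le_iff_coeff_eq_zero]
    intro k hk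
    rw [coeff_reflect, revAt_eq_self_of_lt hk, coeff_eq_zero_of_natDegree_lt (hP.trans_lt hk)]
  have h5 := reflect_mul (1 : ℂ[X]) (reflect n P) (F := 1) (G := n) (by simp) h4
  rw [one_mul, h1, h3] at h5
  rw [starPoly, h2, add_comm, h5]

theorem starPoly_sub (n : ℕ) (P Q : ℂ[X]) : starPoly n (P - Q) = starPoly n P - starPoly n Q := by
  simp [starPoly, Polynomial.map_sub, reflect_sub]

theorem starPoly_C_mul (n : ℕ) (c : ℂ) (P : ℂ[X]) :
    starPoly n (C c * P) = C (conj c) * starPoly n P := by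
  simp [starPoly, Polynomial.map_mul, reflect_C_mul]

theorem starPoly_eval_zero {n : ℕ} {P : ℂ[X]} : (starPoly n P).eval 0 = conj (P.coeff n) := by
  rw [← coeff_zero_eq_eval_zero, starPoly, coeff_reflect, revAt_zero, coeff_map]

end Star

/-! ### Orthogonal polynomials and the Szegő recursion -/

theorem monicOP_eq (μ : Measure Circle) (n : ℕ) :
    monicOP μ n = X ^ n - ∑ k : Fin n,
      C (polyInner μ (monicOP μ k) (X ^ n) / polyInner μ (monicOP μ k) (monicOP μ k)) *
        monicOP μ k := by
  rw [monicOP]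

theorem degree_monicOP_sub_lt (μ : Measure Circle) (n : ℕ) :
    ((X : ℂ[X]) ^ n - monicOP μ n).degree < (n : WithBot ℕ) := by
  induction n using Nat.strong_induction_on with
  | _ n ih =>
    rw [monicOP_eq, sub_sub_cancel]
    refine (degree_sum_le _ _).trans_lt ((Finset.sup_lt_iff (WithBot.bot_lt_coe n)).2 fun k _ => ?_)
    have h1 := ih k k.isLt
    have h2 : (monicOP μ k).degree ≤ (k : ℕ) := by
      have : monicOP μ k = X ^ (k : ℕ) - (X ^ (k : ℕ) - monicOP μ k) := by ring
      rw [this]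
      exact (degree_sub_le _ _).trans (max_le (degree_X_pow_le _) h1.le)
    rw [← smul_eq_C_mul]
    refine (degree_smul_le _ _).trans_lt (h2.trans_lt ?_)
    exact WithBot.coe_lt_coe.2 k.isLt

theorem monicOP_monic (μ : Measure Circle) (n : ℕ) : (monicOP μ n).Monic := by
  have h := monic_X_pow_sub (degree_monicOP_sub_lt μ n)
  rwa [sub_sub_cancel] at h

theorem degree_monicOP (μ : Measure Circle) (n : ℕ) : (monicOP μ n).degree = n := by
  have h : monicOP μ n = X ^ n - (X ^ n - monicOP μ n) := by ring
  rw [h, degree_sub_eq_left_of_degree_lt (by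
    rw [degree_X_pow]; exact degree_monicOP_sub_lt μ n), degree_X_pow]

theorem natDegree_monicOP (μ : Measure Circle) (n : ℕ) : (monicOP μ n).natDegree = n :=
  natDegree_eq_of_degree_eq_some (degree_monicOP μ n)

theorem monicOP_zero (μ : Measure Circle) : monicOP μ 0 = 1 := by
  rw [monicOP_eq]
  simp

theorem coeff_monicOP (μ : Measure Circle) (n : ℕ) : (monicOP μ n).coeff n = 1 := by
  have := monicOP_monic μ n
  rwa [Monic, leadingCoeff, natDegree_monicOP] at this

section Orthogonality

variable {μ : Measure Circle}

theorem polyInner_self_ne_zero {P : ℂ[X]} (h : polyNorm μ P ≠ 0) : polyInner μ P P ≠ 0 := by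
  rw [polyInner_self]
  exact_mod_cast pow_ne_zero 2 h

/-- Here and below only finitely many norms are assumed nonzero, so that the results can serve in
the inductive proof that a measure is nontrivial. -/
theorem polyInner_monicOP_eq_zero [IsFiniteMeasure μ] {n : ℕ} (hN : ∀ k < n, polyNorm μ (monicOP μ k) ≠ 0) :
    ∀ k < n, polyInner μ (monicOP μ k) (monicOP μ n) = 0 := by
  induction n using Nat.strong_induction_on with
  | _ n ih =>
    intro k hk
    rw [monicOP_eq μ n, polyInner_sub_right, polyInner_sum_right,
      Finset.sum_eq_single_of_mem (⟨k, hk⟩ : Fin n) (Finset.mem_univ _)]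
    · rw [polyInner_C_mul_right, div_mul_cancel₀ _ (polyInner_self_ne_zero (hN k hk)), sub_self]
    · intro j _ hj
      rw [polyInner_C_mul_right]
      rcases lt_or_gt_of_ne (fun h => hj (Fin.ext h) : (j : ℕ) ≠ k) with h | h
      · rw [← polyInner_conj_symm (monicOP μ j) (monicOP μ k), ih k hk (fun i hi => hN i (hi.trans hk)) j h, map_zero, mul_zero]
      · rw [ih j j.isLt (fun i hi => hN i (hi.trans j.isLt)) k h, mul_zero]

theorem polyInner_monicOP_X_pow [IsFiniteMeasure μ] {n : ℕ} (hN : ∀ k < n, polyNorm μ (monicOP μ k) ≠ 0) :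
    ∀ k < n, polyInner μ (monicOP μ n) (X ^ k) = 0 := by
  intro k hk
  have h1 : (X : ℂ[X]) ^ k = monicOP μ k + ∑ j : Fin k,
      C (polyInner μ (monicOP μ j) (X ^ k) / polyInner μ (monicOP μ j) (monicOP μ j)) *
        monicOP μ j := by
    rw [monicOP_eq μ k]
    ring
  have h2 : ∀ j < n, polyInner μ (monicOP μ n) (monicOP μ j) = 0 := fun j hj => by
    rw [← polyInner_conj_symm, polyInner_monicOP_eq_zero hN j hj, map_zero]
  rw [h1, polyInner_add_right, h2 k hk, polyInner_sum_right, zero_add]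
  refine Finset.sum_eq_zero fun j _ => ?_
  rw [polyInner_C_mul_right, h2 j (j.isLt.trans hk), mul_zero]

/-- `Φₙ` is orthogonal to all polynomials of smaller degree. -/
theorem polyInner_monicOP_of_degree_lt [IsFiniteMeasure μ] {n : ℕ} (hN : ∀ k < n, polyNorm μ (monicOP μ k) ≠ 0)
    {P : ℂ[X]} (hP : P.degree < n) : polyInner μ (monicOP μ n) P = 0 := by
  rw [P.as_sum_range_C_mul_X_pow, polyInner_sum_right]
  refine Finset.sum_eq_zero fun k _ => ?_
  rw [polyInner_C_mul_right]
  rcases lt_or_ge k n with h | h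
  · rw [polyInner_monicOP_X_pow hN k h, mul_zero]
  · rw [coeff_eq_zero_of_degree_lt (hP.trans_le (by exact_mod_cast h)), zero_mul]

theorem polyInner_monicOP_of_natDegree_le [IsFiniteMeasure μ] {n : ℕ} (hN : ∀ k < n, polyNorm μ (monicOP μ k) ≠ 0)
    {P : ℂ[X]} (hP : P.natDegree ≤ n) :
    polyInner μ (monicOP μ n) P = P.coeff n * polyInner μ (monicOP μ n) (monicOP μ n) := by
  have h1 : (P - C (P.coeff n) * monicOP μ n).degree < n := by
    rw [degree_lt_iff_coeff_zero]
    intro k hk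
    rw [coeff_sub, coeff_C_mul]
    rcases hk.eq_or_lt with rfl | hk
    · rw [coeff_monicOP, mul_one, sub_self]
    · rw [coeff_eq_zero_of_natDegree_lt (hP.trans_lt hk),
        coeff_eq_zero_of_natDegree_lt (p := monicOP μ n) (by rwa [natDegree_monicOP]), mul_zero,
        sub_self]
  have h2 := polyInner_monicOP_of_degree_lt hN h1
  rwa [polyInner_sub_right, polyInner_C_mul_right, sub_eq_zero] at h2

/-- A polynomial that vanishes almost everywhere is zero, up to the first degree in which an
orthogonal polynomial has norm zero. -/
theorem eq_zero_of_ae_eval_eq_zero [IsFiniteMeasure μ] {n : ℕ} (hN : ∀ k ≤ n, polyNorm μ (monicOP μ k) ≠ 0)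
    {P : ℂ[X]} (hP : P.natDegree ≤ n) (h0 : ∀ᵐ ζ : Circle ∂μ, P.eval (ζ : ℂ) = 0) : P = 0 := by
  have h1 := polyInner_monicOP_of_natDegree_le (P := P)
    (fun k hk => hN k (hk.le.trans hP)) le_rfl
  rw [polyInner_eq_zero_of_ae h0, eq_comm, mul_eq_zero] at h1
  rcases h1 with h1 | h1
  · exact leadingCoeff_eq_zero.1 h1
  · exact absurd h1 (polyInner_self_ne_zero (hN _ hP))

/-- `Φₙ*` is orthogonal to `ζ, …, ζⁿ`. -/
theorem polyInner_X_pow_starPoly {n : ℕ} (P : ℂ[X]) (hP : P.natDegree ≤ n) {k : ℕ} (hk : k ≤ n) :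
    polyInner μ (X ^ k) (starPoly n P) = polyInner μ P (X ^ (n - k)) := by
  rw [polyInner, polyInner]
  congr 1
  ext ζ
  rw [eval_starPoly hP]
  simp only [eval_pow, eval_X, map_pow]
  have h1 : (ζ : ℂ) ^ n = (ζ : ℂ) ^ k * (ζ : ℂ) ^ (n - k) := by rw [← pow_add, Nat.add_sub_cancel' hk]
  have h2 : conj (ζ : ℂ) ^ k * (ζ : ℂ) ^ k = 1 := by
    rw [← mul_pow, conj_mul_self_circle, one_pow]
  rw [h1]
  linear_combination (ζ : ℂ) ^ (n - k) * conj (P.eval (ζ : ℂ)) * h2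

/-- The Szegő recursion. -/
theorem monicOP_succ [IsFiniteMeasure μ] {n : ℕ} (hN : ∀ k ≤ n, polyNorm μ (monicOP μ k) ≠ 0) :
    monicOP μ (n + 1) =
      X * monicOP μ n - C (conj (verblunsky μ n)) * starPoly n (monicOP μ n) := by
  set Φ := monicOP μ n with hΦ
  have hΦd : Φ.natDegree = n := natDegree_monicOP μ n
  have hstar0 : (starPoly n Φ).coeff 0 = 1 := by
    rw [coeff_zero_eq_eval_zero, starPoly_eval_zero, coeff_monicOP, map_one]
  -- The defect `S` has degree at most `n`, no constant term, and is orthogonal to `ζ, …, ζⁿ`. Hence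
  -- it is orthogonal to itself.
  set S := monicOP μ (n + 1) - (X * Φ - C (conj (verblunsky μ n)) * starPoly n Φ) with hS
  have hSdeg : S.natDegree ≤ n := by
    rw [natDegree_le_iff_coeff_eq_zero]
    intro k hk
    have h1 : (starPoly n Φ).coeff k = 0 :=
      coeff_eq_zero_of_natDegree_lt ((natDegree_starPoly_le hΦd.le).trans_lt hk)
    obtain ⟨j, rfl⟩ := Nat.exists_eq_add_of_lt hk
    rw [hS, coeff_sub, coeff_sub, coeff_C_mul, h1, coeff_X_mul]
    rcases Nat.eq_zero_or_pos j with rfl | hj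
    · rw [add_zero, coeff_monicOP, coeff_monicOP, mul_zero, sub_zero, sub_self]
    · rw [coeff_eq_zero_of_natDegree_lt (by rw [natDegree_monicOP]; omega),
        coeff_eq_zero_of_natDegree_lt (by rw [hΦd]; omega), mul_zero, sub_zero, sub_zero]
  have hS0 : S.coeff 0 = 0 := by
    rw [hS, coeff_sub, coeff_sub, coeff_C_mul, hstar0, coeff_X_mul_zero, verblunsky,
      coeff_zero_eq_eval_zero]
    simp
  have hSX : ∀ k, 1 ≤ k → k ≤ n → polyInner μ (X ^ k) S = 0 := by
    intro k hk1 hk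
    obtain ⟨j, rfl⟩ := Nat.exists_eq_add_of_le' hk1
    have h1 : polyInner μ (X ^ (j + 1)) (monicOP μ (n + 1)) = 0 := by
      rw [← polyInner_conj_symm, polyInner_monicOP_X_pow (fun i hi => hN i (by omega)) _ (by omega),
        map_zero]
    have h2 : polyInner μ (X ^ (j + 1)) (X * Φ) = 0 := by
      rw [pow_succ', polyInner_X_mul, ← polyInner_conj_symm,
        polyInner_monicOP_X_pow (fun i hi => hN i hi.le) _ (by omega), map_zero]
    rw [hS, polyInner_sub_right, polyInner_sub_right, polyInner_C_mul_right, h1, h2,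
      polyInner_X_pow_starPoly Φ hΦd.le hk,
      polyInner_monicOP_X_pow (fun i hi => hN i hi.le) _ (by omega)]
    simp
  have hSS : polyInner μ S S = 0 := by
    conv_lhs => arg 3; rw [S.as_sum_range_C_mul_X_pow]
    rw [polyInner_sum_right]
    refine Finset.sum_eq_zero fun k hk => ?_
    rw [polyInner_C_mul_right]
    rcases Nat.eq_zero_or_pos k with rfl | hk0
    · rw [hS0, zero_mul]
    · rw [← polyInner_conj_symm, hSX k hk0 (by
        rw [Finset.mem_range] at hk; omega), map_zero, mul_zero]
  have hnorm : polyNorm μ S = 0 := by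
    rw [polyInner_self] at hSS
    exact pow_eq_zero_iff two_ne_zero |>.1 (by exact_mod_cast hSS)
  exact sub_eq_zero.1 (eq_zero_of_ae_eval_eq_zero hN hSdeg (ae_eval_eq_zero hnorm))

theorem starPoly_monicOP_succ [IsFiniteMeasure μ] {n : ℕ} (hN : ∀ k ≤ n, polyNorm μ (monicOP μ k) ≠ 0) :
    starPoly (n + 1) (monicOP μ (n + 1)) =
      starPoly n (monicOP μ n) - C (verblunsky μ n) * (X * monicOP μ n) := by
  have hd := (natDegree_monicOP μ n).le
  rw [monicOP_succ hN, starPoly_sub, starPoly_C_mul, starPoly_X_mul hd,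
    starPoly_starPoly_succ hd, Complex.conj_conj]

theorem polyNorm_starPoly {n : ℕ} {P : ℂ[X]} (hP : P.natDegree ≤ n) :
    polyNorm μ (starPoly n P) = polyNorm μ P := by
  rw [polyNorm, polyNorm]
  congr 2
  ext ζ
  rw [eval_starPoly hP, norm_mul, norm_pow, Circle.norm_coe, one_pow, one_mul, RCLike.norm_conj]

/-- The recursion for the norms of the orthogonal polynomials. -/
theorem polyNorm_monicOP_succ_sq [IsFiniteMeasure μ] {n : ℕ} (hN : ∀ k ≤ n, polyNorm μ (monicOP μ k) ≠ 0) :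
    polyNorm μ (monicOP μ (n + 1)) ^ 2 =
      (1 - ‖verblunsky μ n‖ ^ 2) * polyNorm μ (monicOP μ n) ^ 2 := by
  set Φ := monicOP μ n
  set α := verblunsky μ n
  have hd := (natDegree_monicOP μ n).le
  -- Pythagoras: the summands are orthogonal, and neither multiplication by `ζ` nor reversal changes
  -- the norm.
  have h1 : X * Φ = monicOP μ (n + 1) + C (conj α) * starPoly n Φ := by
    rw [monicOP_succ hN]
    ring
  have h2 : polyInner μ (monicOP μ (n + 1)) (starPoly n Φ) = 0 := by
    refine polyInner_monicOP_of_degree_lt (fun k hk => hN k (by omega)) ?_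
    refine degree_le_natDegree.trans_lt ?_
    exact_mod_cast Nat.lt_succ_of_le (natDegree_starPoly_le hd)
  have h3 : polyInner μ (starPoly n Φ) (monicOP μ (n + 1)) = 0 := by
    rw [← polyInner_conj_symm, h2, map_zero]
  have h4 : polyInner μ (X * Φ) (X * Φ) = polyInner μ (monicOP μ (n + 1)) (monicOP μ (n + 1)) +
      conj α * α * polyInner μ (starPoly n Φ) (starPoly n Φ) := by
    conv_lhs => arg 3; rw [h1]
    rw [polyInner_add_right, polyInner_C_mul_right,
      ← polyInner_conj_symm (monicOP μ (n + 1)) (X * Φ),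
      ← polyInner_conj_symm (starPoly n Φ) (X * Φ), h1, polyInner_add_right, polyInner_add_right,
      polyInner_C_mul_right, polyInner_C_mul_right, h2, h3]
    simp only [map_add, map_mul, Complex.conj_conj, polyInner_conj_symm, map_zero]
    ring
  rw [polyInner_X_mul, polyInner_self, polyInner_self, polyInner_self, polyNorm_starPoly hd,
    mul_comm (conj α), Complex.mul_conj, Complex.normSq_eq_norm_sq] at h4
  have h5 : polyNorm μ Φ ^ 2 = polyNorm μ (monicOP μ (n + 1)) ^ 2 +
      ‖α‖ ^ 2 * polyNorm μ Φ ^ 2 := by exact_mod_cast h4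
  linarith

theorem norm_verblunsky_lt_one [IsFiniteMeasure μ] {n : ℕ} (hN : ∀ k ≤ n + 1, polyNorm μ (monicOP μ k) ≠ 0) :
    ‖verblunsky μ n‖ < 1 := by
  have h1 := polyNorm_monicOP_succ_sq (fun k hk => hN k (by omega) : ∀ k ≤ n, _)
  have h2 : 0 < polyNorm μ (monicOP μ (n + 1)) ^ 2 := by
    have := hN (n + 1) le_rfl
    positivity
  have h3 : 0 < polyNorm μ (monicOP μ n) ^ 2 := by
    have := hN n (by omega)
    positivity
  rw [h1] at h2
  have h4 := (pos_iff_pos_of_mul_pos h2).2 h3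
  nlinarith [norm_nonneg (verblunsky μ n)]

theorem polyNorm_monicOP_zero {μ : Measure Circle} [IsProbabilityMeasure μ] :
    polyNorm μ (monicOP μ 0) = 1 := by
  simp [polyNorm, monicOP_zero]

/-- The orthogonal polynomials of a nontrivial measure do not vanish in `L²`. -/
theorem IsNontrivialProb.polyNorm_ne_zero {μ : Measure Circle} (hμ : IsNontrivialProb μ) (n : ℕ) :
    polyNorm μ (monicOP μ n) ≠ 0 := by
  intro h
  have := hμ.isProb
  have h1 := ae_eval_eq_zero h
  have h2 : {ζ : Circle | (monicOP μ n).eval (ζ : ℂ) = 0}.Finite := by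
    refine Set.Finite.subset (((monicOP μ n).roots.toFinset.finite_toSet).preimage
      (f := fun ζ : Circle => (ζ : ℂ)) Circle.coe_injective.injOn) fun ζ hζ => ?_
    simpa [(monicOP_monic μ n).ne_zero] using hζ
  exact hμ.not_finite _ h2 h1

/-- A probability measure whose orthogonal polynomials do not vanish in `L²` is nontrivial. -/
theorem isNontrivialProb_of_polyNorm_ne_zero {μ : Measure Circle} [IsProbabilityMeasure μ]
    (hN : ∀ n, polyNorm μ (monicOP μ n) ≠ 0) : IsNontrivialProb μ := by
  refine ⟨inferInstance, fun s hs h => ?_⟩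
  set Q : ℂ[X] := ∏ ζ ∈ hs.toFinset, (X - C (ζ : ℂ)) with hQ
  have hQ0 : Q ≠ 0 := (monic_prod_of_monic _ _ fun ζ _ => monic_X_sub_C _).ne_zero
  refine hQ0 (eq_zero_of_ae_eval_eq_zero (n := Q.natDegree) (fun k _ => hN k) le_rfl ?_)
  have h1 : ∀ᵐ ζ ∂μ, ζ ∈ s := h
  filter_upwards [h1] with ζ hζ
  rw [hQ, eval_prod]
  exact Finset.prod_eq_zero (hs.mem_toFinset.2 hζ) (by simp)

end Orthogonality

/-! ### Cauchy transforms and Geronimus' theorem -/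

section Transforms

variable (μ : Measure Circle)

/-- The Cauchy transform of `ζ⁻ⁿ Φₙ`. -/
noncomputable def cauchyOP (n : ℕ) (z : ℂ) : ℂ :=
  ∫ ζ : Circle, conj (ζ : ℂ) ^ n * (monicOP μ n).eval (ζ : ℂ) * (ζ : ℂ) / ((ζ : ℂ) - z) ∂μ

/-- The Cauchy transform of `ζ⁻⁽ⁿ⁺¹⁾ Φₙ*`. -/
noncomputable def cauchyStar (n : ℕ) (z : ℂ) : ℂ :=
  ∫ ζ : Circle, conj (ζ : ℂ) ^ (n + 1) * (starPoly n (monicOP μ n)).eval (ζ : ℂ) * (ζ : ℂ) /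
    ((ζ : ℂ) - z) ∂μ

theorem continuous_cauchy_numerator (n : ℕ) (P : ℂ[X]) :
    Continuous fun ζ : Circle => conj (ζ : ℂ) ^ n * P.eval (ζ : ℂ) * (ζ : ℂ) :=
  (((Complex.continuous_conj.comp continuous_coe).pow n).mul (continuous_eval P)).mul
    continuous_coe

variable {μ} [IsFiniteMeasure μ]

theorem differentiableOn_cauchyOP (n : ℕ) :
    DifferentiableOn ℂ (cauchyOP μ n) (Metric.ball 0 1) :=
  differentiableOn_cauchy_integral (continuous_cauchy_numerator n _)

theorem differentiableOn_cauchyStar (n : ℕ) :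
    DifferentiableOn ℂ (cauchyStar μ n) (Metric.ball 0 1) :=
  differentiableOn_cauchy_integral (continuous_cauchy_numerator (n + 1) _)

theorem integrable_cauchy (n : ℕ) (P : ℂ[X]) {z : ℂ} (hz : z ∈ Metric.ball (0 : ℂ) 1) :
    Integrable (fun ζ : Circle => conj (ζ : ℂ) ^ n * P.eval (ζ : ℂ) * (ζ : ℂ) / ((ζ : ℂ) - z)) μ :=
  integrable_of_continuous ((continuous_cauchy_numerator n P).div
    (continuous_coe.sub continuous_const) (sub_ne_zero_of_mem_ball hz))

theorem cauchyOP_succ {n : ℕ} (hN : ∀ k ≤ n, polyNorm μ (monicOP μ k) ≠ 0) {z : ℂ}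
    (hz : z ∈ Metric.ball (0 : ℂ) 1) :
    cauchyOP μ (n + 1) z = cauchyOP μ n z - conj (verblunsky μ n) * cauchyStar μ n z := by
  rw [cauchyOP, cauchyOP, cauchyStar, ← integral_const_mul,
    ← integral_sub (integrable_cauchy n _ hz) ((integrable_cauchy (n + 1) _ hz).const_mul _)]
  congr 1
  ext ζ
  have h1 := sub_ne_zero_of_mem_ball hz ζ
  rw [monicOP_succ hN, ← mul_div_assoc, ← sub_div]
  congr 1
  simp only [eval_sub, eval_mul, eval_C, eval_X]
  linear_combination conj (ζ : ℂ) ^ n * (monicOP μ n).eval (ζ : ℂ) * ζ * conj_mul_self_circle ζ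

/-- Write `z / (ζ - z) = ζ / (ζ - z) - 1`. The constant term contributes nothing since `Φₙ₊₁*` is
orthogonal to `ζⁿ⁺¹`, and the rest is the Szegő recursion. -/
theorem mul_cauchyStar_succ {n : ℕ} (hN : ∀ k ≤ n, polyNorm μ (monicOP μ k) ≠ 0) {z : ℂ}
    (hz : z ∈ Metric.ball (0 : ℂ) 1) :
    z * cauchyStar μ (n + 1) z = cauchyStar μ n z - verblunsky μ n * cauchyOP μ n z := by
  have h1 : ∫ ζ : Circle, conj (ζ : ℂ) ^ (n + 1) *
      (starPoly (n + 1) (monicOP μ (n + 1))).eval (ζ : ℂ) ∂μ = 0 := by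
    have h2 := polyInner_X_pow_starPoly (μ := μ) (monicOP μ (n + 1))
      (natDegree_monicOP μ (n + 1)).le le_rfl
    rw [polyInner_monicOP_X_pow (fun i hi => hN i (by omega)) _ (by omega), polyInner] at h2
    simpa using h2
  have hi : Integrable (fun ζ : Circle => conj (ζ : ℂ) ^ (n + 1) *
      (starPoly (n + 1) (monicOP μ (n + 1))).eval (ζ : ℂ)) μ :=
    integrable_of_continuous (((Complex.continuous_conj.comp continuous_coe).pow _).mul
      (continuous_eval _))
  rw [← sub_zero (z * _), ← neg_zero, ← h1, sub_neg_eq_add, cauchyOP, cauchyStar, cauchyStar,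
    ← integral_const_mul, ← integral_const_mul,
    ← integral_add ((integrable_cauchy (n + 2) _ hz).const_mul _) hi,
    ← integral_sub (integrable_cauchy (n + 1) _ hz) ((integrable_cauchy n _ hz).const_mul _)]
  congr 1
  ext ζ
  have h3 := sub_ne_zero_of_mem_ball hz ζ
  rw [starPoly_monicOP_succ hN, ← mul_div_assoc, ← mul_div_assoc, ← sub_div,
    div_add' _ _ _ h3]
  congr 1
  simp only [eval_sub, eval_mul, eval_C, eval_X]
  have h4 := conj_mul_self_circle ζ
  generalize (starPoly n (monicOP μ n)).eval (ζ : ℂ) = s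
  generalize (monicOP μ n).eval (ζ : ℂ) = p
  generalize verblunsky μ n = a
  linear_combination (conj (ζ : ℂ) ^ (n + 1) * (s - a * (ζ * p)) * z
    - a * conj (ζ : ℂ) ^ n * p * ζ) * h4

theorem cauchyOP_zero_apply {n : ℕ} (hN : ∀ k < n, polyNorm μ (monicOP μ k) ≠ 0) :
    cauchyOP μ n 0 = polyInner μ (monicOP μ n) (monicOP μ n) := by
  have h1 : cauchyOP μ n 0 = polyInner μ (X ^ n) (monicOP μ n) := by
    rw [cauchyOP, polyInner]
    congr 1
    ext ζ
    simp
  rw [h1, ← polyInner_conj_symm, polyInner_monicOP_of_natDegree_le hN (natDegree_X_pow_le n),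
    coeff_X_pow_self, one_mul, polyInner_conj_symm]

theorem cauchyStar_zero_apply {n : ℕ} (hN : ∀ k ≤ n, polyNorm μ (monicOP μ k) ≠ 0) :
    cauchyStar μ n 0 = verblunsky μ n * cauchyOP μ n 0 := by
  have h := mul_cauchyStar_succ hN zero_mem_disc
  rw [zero_mul, eq_comm, sub_eq_zero] at h
  exact h

/-- The transform of `Φₙ` at the origin is `‖Φₙ‖² ≠ 0`, so the ratio of the transforms there is well
defined. This reads off the Schur parameter. -/
theorem eq_verblunsky_of_cauchyStar_zero {n : ℕ} (hN : ∀ k ≤ n, polyNorm μ (monicOP μ k) ≠ 0)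
    {c : ℂ} (h : cauchyStar μ n 0 = c * cauchyOP μ n 0) : c = verblunsky μ n := by
  rw [cauchyStar_zero_apply hN] at h
  refine (mul_right_cancel₀ ?_ h).symm
  rw [cauchyOP_zero_apply fun k hk => hN k hk.le]
  exact polyInner_self_ne_zero (hN n le_rfl)

end Transforms

theorem schurStep_congr {f g : ℂ → ℂ} (h : Set.EqOn f g (Metric.ball 0 1)) :
    Set.EqOn (schurStep f) (schurStep g) (Metric.ball 0 1) := by
  have h0 : f 0 = g 0 := h zero_mem_disc
  have hq : Set.EqOn (fun z => (f z - f 0) / (1 - conj (f 0) * f z))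
      (fun z => (g z - g 0) / (1 - conj (g 0) * g z)) (Metric.ball 0 1) := by
    intro z hz
    simp only [h0, h hz]
  intro z hz
  by_cases hz0 : z = 0
  · subst hz0
    rw [schurStep, schurStep, dslope_same, dslope_same]
    exact (hq.eventuallyEq_of_mem (Metric.isOpen_ball.mem_nhds hz)).deriv_eq
  · rw [schurStep, schurStep, dslope_of_ne _ hz0, dslope_of_ne _ hz0, slope_def_field,
      slope_def_field]
    simp only [h0, h hz]

/-- The Schur parameters of a function. -/
noncomputable def schurParam (f : ℂ → ℂ) (n : ℕ) : ℂ := (schurStep^[n] f) 0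

theorem schurParam_zero (f : ℂ → ℂ) : schurParam f 0 = f 0 := rfl

theorem schurParam_step (f : ℂ → ℂ) (n : ℕ) :
    schurParam (schurStep f) n = schurParam f (n + 1) := by
  rw [schurParam, schurParam, Function.iterate_succ_apply]

theorem schurParam_congr {f g : ℂ → ℂ} (h : Set.EqOn f g (Metric.ball 0 1)) (n : ℕ) :
    schurParam f n = schurParam g n := by
  induction n generalizing f g with
  | zero => exact h zero_mem_disc
  | succ n ih => rw [← schurParam_step, ← schurParam_step, ih (schurStep_congr h)]

/-- Geronimus' theorem, in the form of an identity between Cauchy transforms. -/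
theorem geronimus_aux {μ : Measure Circle} [IsProbabilityMeasure μ] (n : ℕ)
    (hN : ∀ k ≤ n, polyNorm μ (monicOP μ k) ≠ 0) :
    IsSchur (schurStep^[n] (schur μ)) ∧ (schurStep^[n] (schur μ)) 0 = verblunsky μ n ∧
      ∀ z ∈ Metric.ball (0 : ℂ) 1,
        cauchyStar μ n z = (schurStep^[n] (schur μ)) z * cauchyOP μ n z := by
  suffices h : IsSchur (schurStep^[n] (schur μ)) ∧ Set.EqOn (cauchyStar μ n)
      (fun z => (schurStep^[n] (schur μ)) z * cauchyOP μ n z) (Metric.ball 0 1) from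
    ⟨h.1, eq_verblunsky_of_cauchyStar_zero hN (h.2 zero_mem_disc), h.2⟩
  induction n with
  | zero =>
    refine ⟨isSchur_schur μ, eqOn_disc_of_ne_zero
      (differentiableOn_cauchyStar 0).continuousOn
      ((isSchur_schur μ).diff.mul (differentiableOn_cauchyOP 0)).continuousOn fun z hz hz0 => ?_⟩
    -- For `n = 0` the transforms are essentially `F + 1` and `F - 1`, whose ratio is `z f` by
    -- definition.
    have h1 : 2 * cauchyOP μ 0 z = caratheodory μ z + 1 := by
      rw [caratheodory_eq hz, cauchyOP]
      simp [monicOP_zero]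
    have h2 : 2 * (z * cauchyStar μ 0 z) = caratheodory μ z - 1 := by
      have hk : Integrable (fun ζ : Circle => (ζ : ℂ) / ((ζ : ℂ) - z)) μ :=
        integrable_of_continuous (continuous_coe.div (continuous_coe.sub continuous_const)
          (sub_ne_zero_of_mem_ball hz))
      have h3 : z * cauchyStar μ 0 z = ∫ ζ : Circle, ((ζ : ℂ) / ((ζ : ℂ) - z) - 1) ∂μ := by
        rw [cauchyStar, ← integral_const_mul]
        congr 1
        ext ζ
        have h4 := sub_ne_zero_of_mem_ball hz ζ
        have h5 := conj_mul_self_circle ζ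
        have h6 : (starPoly 0 (monicOP μ 0)).eval (ζ : ℂ) = 1 := by
          rw [eval_starPoly (by rw [natDegree_monicOP]), monicOP_zero]
          simp
        rw [h6, zero_add, pow_one, mul_one, h5]
        field_simp
        ring
      rw [h3, integral_sub hk (integrable_const _), caratheodory_eq hz]
      simp
      ring
    have h3 := mul_schur μ z
    rw [eq_div_iff (caratheodory_add_one_ne_zero μ hz), ← h1, ← h2] at h3
    apply mul_left_cancel₀ (mul_ne_zero two_ne_zero hz0)
    rw [Function.iterate_zero, id_eq]
    linear_combination -h3
  | succ n ih =>
    have hN' : ∀ k ≤ n, polyNorm μ (monicOP μ k) ≠ 0 := fun k hk => hN k (by omega)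
    obtain ⟨hS, heq⟩ := ih hN'
    have h0 : (schurStep^[n] (schur μ)) 0 = verblunsky μ n :=
      eq_verblunsky_of_cauchyStar_zero hN' (heq zero_mem_disc)
    have hlt : ‖(schurStep^[n] (schur μ)) 0‖ < 1 := by
      rw [h0]
      exact norm_verblunsky_lt_one hN
    rw [Function.iterate_succ_apply']
    refine ⟨hS.step hlt, eqOn_disc_of_ne_zero (differentiableOn_cauchyStar _).continuousOn
      ((hS.step hlt).diff.mul (differentiableOn_cauchyOP _)).continuousOn fun z hz hz0 => ?_⟩
    -- With `fₙ` the current iterate and `Cₙ` the transform of `Φₙ`, the recursions give `z C*ₙ₊₁ =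
    -- (fₙ - αₙ) Cₙ` and `Cₙ₊₁ = (1 - conj αₙ fₙ) Cₙ`; the quotient is the Schur step.
    apply mul_left_cancel₀ hz0
    have h1 := hS.mul_step hlt hz
    have h2 := heq hz
    simp only at h2
    rw [mul_cauchyStar_succ hN' hz, cauchyOP_succ hN' hz, h2]
    rw [h0] at h1
    linear_combination -cauchyOP μ n z * h1

theorem IsNontrivialProb.isSchur_iterate {μ : Measure Circle} (hμ : IsNontrivialProb μ) (n : ℕ) :
    IsSchur (schurStep^[n] (schur μ)) :=
  have := hμ.isProb
  (geronimus_aux n fun k _ => hμ.polyNorm_ne_zero k).1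

/-- Geronimus' theorem: the Schur parameters are the Verblunsky coefficients. -/
theorem IsNontrivialProb.schurParam_eq {μ : Measure Circle} (hμ : IsNontrivialProb μ) (n : ℕ) :
    schurParam (schur μ) n = verblunsky μ n :=
  have := hμ.isProb
  (geronimus_aux n fun k _ => hμ.polyNorm_ne_zero k).2.1

theorem IsNontrivialProb.norm_verblunsky_lt_one {μ : Measure Circle} (hμ : IsNontrivialProb μ)
    (n : ℕ) : ‖verblunsky μ n‖ < 1 :=
  have := hμ.isProb
  OPUC.norm_verblunsky_lt_one fun k _ => hμ.polyNorm_ne_zero k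

/-- A measure whose Schur parameters lie in the open disc is nontrivial. -/
theorem isNontrivialProb_of_schurParam {μ : Measure Circle} [IsProbabilityMeasure μ]
    (h : ∀ n, ‖schurParam (schur μ) n‖ < 1) : IsNontrivialProb μ := by
  refine isNontrivialProb_of_polyNorm_ne_zero fun n => ?_
  suffices hk : ∀ k ≤ n, polyNorm μ (monicOP μ k) ≠ 0 from hk n le_rfl
  induction n with
  | zero =>
    intro k hk
    rw [Nat.le_zero.1 hk, polyNorm_monicOP_zero]
    exact one_ne_zero
  | succ n ih =>
    intro k hk
    rcases hk.lt_or_eq with hk | rfl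
    · exact ih k (by omega)
    · have h1 := polyNorm_monicOP_succ_sq ih
      have h2 : ‖verblunsky μ n‖ < 1 := by
        have := h n
        rwa [schurParam, (geronimus_aux n ih).2.1] at this
      have h3 : 0 < polyNorm μ (monicOP μ n) ^ 2 := by
        have := ih n le_rfl
        positivity
      intro h4
      rw [h4] at h1
      have h5 : 0 < 1 - ‖verblunsky μ n‖ ^ 2 := by nlinarith [norm_nonneg (verblunsky μ n)]
      have := mul_pos h5 h3
      rw [← h1] at this
      simp at this

/-- Existence of the measure with the shifted Verblunsky coefficients. -/
theorem IsNontrivialProb.exists_isStripped {μ : Measure Circle} (hμ : IsNontrivialProb μ) :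
    ∃ μ₁ : Measure Circle, IsStripped μ μ₁ := by
  have := hμ.isProb
  have h1 : IsSchur (schurStep (schur μ)) := hμ.isSchur_iterate 1
  -- The Schur iterate of `f` carries exactly the shifted parameters.
  obtain ⟨μ₁, hprob, heq⟩ := h1.exists_measure
  have h2 : ∀ n, schurParam (schur μ₁) n = verblunsky μ (n + 1) := fun n => by
    rw [schurParam_congr heq, schurParam_step, hμ.schurParam_eq]
  have h3 : IsNontrivialProb μ₁ := isNontrivialProb_of_schurParam fun n => by
    rw [h2]
    exact hμ.norm_verblunsky_lt_one _
  exact ⟨μ₁, h3, fun j => by rw [← h3.schurParam_eq, h2]⟩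

/-! ### Schur approximants and uniqueness -/

/-- The Schur approximants: the Schur function with the given first `n` parameters, continued by
zero. -/
noncomputable def schurApprox : (ℕ → ℂ) → ℕ → ℂ → ℂ
  | _, 0, _ => 0
  | γ, n + 1, z => (γ 0 + z * schurApprox (fun k => γ (k + 1)) n z) /
      (1 + conj (γ 0) * (z * schurApprox (fun k => γ (k + 1)) n z))

/-- The hyperbolic contraction rate of `w ↦ z w` for `‖z‖ = r`. -/
noncomputable def contractionRate (r : ℝ) : ℝ := 2 * r / (1 + r ^ 2)

theorem contractionRate_nonneg {r : ℝ} (hr : 0 ≤ r) : 0 ≤ contractionRate r := by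
  unfold contractionRate
  positivity

theorem contractionRate_lt_one {r : ℝ} (hr : r < 1) : contractionRate r < 1 := by
  unfold contractionRate
  rw [div_lt_one (by positivity)]
  nlinarith [mul_pos (sub_pos.2 hr) (sub_pos.2 hr)]

/-- Equality holds at `c = -1`, the extremal case that determines `contractionRate`. -/
theorem norm_one_sub_le_dilate {r : ℝ} (hr0 : 0 ≤ r) (hr : r ≤ 1) {c : ℂ} (hc : ‖c‖ ≤ 1) :
    (1 + r ^ 2) * ‖1 - c‖ ≤ 2 * ‖1 - (r : ℂ) ^ 2 * c‖ := by
  refine le_of_sq_le_sq ?_ (by positivity)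
  rw [mul_pow, mul_pow, ← Complex.normSq_eq_norm_sq, ← Complex.normSq_eq_norm_sq]
  have h1 : c.re * c.re + c.im * c.im ≤ 1 := by
    rw [← Complex.normSq_apply, Complex.normSq_eq_norm_sq]
    nlinarith [norm_nonneg c]
  rw [← Complex.ofReal_pow]
  simp only [Complex.normSq_apply, Complex.sub_re, Complex.sub_im, Complex.re_ofReal_mul,
    Complex.im_ofReal_mul, Complex.one_re, Complex.one_im]
  have h2 : 0 ≤ 1 - r ^ 2 := by nlinarith
  have h3 : 0 ≤ (1 - r ^ 2) * (1 + r ^ 2) * (1 - (c.re * c.re + c.im * c.im)) :=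
    mul_nonneg (by positivity) (by linarith)
  nlinarith [mul_nonneg h2 h2, sq_nonneg ((1 - r ^ 2) * (1 + c.re)), sq_nonneg ((1 - r ^ 2) * c.im)]

/-- Inverse Schur steps contract the pseudohyperbolic distance. -/
theorem pseudohyperbolic_contraction {α z a b : ℂ} {D : ℝ} (hα : ‖α‖ < 1) (hz : ‖z‖ < 1)
    (ha : ‖a‖ ≤ 1) (hb : ‖b‖ ≤ 1) (h : ‖a - b‖ ≤ D * ‖1 - conj a * b‖) (hD : 0 ≤ D) :
    ‖(α + z * a) / (1 + conj α * (z * a)) - (α + z * b) / (1 + conj α * (z * b))‖ ≤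
      contractionRate ‖z‖ * D *
        ‖1 - conj ((α + z * a) / (1 + conj α * (z * a))) *
          ((α + z * b) / (1 + conj α * (z * b)))‖ := by
  have hu : 1 + conj α * (z * a) ≠ 0 :=
    one_add_ne_zero (norm_conj_mul_lt_one hα (norm_mul_lt_one hz ha).le)
  have hv : 1 + conj α * (z * b) ≠ 0 :=
    one_add_ne_zero (norm_conj_mul_lt_one hα (norm_mul_lt_one hz hb).le)
  have hu' : conj (1 + conj α * (z * a)) ≠ 0 := (_root_.map_ne_zero _).2 hu
  -- In both quantities the Möbius map contributes the same factor in absolute value, so only the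
  -- effect of multiplication by `z` remains.
  have e1 : (α + z * a) / (1 + conj α * (z * a)) - (α + z * b) / (1 + conj α * (z * b)) =
      (1 - α * conj α) * (z * (a - b)) / ((1 + conj α * (z * a)) * (1 + conj α * (z * b))) := by
    rw [div_sub_div _ _ hu hv]
    congr 1
    ring
  have e2 : 1 - conj ((α + z * a) / (1 + conj α * (z * a))) *
      ((α + z * b) / (1 + conj α * (z * b))) =
      (1 - α * conj α) * (1 - conj z * z * (conj a * b)) /
        (conj (1 + conj α * (z * a)) * (1 + conj α * (z * b))) := by
    rw [map_div₀, div_mul_div_comm, one_sub_div (mul_ne_zero hu' hv)]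
    congr 1
    simp only [map_add, map_mul, Complex.conj_conj, map_one]
    ring
  have hc : ‖conj a * b‖ ≤ 1 := by
    rw [norm_mul, RCLike.norm_conj]
    exact mul_le_one₀ ha (norm_nonneg _) hb
  have h1 := norm_one_sub_le_dilate (norm_nonneg z) hz.le hc
  have h2 : conj z * z = (‖z‖ : ℂ) ^ 2 := Complex.conj_mul' z
  rw [e1, e2, norm_div, norm_div, norm_mul, norm_mul, norm_mul, norm_mul, norm_mul, RCLike.norm_conj,
    ← mul_div_assoc, h2]
  refine div_le_div_of_nonneg_right ?_ (by positivity)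
  rw [mul_left_comm (contractionRate ‖z‖ * D)]
  refine mul_le_mul_of_nonneg_left ?_ (norm_nonneg _)
  rw [contractionRate, div_mul_eq_mul_div, div_mul_eq_mul_div, le_div_iff₀ (by positivity)]
  calc ‖z‖ * ‖a - b‖ * (1 + ‖z‖ ^ 2) ≤ ‖z‖ * (D * ‖1 - conj a * b‖) * (1 + ‖z‖ ^ 2) := by gcongr
    _ = ‖z‖ * D * ((1 + ‖z‖ ^ 2) * ‖1 - conj a * b‖) := by ring
    _ ≤ ‖z‖ * D * (2 * ‖1 - (‖z‖ : ℂ) ^ 2 * (conj a * b)‖) := by gcongr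
    _ = _ := by ring

theorem norm_inv_moebius_le_one {α w : ℂ} (hα : ‖α‖ < 1) (hw : ‖w‖ ≤ 1) :
    ‖(α + w) / (1 + conj α * w)‖ ≤ 1 := by
  have := norm_moebius_le_one (a := -α) (by rwa [norm_neg]) hw
  rw [map_neg, neg_mul, sub_neg_eq_add, sub_neg_eq_add] at this
  rwa [add_comm α]

theorem norm_schurApprox_le_one {γ : ℕ → ℂ} (hγ : ∀ k, ‖γ k‖ < 1) {z : ℂ} (hz : ‖z‖ < 1) (n : ℕ) :
    ‖schurApprox γ n z‖ ≤ 1 := by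
  induction n generalizing γ with
  | zero => simp [schurApprox]
  | succ n ih =>
    exact norm_inv_moebius_le_one (hγ 0) (norm_mul_lt_one hz (ih fun k => hγ (k + 1))).le

/-- Function and approximant come from `fₙ` and `0` by the same `n` inverse Schur steps, each
contracting. The bound is kept free of division so that values of modulus one need no separate
treatment. -/
theorem norm_sub_schurApprox_le {f : ℂ → ℂ} (hf : IsSchur f) (h : ∀ n, ‖schurParam f n‖ < 1)
    {z : ℂ} (hz : z ∈ Metric.ball (0 : ℂ) 1) (n : ℕ) :
    ‖f z - schurApprox (schurParam f) n z‖ ≤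
      contractionRate ‖z‖ ^ n * ‖1 - conj (f z) * schurApprox (schurParam f) n z‖ := by
  have hz' : ‖z‖ < 1 := by simpa using hz
  induction n generalizing f with
  | zero => simpa [schurApprox] using hf.norm_le z hz
  | succ n ih =>
    have h0 : ‖f 0‖ < 1 := h 0
    have hpar : (fun k => schurParam f (k + 1)) = schurParam (schurStep f) :=
      funext fun k => (schurParam_step f k).symm
    have h1 : ∀ k, ‖schurParam (schurStep f) k‖ < 1 := fun k => by
      rw [schurParam_step]
      exact h _
    have h2 := ih (hf.step h0) h1
    have h3 := pseudohyperbolic_contraction h0 hz' ((hf.step h0).norm_le z hz)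
      (norm_schurApprox_le_one h1 hz' n) h2 (pow_nonneg (contractionRate_nonneg (norm_nonneg z)) n)
    rw [← hf.eq_inv_step h0 hz] at h3
    rw [schurApprox, hpar, schurParam_zero, pow_succ']
    exact h3

/-- The Schur approximants converge. -/
theorem tendsto_schurApprox {f : ℂ → ℂ} (hf : IsSchur f) (h : ∀ n, ‖schurParam f n‖ < 1)
    {z : ℂ} (hz : z ∈ Metric.ball (0 : ℂ) 1) :
    Tendsto (fun n => schurApprox (schurParam f) n z) atTop (𝓝 (f z)) := by
  have hz' : ‖z‖ < 1 := by simpa using hz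
  rw [tendsto_iff_norm_sub_tendsto_zero]
  have h1 : Tendsto (fun n => contractionRate ‖z‖ ^ n * 2) atTop (𝓝 0) := by
    simpa using (tendsto_pow_atTop_nhds_zero_of_lt_one
      (contractionRate_nonneg (norm_nonneg z)) (contractionRate_lt_one hz')).mul_const 2
  refine squeeze_zero (fun n => norm_nonneg _) (fun n => ?_) h1
  rw [norm_sub_rev]
  refine (norm_sub_schurApprox_le hf h hz n).trans ?_
  have := contractionRate_nonneg (norm_nonneg z)
  gcongr
  refine (norm_sub_le _ _).trans ?_
  rw [norm_one, norm_mul, RCLike.norm_conj]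
  have h2 := mul_le_one₀ (hf.norm_le z hz) (norm_nonneg _) (norm_schurApprox_le_one h hz' n)
  linarith

/-- A Schur function is determined by its parameters. -/
theorem IsSchur.eqOn_of_schurParam {f g : ℂ → ℂ} (hf : IsSchur f) (hg : IsSchur g)
    (h : ∀ n, ‖schurParam f n‖ < 1) (heq : schurParam f = schurParam g) :
    Set.EqOn f g (Metric.ball 0 1) := fun z hz => by
  have h1 := tendsto_schurApprox hg (heq ▸ h) hz
  rw [← heq] at h1
  exact tendsto_nhds_unique (tendsto_schurApprox hf h hz) h1

/-- Both sides have the parameters `αⱼ₊₁`, so uniqueness turns the shift of coefficients into one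
Schur step. -/
theorem IsStripped.eqOn_schur {μ μ₁ : Measure Circle} (hμ : IsNontrivialProb μ)
    (h : IsStripped μ μ₁) : Set.EqOn (schur μ₁) (schurStep (schur μ)) (Metric.ball 0 1) := by
  have := h.nontrivial.isProb
  refine (isSchur_schur μ₁).eqOn_of_schurParam (hμ.isSchur_iterate 1) (fun n => ?_)
    (funext fun n => ?_)
  · rw [h.nontrivial.schurParam_eq]
    exact h.nontrivial.norm_verblunsky_lt_one n
  · rw [h.nontrivial.schurParam_eq, schurParam_step, hμ.schurParam_eq, h.shift]

/-! ### Solutions of the Szegő recursion and ratio asymptotics -/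

/-- The normalization factor in the solution of the Szegő recursion. -/
noncomputable def szegoFactor : (ℕ → ℂ) → ℕ → ℂ → ℂ
  | _, 0, _ => 1
  | γ, n + 1, z => szegoFactor (fun k => γ (k + 1)) n z *
      (1 + conj (γ 0) * (z * schurApprox (fun k => γ (k + 1)) n z))

theorem szegoFactor_ne_zero {γ : ℕ → ℂ} (hγ : ∀ k, ‖γ k‖ < 1) {z : ℂ} (hz : ‖z‖ < 1) (n : ℕ) :
    szegoFactor γ n z ≠ 0 := by
  induction n generalizing γ with
  | zero => exact one_ne_zero
  | succ n ih =>
    exact mul_ne_zero (ih fun k => hγ (k + 1)) (one_add_ne_zero (norm_conj_mul_lt_one (hγ 0)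
      (norm_mul_lt_one hz (norm_schurApprox_le_one (fun k => hγ (k + 1)) hz n)).le))

/-- Solutions of the Szegő recursion in terms of the Schur approximants. -/
theorem szego_recursion_solution {γ : ℕ → ℂ} (hγ : ∀ k, ‖γ k‖ < 1) {z : ℂ} (hz : ‖z‖ < 1)
    {A B : ℕ → ℂ} (hA : ∀ k, A (k + 1) = z * A k - conj (γ k) * B k)
    (hB : ∀ k, B (k + 1) = B k - γ k * (z * A k)) (n : ℕ) :
    B n = szegoFactor γ n z * (B 0 - z * schurApprox γ n z * A 0) := by
  induction n generalizing γ A B with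
  | zero => simp [szegoFactor, schurApprox]
  | succ n ih =>
    -- The first step is peeled off, not the last: the linear form in `A 1, B 1` becomes one in `A
    -- 0, B 0` times `1 + conj γ₀ z w`, with `w` the shifted approximant.
    have h1 := ih (γ := fun k => γ (k + 1)) (fun k => hγ (k + 1)) (A := fun k => A (k + 1))
      (B := fun k => B (k + 1)) (fun k => hA (k + 1)) (fun k => hB (k + 1))
    simp only [zero_add] at h1
    rw [h1, hA 0, hB 0, szegoFactor, schurApprox]
    have h2 : 1 + conj (γ 0) * (z * schurApprox (fun k => γ (k + 1)) n z) ≠ 0 :=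
      one_add_ne_zero (norm_conj_mul_lt_one (hγ 0)
        (norm_mul_lt_one hz (norm_schurApprox_le_one (fun k => hγ (k + 1)) hz n)).le)
    generalize schurApprox (fun k => γ (k + 1)) n z = w at h2 ⊢
    rw [mul_assoc (szegoFactor _ n z)]
    congr 1
    linear_combination z * A 0 * div_mul_cancel₀ (γ 0 + z * w) h2

section Ratio

variable {μ μ₁ : Measure Circle}

theorem IsNontrivialProb.eval_starPoly_succ (hμ : IsNontrivialProb μ) (z : ℂ) (n : ℕ) :
    (starPoly (n + 1) (monicOP μ (n + 1))).eval z = (starPoly n (monicOP μ n)).eval z -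
      verblunsky μ n * (z * (monicOP μ n).eval z) := by
  have := hμ.isProb
  rw [starPoly_monicOP_succ fun k _ => hμ.polyNorm_ne_zero k]
  simp

theorem IsNontrivialProb.eval_monicOP_succ (hμ : IsNontrivialProb μ) (z : ℂ) (n : ℕ) :
    (monicOP μ (n + 1)).eval z = z * (monicOP μ n).eval z -
      conj (verblunsky μ n) * (starPoly n (monicOP μ n)).eval z := by
  have := hμ.isProb
  rw [monicOP_succ fun k _ => hμ.polyNorm_ne_zero k]
  simp

theorem starPoly_zero_one : starPoly 0 1 = 1 := by
  simp [starPoly]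

theorem IsStripped.polyNorm_succ_sq (hμ : IsNontrivialProb μ) (h : IsStripped μ μ₁) (n : ℕ) :
    polyNorm μ (monicOP μ (n + 1)) ^ 2 =
      (1 - ‖verblunsky μ 0‖ ^ 2) * polyNorm μ₁ (monicOP μ₁ n) ^ 2 := by
  have := hμ.isProb
  have := h.nontrivial.isProb
  induction n with
  | zero =>
    rw [polyNorm_monicOP_succ_sq fun k _ => hμ.polyNorm_ne_zero k, polyNorm_monicOP_zero,
      polyNorm_monicOP_zero]
  | succ n ih =>
    rw [polyNorm_monicOP_succ_sq fun k _ => hμ.polyNorm_ne_zero k, ih,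
      polyNorm_monicOP_succ_sq fun k _ => h.nontrivial.polyNorm_ne_zero k, h.shift]
    ring

theorem sqrt_one_sub_sq_pos {a : ℂ} (ha : ‖a‖ < 1) : 0 < √(1 - ‖a‖ ^ 2) :=
  Real.sqrt_pos.2 (by nlinarith [norm_nonneg a])

theorem IsStripped.polyNorm_succ (hμ : IsNontrivialProb μ) (h : IsStripped μ μ₁) (n : ℕ) :
    polyNorm μ (monicOP μ (n + 1)) =
      √(1 - ‖verblunsky μ 0‖ ^ 2) * polyNorm μ₁ (monicOP μ₁ n) := by
  have h1 : 0 ≤ polyNorm μ₁ (monicOP μ₁ n) := Real.sqrt_nonneg _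
  have h2 : 0 ≤ polyNorm μ (monicOP μ (n + 1)) := Real.sqrt_nonneg _
  rw [← Real.sqrt_sq h2, h.polyNorm_succ_sq hμ, Real.sqrt_mul' _ (sq_nonneg _), Real.sqrt_sq h1]

theorem eval_starPoly_orthoPoly (μ : Measure Circle) (n : ℕ) (z : ℂ) :
    (starPoly n (orthoPoly μ n)).eval z =
      ((polyNorm μ (monicOP μ n) : ℝ) : ℂ)⁻¹ * (starPoly n (monicOP μ n)).eval z := by
  rw [orthoPoly, starPoly_C_mul, Complex.conj_ofReal]
  simp

/-- The basic relation between `f` and `f₁`. -/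
theorem IsStripped.schur_mul (hμ : IsNontrivialProb μ) (h : IsStripped μ μ₁) {z : ℂ}
    (hz : z ∈ Metric.ball (0 : ℂ) 1) :
    z * schur μ₁ z * (1 - conj (verblunsky μ 0) * schur μ z) = schur μ z - verblunsky μ 0 := by
  have h1 : schur μ 0 = verblunsky μ 0 := hμ.schurParam_eq 0
  have := hμ.isProb
  have h2 := (isSchur_schur μ).mul_step (by rw [h1]; exact hμ.norm_verblunsky_lt_one 0) hz
  rwa [← h.eqOn_schur hμ hz, h1] at h2

/-- Eliminates `f` by the Schur relation. The form in `f₁` alone is the one that appears as limit of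
the polynomial ratios. -/
theorem IsStripped.relSzego_eq (hμ : IsNontrivialProb μ) (h : IsStripped μ μ₁) {z : ℂ}
    (hz : z ∈ Metric.ball (0 : ℂ) 1) :
    relSzego μ μ₁ z = (√(1 - ‖verblunsky μ 0‖ ^ 2) : ℝ) * (1 - z * schur μ₁ z) /
      ((1 - verblunsky μ 0 * z) - z * schur μ₁ z * (z - conj (verblunsky μ 0))) ∧
    (1 - verblunsky μ 0 * z) - z * schur μ₁ z * (z - conj (verblunsky μ 0)) ≠ 0 := by
  have := hμ.isProb
  have := h.nontrivial.isProb
  have hα := hμ.norm_verblunsky_lt_one 0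
  have h1 := h.schur_mul hμ hz
  have hf1 := (isSchur_schur μ₁).norm_mul_lt hz
  have h2 : 1 + conj (verblunsky μ 0) * (z * schur μ₁ z) ≠ 0 :=
    one_add_ne_zero (norm_conj_mul_lt_one hα hf1.le)
  have h3 : 1 - z * schur μ z ≠ 0 := one_sub_ne_zero ((isSchur_schur μ).norm_mul_lt hz)
  have hρ : ((√(1 - ‖verblunsky μ 0‖ ^ 2) : ℝ) : ℂ) ≠ 0 := by
    exact_mod_cast (sqrt_one_sub_sq_pos hα).ne'
  have hρ2 : ((√(1 - ‖verblunsky μ 0‖ ^ 2) : ℝ) : ℂ) ^ 2 =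
      1 - conj (verblunsky μ 0) * verblunsky μ 0 := by
    rw [Complex.conj_mul', ← Complex.ofReal_pow,
      Real.sq_sqrt (by nlinarith [norm_nonneg (verblunsky μ 0)])]
    push_cast
    ring
  have h4 : (1 - verblunsky μ 0 * z) - z * schur μ₁ z * (z - conj (verblunsky μ 0)) =
      (1 - z * schur μ z) * (1 + conj (verblunsky μ 0) * (z * schur μ₁ z)) := by
    linear_combination -z * h1
  refine ⟨?_, h4 ▸ mul_ne_zero h3 h2⟩
  rw [h4, relSzego, div_mul_div_comm, div_eq_div_iff (mul_ne_zero hρ h3) (mul_ne_zero h3 h2)]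
  have h5 : (1 - conj (verblunsky μ 0) * schur μ z) *
      (1 + conj (verblunsky μ 0) * (z * schur μ₁ z)) =
        1 - conj (verblunsky μ 0) * verblunsky μ 0 := by
    linear_combination conj (verblunsky μ 0) * h1
  linear_combination (1 - z * schur μ₁ z) * (1 - z * schur μ z) * (h5 - hρ2)

/-- Ratio asymptotics of the reversed orthonormal polynomials. -/
theorem IsStripped.tendsto_ratio (hμ : IsNontrivialProb μ) (h : IsStripped μ μ₁) {z : ℂ}
    (hz : z ∈ Metric.ball (0 : ℂ) 1) :
    Tendsto (fun n : ℕ => (starPoly n (orthoPoly μ₁ n)).eval z /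
      (starPoly (n + 1) (orthoPoly μ (n + 1))).eval z) atTop (𝓝 (relSzego μ μ₁ z)) := by
  have := h.nontrivial.isProb
  have hz' : ‖z‖ < 1 := by simpa using hz
  have hγ := h.nontrivial.norm_verblunsky_lt_one
  have hpar : schurParam (schur μ₁) = verblunsky μ₁ := funext h.nontrivial.schurParam_eq
  have hlim := tendsto_schurApprox (isSchur_schur μ₁) (hpar ▸ hγ) hz
  rw [hpar] at hlim
  obtain ⟨heq, hne⟩ := h.relSzego_eq hμ hz
  rw [heq]
  have h1 := szego_recursion_solution hγ hz' (A := fun k => (monicOP μ₁ k).eval z)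
    (B := fun k => (starPoly k (monicOP μ₁ k)).eval z) (h.nontrivial.eval_monicOP_succ z)
    (h.nontrivial.eval_starPoly_succ z)
  -- The polynomials of `μ` are started at index one, with data `z - conj α₀` and `1 - α₀ z`, so
  -- that both solutions use the coefficients of `μ₁`.
  have h2 := szego_recursion_solution hγ hz'
    (A := fun k => (monicOP μ (k + 1)).eval z)
    (B := fun k => (starPoly (k + 1) (monicOP μ (k + 1))).eval z)
    (fun k => by rw [h.shift]; exact hμ.eval_monicOP_succ z (k + 1))
    (fun k => by rw [h.shift]; exact hμ.eval_starPoly_succ z (k + 1))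
  simp only [hμ.eval_monicOP_succ z 0, hμ.eval_starPoly_succ z 0, zero_add, monicOP_zero,
    starPoly_zero_one, eval_one, mul_one] at h1 h2
  have h3 := ((hlim.const_mul z).const_sub 1).const_mul
    ((√(1 - ‖verblunsky μ 0‖ ^ 2) : ℝ) : ℂ)
  have h4 := ((hlim.const_mul z).mul_const (z - conj (verblunsky μ 0))).const_sub
    (1 - verblunsky μ 0 * z)
  refine (h3.div h4 hne).congr fun n => ?_
  rw [eval_starPoly_orthoPoly, eval_starPoly_orthoPoly, h1, h2, h.polyNorm_succ hμ]
  have h5 := szegoFactor_ne_zero hγ hz' n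
  have h6 : ((polyNorm μ₁ (monicOP μ₁ n) : ℝ) : ℂ) ≠ 0 := by
    exact_mod_cast h.nontrivial.polyNorm_ne_zero n
  have hρ : ((√(1 - ‖verblunsky μ 0‖ ^ 2) : ℝ) : ℂ) ≠ 0 := by
    exact_mod_cast (sqrt_one_sub_sq_pos (hμ.norm_verblunsky_lt_one 0)).ne'
  rw [Complex.ofReal_mul, mul_inv, mul_left_comm _ (szegoFactor (verblunsky μ₁) n z),
    mul_left_comm _ (szegoFactor (verblunsky μ₁) n z), mul_div_mul_left _ _ h5,
    mul_comm ((√(1 - ‖verblunsky μ 0‖ ^ 2) : ℝ) : ℂ)⁻¹, mul_assoc,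
    mul_div_mul_left _ _ (inv_ne_zero h6), inv_mul_eq_div, div_div_eq_mul_div]
  exact congrArg₂ (fun a b : ℂ => a / b) (mul_comm _ _) rfl

end Ratio

/-! ### Relative Szegő function: logarithm and boundary values -/

section RelSzego

variable {μ μ₁ : Measure Circle}

theorem IsSchur.mul_diff {f : ℂ → ℂ} (hf : IsSchur f) :
    DifferentiableOn ℂ (fun z => 1 - z * f z) (Metric.ball 0 1) :=
  (differentiableOn_id.mul hf.diff).const_sub 1

theorem IsSchur.re_one_sub_mul_pos {f : ℂ → ℂ} (hf : IsSchur f) {z : ℂ}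
    (hz : z ∈ Metric.ball (0 : ℂ) 1) : 0 < (1 - z * f z).re :=
  re_one_sub_pos (hf.norm_mul_lt hz)

theorem IsSchur.re_one_sub_conj_mul_pos {f : ℂ → ℂ} (hf : IsSchur f) {a : ℂ} (ha : ‖a‖ < 1) {z : ℂ}
    (hz : z ∈ Metric.ball (0 : ℂ) 1) : 0 < (1 - conj a * f z).re :=
  re_one_sub_pos (norm_conj_mul_lt_one ha (hf.norm_le z hz))

theorem ne_zero_of_re_pos {w : ℂ} (hw : 0 < w.re) : w ≠ 0 := fun h => by
  rw [h] at hw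
  exact lt_irrefl _ hw

theorem sqrt_one_sub_sq_ne_zero {a : ℂ} (ha : ‖a‖ < 1) : ((√(1 - ‖a‖ ^ 2) : ℝ) : ℂ) ≠ 0 := by
  exact_mod_cast (sqrt_one_sub_sq_pos ha).ne'

theorem analyticOnNhd_relSzego [IsProbabilityMeasure μ] [IsProbabilityMeasure μ₁] :
    AnalyticOnNhd ℂ (relSzego μ μ₁) (Metric.ball 0 1) := by
  refine DifferentiableOn.analyticOnNhd ?_ Metric.isOpen_ball
  exact ((((isSchur_schur μ).diff.const_mul _).const_sub 1).div_const _).mul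
    ((isSchur_schur μ₁).mul_diff.div (isSchur_schur μ).mul_diff
      fun z hz => ne_zero_of_re_pos ((isSchur_schur μ).re_one_sub_mul_pos hz))

theorem relSzego_ne_zero [IsProbabilityMeasure μ] [IsProbabilityMeasure μ₁]
    (hα : ‖verblunsky μ 0‖ < 1) {z : ℂ} (hz : z ∈ Metric.ball (0 : ℂ) 1) :
    relSzego μ μ₁ z ≠ 0 :=
  mul_ne_zero (div_ne_zero
    (ne_zero_of_re_pos ((isSchur_schur μ).re_one_sub_conj_mul_pos hα hz))
      (sqrt_one_sub_sq_ne_zero hα))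
    (div_ne_zero (ne_zero_of_re_pos ((isSchur_schur μ₁).re_one_sub_mul_pos hz))
      (ne_zero_of_re_pos ((isSchur_schur μ).re_one_sub_mul_pos hz)))

/-- An explicit logarithm of the relative Szegő function. -/
noncomputable def logRelSzego (μ μ₁ : Measure Circle) (z : ℂ) : ℂ :=
  (Complex.log (1 - conj (verblunsky μ 0) * schur μ z) +
    -Complex.log ((√(1 - ‖verblunsky μ 0‖ ^ 2) : ℝ) : ℂ)) +
    (Complex.log (1 - z * schur μ₁ z) + -Complex.log (1 - z * schur μ z))

theorem exp_logRelSzego [IsProbabilityMeasure μ] [IsProbabilityMeasure μ₁]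
    (hα : ‖verblunsky μ 0‖ < 1) {z : ℂ} (hz : z ∈ Metric.ball (0 : ℂ) 1) :
    Complex.exp (logRelSzego μ μ₁ z) = relSzego μ μ₁ z := by
  have h1 := ne_zero_of_re_pos ((isSchur_schur μ).re_one_sub_conj_mul_pos hα hz)
  have h2 := ne_zero_of_re_pos ((isSchur_schur μ).re_one_sub_mul_pos hz)
  have h3 := ne_zero_of_re_pos ((isSchur_schur μ₁).re_one_sub_mul_pos hz)
  rw [logRelSzego, Complex.exp_add, Complex.exp_add, Complex.exp_add, Complex.exp_neg,
    Complex.exp_neg, Complex.exp_log h1, Complex.exp_log h2, Complex.exp_log h3,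
    Complex.exp_log (sqrt_one_sub_sq_ne_zero hα), relSzego, div_eq_mul_inv, div_eq_mul_inv]

theorem memHardy_logRelSzego [IsProbabilityMeasure μ] [IsProbabilityMeasure μ₁]
    (hα : ‖verblunsky μ 0‖ < 1) {p : ℝ} (hp : 0 < p) : MemHardy p (logRelSzego μ μ₁) := by
  refine MemHardy.add hp.le (MemHardy.add hp.le ?_ (MemHardy.const p _))
    (MemHardy.add hp.le ?_ (MemHardy.neg ?_))
  · exact memHardy_log (((isSchur_schur μ).diff.const_mul _).const_sub 1)
      (fun z hz => (isSchur_schur μ).re_one_sub_conj_mul_pos hα hz) hp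
  · exact memHardy_log (isSchur_schur μ₁).mul_diff
      (fun z hz => (isSchur_schur μ₁).re_one_sub_mul_pos hz) hp
  · exact memHardy_log (isSchur_schur μ).mul_diff
      (fun z hz => (isSchur_schur μ).re_one_sub_mul_pos hz) hp

theorem memHardy_of_exp_eq_relSzego [IsProbabilityMeasure μ] [IsProbabilityMeasure μ₁]
    (hα : ‖verblunsky μ 0‖ < 1) {L : ℂ → ℂ} (hL : AnalyticOnNhd ℂ L (Metric.ball 0 1))
    (h : ∀ z ∈ Metric.ball (0 : ℂ) 1, Complex.exp (L z) = relSzego μ μ₁ z) {p : ℝ} (hp : 0 < p) :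
    MemHardy p L := by
  have hH := memHardy_logRelSzego (μ₁ := μ₁) hα hp
  obtain ⟨c, hc⟩ := log_unique hL hH.1 fun z hz => by
    rw [h z hz, exp_logRelSzego hα hz]
  exact (hH.add hp.le (MemHardy.const p c)).congr fun z hz => (hc z hz).symm

theorem re_logRelSzego [IsProbabilityMeasure μ] [IsProbabilityMeasure μ₁]
    (hα : ‖verblunsky μ 0‖ < 1) {z : ℂ} (hz : z ∈ Metric.ball (0 : ℂ) 1) :
    (logRelSzego μ μ₁ z).re = Real.log ‖relSzego μ μ₁ z‖ := by
  rw [← exp_logRelSzego hα hz, Complex.norm_exp, Real.log_exp]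

theorem tendsto_smul_circle (ζ : Circle) :
    Tendsto (fun r : ℝ => (r : ℂ) * (ζ : ℂ)) (𝓝[<] 1) (𝓝 ζ) := by
  have h : Tendsto (fun r : ℝ => (r : ℂ)) (𝓝[<] 1) (𝓝 ((1 : ℝ) : ℂ)) :=
    (Complex.continuous_ofReal.tendsto 1).mono_left nhdsWithin_le_nhds
  simpa using h.mul_const (ζ : ℂ)

/-- Boundary behaviour of the Schur function and the density of the measure. -/
theorem ae_schur_boundary (μ : Measure Circle) [IsProbabilityMeasure μ] :
    ∀ᵐ ζ : Circle ∂arc, ∃ b : ℂ, Tendsto (fun r : ℝ => schur μ (r * ζ)) (𝓝[<] 1) (𝓝 b) ∧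
      ‖b‖ ≤ 1 ∧ 1 - ζ * b ≠ 0 ∧ weight μ ζ = (1 - ‖b‖ ^ 2) / ‖1 - ζ * b‖ ^ 2 := by
  have hS := isSchur_schur μ
  filter_upwards [ae_exists_radial_limit hS.diff hS.norm_le, ae_tendsto_re_caratheodory μ,
    ae_radial_limit_ne_zero hS.mul_diff fun z hz => hS.re_one_sub_mul_pos hz]
    with ζ ⟨b, hb⟩ hw hne
  have h1 : Tendsto (fun r : ℝ => (r * ζ : ℂ) * schur μ (r * ζ)) (𝓝[<] 1) (𝓝 (ζ * b)) :=
    (tendsto_smul_circle ζ).mul hb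
  have h2 := h1.const_sub 1
  have h3 : 1 - ζ * b ≠ 0 := fun h => hne (h ▸ h2)
  refine ⟨b, hb, ?_, h3, ?_⟩
  · refine le_of_tendsto hb.norm ?_
    filter_upwards [eventually_Ioo_nhdsLT_one] with r hr
    exact hS.norm_le _ (smul_circle_mem_ball hr.1.le hr.2 ζ)
  · have h4 := ((h1.norm.pow 2).const_sub 1).div (h2.norm.pow 2)
      (pow_ne_zero 2 (norm_ne_zero_iff.2 h3))
    rw [norm_mul, Circle.norm_coe, one_mul] at h4
    refine tendsto_nhds_unique hw (h4.congr' ?_)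
    filter_upwards [eventually_Ioo_nhdsLT_one] with r hr
    exact (re_caratheodory_eq μ (smul_circle_mem_ball hr.1.le hr.2 ζ)).symm

/-- Boundary behaviour of the relative Szegő function. -/
theorem IsStripped.ae_relSzego_boundary (hμ : IsNontrivialProb μ) (h : IsStripped μ μ₁) :
    ∀ᵐ ζ : Circle ∂arc, ∃ c : ℂ, c ≠ 0 ∧
      Tendsto (fun r : ℝ => relSzego μ μ₁ (r * ζ)) (𝓝[<] 1) (𝓝 c) ∧
      weight μ ζ = ‖c‖ ^ 2 * weight μ₁ ζ := by
  have := hμ.isProb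
  have := h.nontrivial.isProb
  have hα := hμ.norm_verblunsky_lt_one 0
  have hρ := sqrt_one_sub_sq_pos hα
  filter_upwards [ae_schur_boundary μ, ae_schur_boundary μ₁]
    with ζ ⟨b, hb, hb1, hne, hw⟩ ⟨b₁, hb₁, hb₁1, hne₁, hw₁⟩
  have hrel : ζ * b₁ * (1 - conj (verblunsky μ 0) * b) = b - verblunsky μ 0 := by
    have h1 := ((tendsto_smul_circle ζ).mul hb₁).mul
      ((hb.const_mul (conj (verblunsky μ 0))).const_sub 1)
    refine tendsto_nhds_unique h1 ((hb.sub_const (verblunsky μ 0)).congr' ?_)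
    filter_upwards [eventually_Ioo_nhdsLT_one] with r hr
    exact (h.schur_mul hμ (smul_circle_mem_ball hr.1.le hr.2 ζ)).symm
  have h1b : 1 - conj (verblunsky μ 0) * b ≠ 0 := one_sub_ne_zero (norm_conj_mul_lt_one hα hb1)
  refine ⟨(1 - conj (verblunsky μ 0) * b) / ((√(1 - ‖verblunsky μ 0‖ ^ 2) : ℝ) : ℂ) *
    ((1 - ζ * b₁) / (1 - ζ * b)), ?_, ?_, ?_⟩
  · exact mul_ne_zero (div_ne_zero h1b (sqrt_one_sub_sq_ne_zero hα)) (div_ne_zero hne₁ hne)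
  · exact (((hb.const_mul _).const_sub 1).div_const _).mul
      ((((tendsto_smul_circle ζ).mul hb₁).const_sub 1).div
        (((tendsto_smul_circle ζ).mul hb).const_sub 1) hne)
  -- Since `|ζ| = 1`, the boundary relation gives `|b - α₀| = |b₁| |1 - conj α₀ b|`, which links `1
  -- - |b|²` to `1 - |b₁|²`.
  · have h2 := norm_moebius_identity (verblunsky μ 0) b
    rw [← hrel, norm_mul, norm_mul, Circle.norm_coe, one_mul] at h2
    rw [hw, hw₁, norm_mul, norm_div, norm_div, Complex.norm_real, Real.norm_of_nonneg hρ.le,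
      mul_pow, div_pow, div_pow, Real.sq_sqrt (by nlinarith [norm_nonneg (verblunsky μ 0)])]
    have h3 : ‖1 - ζ * b‖ ≠ 0 := norm_ne_zero_iff.2 hne
    have h4 : ‖1 - ζ * b₁‖ ≠ 0 := norm_ne_zero_iff.2 hne₁
    have h5 : 1 - ‖verblunsky μ 0‖ ^ 2 ≠ 0 := by nlinarith [norm_nonneg (verblunsky μ 0)]
    generalize ‖1 - conj (verblunsky μ 0) * b‖ = u at h2 ⊢
    generalize ‖1 - ζ * b‖ = v at h3 ⊢
    generalize ‖1 - ζ * b₁‖ = v₁ at h4 ⊢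
    field_simp
    linear_combination -h2

theorem IsStripped.ae_weight_ne_zero_iff (hμ : IsNontrivialProb μ) (h : IsStripped μ μ₁) :
    ∀ᵐ ζ ∂arc, weight μ ζ ≠ 0 ↔ weight μ₁ ζ ≠ 0 := by
  filter_upwards [h.ae_relSzego_boundary hμ] with ζ ⟨c, hc, _, hw⟩
  rw [hw, mul_ne_zero_iff]
  exact and_iff_right (pow_ne_zero 2 (norm_ne_zero_iff.2 hc))

theorem IsStripped.ae_weight_div (hμ : IsNontrivialProb μ) (h : IsStripped μ μ₁) :
    ∀ᵐ ζ : Circle ∂arc, weight μ ζ ≠ 0 → ∃ b : ℂ,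
      Tendsto (fun r : ℝ => relSzego μ μ₁ (r * ζ)) (𝓝[<] 1) (𝓝 b) ∧
        weight μ ζ / weight μ₁ ζ = ‖b‖ ^ 2 := by
  filter_upwards [h.ae_relSzego_boundary hμ] with ζ ⟨c, hc, ht, hw⟩ hne
  refine ⟨c, ht, ?_⟩
  rw [hw] at hne ⊢
  exact mul_div_cancel_right₀ _ (right_ne_zero_of_mul hne)

/-- Boundary values of the real part of the logarithm. -/
theorem IsStripped.ae_tendsto_re_log (hμ : IsNontrivialProb μ) (h : IsStripped μ μ₁) :
    ∀ᵐ ζ : Circle ∂arc, weight μ₁ ζ ≠ 0 →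
      Tendsto (fun n => (logRelSzego μ μ₁ (radius n * ζ)).re) atTop
        (𝓝 (1 / 2 * Real.log (weight μ ζ / weight μ₁ ζ))) := by
  have := hμ.isProb
  have := h.nontrivial.isProb
  filter_upwards [h.ae_relSzego_boundary hμ] with ζ ⟨c, hc, ht, hw⟩ hne
  have h1 : 1 / 2 * Real.log (weight μ ζ / weight μ₁ ζ) = Real.log ‖c‖ := by
    rw [hw, mul_div_cancel_right₀ _ hne, Real.log_pow]
    push_cast
    ring
  rw [h1]
  refine (((ht.comp tendsto_radius).norm).log (norm_ne_zero_iff.2 hc)).congr fun n => ?_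
  exact (re_logRelSzego (hμ.norm_verblunsky_lt_one 0)
    (smul_circle_mem_ball (radius_nonneg n) (radius_lt_one n) ζ)).symm

theorem measurable_weight (μ : Measure Circle) : Measurable (weight μ) :=
  (Measure.measurable_rnDeriv μ arc).ennreal_toReal

/-- Twice the real part of the logarithm tends to `log (w / w₁)` radially, so the `H^p` bound passes
to the limit by Fatou's lemma. -/
theorem IsStripped.integrableOn_log_weight (hμ : IsNontrivialProb μ) (h : IsStripped μ μ₁) {p : ℝ}
    (hp : 0 < p) :
    IntegrableOn (fun ζ => |Real.log (weight μ ζ / weight μ₁ ζ)| ^ p)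
      {ζ | weight μ₁ ζ ≠ 0} arc := by
  have := hμ.isProb
  have := h.nontrivial.isProb
  have hH : MemHardy p fun z => logRelSzego μ μ₁ z + logRelSzego μ μ₁ z :=
    (memHardy_logRelSzego (hμ.norm_verblunsky_lt_one 0) hp).add hp.le
      (memHardy_logRelSzego (hμ.norm_verblunsky_lt_one 0) hp)
  obtain ⟨C, hC, hle⟩ := hH.exists_lintegral_le hp.le
  have hS : MeasurableSet {ζ | weight μ₁ ζ ≠ 0} :=
    (measurable_weight μ₁ (measurableSet_singleton 0)).compl
  have hcont : ∀ n, Continuous fun ζ : Circle =>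
      |(logRelSzego μ μ₁ (radius n * ζ) + logRelSzego μ μ₁ (radius n * ζ)).re| ^ p := fun n =>
    (Complex.continuous_re.comp (continuous_dilate hH.1.continuousOn (radius_nonneg n)
      (radius_lt_one n))).abs.rpow_const fun _ => .inr hp.le
  refine integrable_of_tendsto_ae (h := fun n (ζ : Circle) =>
      |(logRelSzego μ μ₁ (radius n * ζ) + logRelSzego μ μ₁ (radius n * ζ)).re| ^ p)
    (fun n => (hcont n).aemeasurable) (fun n ζ => by positivity) hC (fun n => ?_) ?_
  · refine (setLIntegral_le_lintegral _ _).trans (le_trans (lintegral_mono fun ζ => ?_) (hle n))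
    apply ENNReal.ofReal_le_ofReal
    exact Real.rpow_le_rpow (abs_nonneg _) (Complex.abs_re_le_norm _) hp.le
  · filter_upwards [ae_restrict_of_ae (h.ae_tendsto_re_log hμ), ae_restrict_mem hS] with ζ ht hζ
    have h1 := ((ht hζ).add (ht hζ)).abs.rpow_const (p := p) (.inr hp.le)
    rw [← add_mul, add_halves, one_mul] at h1
    simpa only [Complex.add_re] using h1

end RelSzego

/-! ### Sum rule and integrability of the logarithm of the weight -/

section SzegoTheorem

/-- The Schur algorithm and the function `1 - |f|²`. -/
theorem IsSchur.one_sub_norm_sq {f : ℂ → ℂ} (hf : IsSchur f) (h0 : ‖f 0‖ < 1) {z : ℂ}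
    (hz : z ∈ Metric.ball (0 : ℂ) 1) :
    ‖1 - conj (f 0) * f z‖ ^ 2 * (1 - ‖z * schurStep f z‖ ^ 2) =
      (1 - ‖f 0‖ ^ 2) * (1 - ‖f z‖ ^ 2) := by
  have h1 := norm_moebius_identity (f 0) (f z)
  rw [← hf.mul_step h0 hz, norm_mul _ (1 - conj (f 0) * f z)] at h1
  linear_combination h1

theorem one_sub_sq_pos {x : ℝ} (h0 : 0 ≤ x) (h1 : x < 1) : 0 < 1 - x ^ 2 := by nlinarith

/-- In the preceding identity the factor `1 - |z f₁|²` is strictly positive. This makes `log (1 -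
|f|²)` continuous in the disc. -/
theorem IsSchur.norm_lt_one {f : ℂ → ℂ} (hf : IsSchur f) (h0 : ‖f 0‖ < 1) {z : ℂ}
    (hz : z ∈ Metric.ball (0 : ℂ) 1) : ‖f z‖ < 1 := by
  have h1 := hf.one_sub_norm_sq h0 hz
  have h2 := one_sub_sq_pos (norm_nonneg _) ((hf.step h0).norm_mul_lt hz)
  have h3 : 0 < ‖1 - conj (f 0) * f z‖ ^ 2 := by
    have := ne_zero_of_re_pos (hf.re_one_sub_conj_mul_pos h0 hz)
    positivity
  have h4 := one_sub_sq_pos (norm_nonneg _) h0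
  have h5 : 0 < 1 - ‖f z‖ ^ 2 := pos_of_mul_pos_right (h1 ▸ mul_pos h3 h2) h4.le
  nlinarith [norm_nonneg (f z)]

theorem continuous_log_one_sub {f : ℂ → ℂ} (hf : ContinuousOn f (Metric.ball 0 1))
    (hlt : ∀ z ∈ Metric.ball (0 : ℂ) 1, ‖f z‖ < 1) {r : ℝ} (hr0 : 0 ≤ r) (hr : r < 1) :
    Continuous fun ζ : Circle => Real.log (1 - ‖f (r * ζ)‖ ^ 2) :=
  (continuous_const.sub ((continuous_dilate hf hr0 hr).norm.pow 2)).log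
    fun ζ => (one_sub_sq_pos (norm_nonneg _) (hlt _ (smul_circle_mem_ball hr0 hr ζ))).ne'

/-- One step of the sum rule for `∫ log (1 - |f|²)`. -/
theorem IsSchur.sum_rule_step {f : ℂ → ℂ} (hf : IsSchur f) (h0 : ‖f 0‖ < 1)
    (h1 : ‖schurStep f 0‖ < 1) {r : ℝ} (hr0 : 0 ≤ r) (hr : r < 1) :
    Real.log (1 - ‖f 0‖ ^ 2) + ∫ ζ : Circle, Real.log (1 - ‖schurStep f (r * ζ)‖ ^ 2) ∂arc ≤
      ∫ ζ : Circle, Real.log (1 - ‖f (r * ζ)‖ ^ 2) ∂arc := by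
  have hpos := one_sub_sq_pos (norm_nonneg _) h0
  have hre := fun z (hz : z ∈ Metric.ball (0 : ℂ) 1) => hf.re_one_sub_conj_mul_pos h0 hz
  have hd : DifferentiableOn ℂ (fun z => Complex.log (1 - conj (f 0) * f z)) (Metric.ball 0 1) :=
    ((hf.diff.const_mul _).const_sub 1).clog fun z hz => .inl (hre z hz)
  have hmean := integral_re_dilate hd hr0 hr
  have h00 : ‖1 - conj (f 0) * f 0‖ = 1 - ‖f 0‖ ^ 2 := by
    rw [Complex.conj_mul', ← Complex.ofReal_pow, ← Complex.ofReal_one, ← Complex.ofReal_sub,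
      Complex.norm_real, Real.norm_of_nonneg hpos.le]
  simp only [Complex.log_re, h00] at hmean
  have hs := hf.step h0
  have hlt1 : ∀ z ∈ Metric.ball (0 : ℂ) 1, ‖schurStep f z‖ < 1 := fun z hz => hs.norm_lt_one h1 hz
  have hi1 := integrable_of_continuous (μ := arc)
    (Complex.continuous_re.comp (continuous_dilate hd.continuousOn hr0 hr))
  simp only [Function.comp_def, Complex.log_re] at hi1
  have hi2 := integrable_of_continuous (μ := arc)
    (continuous_log_one_sub hs.diff.continuousOn hlt1 hr0 hr)
  have hi3 := integrable_of_continuous (μ := arc)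
    (continuous_log_one_sub hf.diff.continuousOn (fun z hz => hf.norm_lt_one h0 hz) hr0 hr)
  -- The logarithm of the identity for `1 - |f|²`; it becomes an inequality because `|z f₁| ≤ |f₁|`.
  -- The mean of `log |1 - conj f(0) f|` is `log (1 - |f(0)|²)`.
  have key : ∫ ζ : Circle, (2 * Real.log ‖1 - conj (f 0) * f (r * ζ)‖ +
      Real.log (1 - ‖schurStep f (r * ζ)‖ ^ 2)) ∂arc ≤
      ∫ ζ : Circle, (Real.log (1 - ‖f 0‖ ^ 2) + Real.log (1 - ‖f (r * ζ)‖ ^ 2)) ∂arc := by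
    refine integral_mono ((hi1.const_mul 2).add hi2) ((integrable_const _).add hi3) fun ζ => ?_
    have hz := smul_circle_mem_ball hr0 hr ζ
    have e := hf.one_sub_norm_sq h0 hz
    have hz1 : 0 < 1 - ‖(r * ζ : ℂ) * schurStep f (r * ζ)‖ ^ 2 :=
      one_sub_sq_pos (norm_nonneg _) (hs.norm_mul_lt hz)
    have hne := norm_ne_zero_iff.2 (ne_zero_of_re_pos (hre _ hz))
    simp only
    rw [← Real.log_mul hpos.ne' (one_sub_sq_pos (norm_nonneg _) (hf.norm_lt_one h0 hz)).ne', ← e,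
      Real.log_mul (pow_ne_zero 2 hne) hz1.ne', Real.log_pow]
    push_cast
    gcongr
    · exact one_sub_sq_pos (norm_nonneg _) (hlt1 _ hz)
    · rw [norm_mul]
      exact mul_le_of_le_one_left (norm_nonneg _) (by simpa using (mem_ball_zero_iff.1 hz).le)
  rw [integral_add (hi1.const_mul 2) hi2, integral_add (integrable_const _) hi3,
    integral_const_mul, hmean] at key
  simp only [integral_const, probReal_univ, one_smul] at key
  linarith

/-- From `f = f(0) + z f₁ (1 - conj f(0) f)`. Small parameters thus propagate to small values of the
iterates. -/
theorem IsSchur.norm_le_add {f : ℂ → ℂ} (hf : IsSchur f) (h0 : ‖f 0‖ < 1) {z : ℂ}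
    (hz : z ∈ Metric.ball (0 : ℂ) 1) : ‖f z‖ ≤ 2 * ‖f 0‖ + ‖z‖ * ‖schurStep f z‖ := by
  have h1 := hf.mul_step h0 hz
  have h2 : f z = f 0 + (z * schurStep f z - z * schurStep f z * (conj (f 0) * f z)) := by
    linear_combination -h1
  have h3 := (hf.step h0).norm_mul_lt hz
  have h4 : ‖z * schurStep f z * (conj (f 0) * f z)‖ ≤ ‖f 0‖ := by
    rw [norm_mul, norm_mul _ (f z), RCLike.norm_conj]
    have := hf.norm_le z hz
    calc _ ≤ 1 * (‖f 0‖ * 1) := by gcongr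
      _ = ‖f 0‖ := by ring
  calc ‖f z‖ ≤ ‖f 0‖ + ‖z * schurStep f z - z * schurStep f z * (conj (f 0) * f z)‖ := by
        conv_lhs => rw [h2]
        exact norm_add_le _ _
    _ ≤ ‖f 0‖ + (‖z * schurStep f z‖ + ‖z * schurStep f z * (conj (f 0) * f z)‖) := by
        gcongr
        exact norm_sub_le _ _
    _ ≤ _ := by
        rw [norm_mul z (schurStep f z)] at *
        linarith

variable {f : ℂ → ℂ}

/-- The bound is the fixed point of `x ↦ 2 ε + r x`. Unrolling `m` steps from the trivial bound `1`
leaves an error `r ^ m`. -/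
theorem iterate_norm_le (hS : ∀ n, IsSchur (schurStep^[n] f)) (h : ∀ n, ‖schurParam f n‖ < 1)
    {N : ℕ} {ε : ℝ} (hε : ∀ n ≥ N, ‖schurParam f n‖ ≤ ε) {r : ℝ} (hr : r < 1) {z : ℂ}
    (hz : ‖z‖ ≤ r) {n : ℕ} (hn : N ≤ n) : ‖(schurStep^[n] f) z‖ ≤ 2 * ε / (1 - r) := by
  have hzb : z ∈ Metric.ball (0 : ℂ) 1 := by simpa using hz.trans_lt hr
  have hr0 : 0 ≤ r := (norm_nonneg z).trans hz
  have h1r : 0 < 1 - r := by linarith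
  have key : ∀ m n, N ≤ n → ‖(schurStep^[n] f) z‖ ≤ 2 * ε / (1 - r) + r ^ m := by
    intro m
    induction m with
    | zero =>
      intro n hn
      have : 0 ≤ ε := (norm_nonneg _).trans (hε n hn)
      have : 0 ≤ 2 * ε / (1 - r) := by positivity
      linarith [(hS n).norm_le z hzb, pow_zero r]
    | succ m ih =>
      intro n hn
      have h2 := (hS n).norm_le_add (h n) hzb
      have h3 := ih (n + 1) (by omega)
      rw [Function.iterate_succ_apply'] at h3
      have h4 : ‖(schurStep^[n] f) 0‖ ≤ ε := hε n hn
      calc _ ≤ 2 * ε + r * (2 * ε / (1 - r) + r ^ m) := by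
            refine h2.trans ?_
            gcongr
        _ = _ := by
          field_simp
          ring
  have h5 : Tendsto (fun m => 2 * ε / (1 - r) + r ^ m) atTop (𝓝 (2 * ε / (1 - r) + 0)) :=
    (tendsto_pow_atTop_nhds_zero_of_lt_one hr0 hr).const_add _
  rw [add_zero] at h5
  exact ge_of_tendsto' h5 fun m => key m n hn

theorem sum_rule_iterate (hS : ∀ n, IsSchur (schurStep^[n] f)) (h : ∀ n, ‖schurParam f n‖ < 1)
    {r : ℝ} (hr0 : 0 ≤ r) (hr : r < 1) (n : ℕ) :
    ∑ j ∈ Finset.range n, Real.log (1 - ‖schurParam f j‖ ^ 2) +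
      ∫ ζ : Circle, Real.log (1 - ‖(schurStep^[n] f) (r * ζ)‖ ^ 2) ∂arc ≤
        ∫ ζ : Circle, Real.log (1 - ‖f (r * ζ)‖ ^ 2) ∂arc := by
  induction n with
  | zero => simp
  | succ n ih =>
    have h1 := (hS n).sum_rule_step (h n)
      (by rw [← Function.iterate_succ_apply' schurStep]; exact h (n + 1)) hr0 hr
    rw [Finset.sum_range_succ, Function.iterate_succ_apply']
    have h2 : schurParam f n = (schurStep^[n] f) 0 := rfl
    rw [h2]
    linarith

/-- The lower bound for `∫ log (1 - |f|²)` on circles of radius less than one. -/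
theorem tsum_log_le_integral (hS : ∀ n, IsSchur (schurStep^[n] f))
    (h : ∀ n, ‖schurParam f n‖ < 1) (hsum : Summable fun n => ‖schurParam f n‖ ^ 2)
    {r : ℝ} (hr0 : 0 ≤ r) (hr : r < 1) :
    ∑' j, Real.log (1 - ‖schurParam f j‖ ^ 2) ≤
      ∫ ζ : Circle, Real.log (1 - ‖f (r * ζ)‖ ^ 2) ∂arc := by
  have hlog : Summable fun n => Real.log (1 - ‖schurParam f n‖ ^ 2) := by
    simpa [sub_eq_add_neg] using Real.summable_log_one_add_of_summable hsum.neg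
  have hpart : ∀ n, ∑' j, Real.log (1 - ‖schurParam f j‖ ^ 2) ≤
      ∑ j ∈ Finset.range n, Real.log (1 - ‖schurParam f j‖ ^ 2) := by
    intro n
    have h1 := hlog.neg.sum_le_tsum (Finset.range n) fun j _ => by
      have := one_sub_sq_pos (norm_nonneg _) (h j)
      have := Real.log_nonpos this.le (by nlinarith [norm_nonneg (schurParam f j)])
      linarith
    rw [Finset.sum_neg_distrib, tsum_neg] at h1
    linarith
  have hzero : Tendsto (fun n => ‖schurParam f n‖) atTop (𝓝 0) := by
    have := hsum.tendsto_atTop_zero.sqrt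
    simpa using this
  have h1r : 0 < 1 - r := by linarith
  have hδ : ∀ δ ∈ Set.Ioo (0 : ℝ) 1, ∑' j, Real.log (1 - ‖schurParam f j‖ ^ 2) +
      Real.log (1 - δ ^ 2) ≤ ∫ ζ : Circle, Real.log (1 - ‖f (r * ζ)‖ ^ 2) ∂arc := by
    intro δ hδ
    -- Parameters below this size force the iterates below `δ` on the circle of radius `r`, so the
    -- remainder in the sum rule is at least `log (1 - δ²)`.
    have hε : 0 < δ * (1 - r) / 2 := by
      have := hδ.1
      positivity
    obtain ⟨N, hN⟩ := eventually_atTop.1 (hzero.eventually (ge_mem_nhds hε))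
    have h1 := sum_rule_iterate hS h hr0 hr N
    have h2 : Real.log (1 - δ ^ 2) ≤
        ∫ ζ : Circle, Real.log (1 - ‖(schurStep^[N] f) (r * ζ)‖ ^ 2) ∂arc := by
      have h3 : ∫ _ : Circle, Real.log (1 - δ ^ 2) ∂arc = Real.log (1 - δ ^ 2) := by simp
      rw [← h3]
      refine integral_mono (integrable_const _) (integrable_of_continuous (continuous_log_one_sub
        (hS N).diff.continuousOn (fun z hz => (hS N).norm_lt_one (h N) hz) hr0 hr)) fun ζ => ?_
      have h4 := iterate_norm_le hS h hN hr (norm_smul_circle hr0 ζ).le le_rfl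
      have h5 : 2 * (δ * (1 - r) / 2) / (1 - r) = δ := by field_simp
      rw [h5] at h4
      have h6 := one_sub_sq_pos hδ.1.le hδ.2
      simp only
      gcongr
    linarith [hpart N]
  have hlim : Tendsto (fun δ : ℝ => ∑' j, Real.log (1 - ‖schurParam f j‖ ^ 2) +
      Real.log (1 - δ ^ 2)) (𝓝[>] 0) (𝓝 (∑' j, Real.log (1 - ‖schurParam f j‖ ^ 2))) := by
    have hc : ContinuousAt (fun δ : ℝ => Real.log (1 - δ ^ 2)) 0 :=
      ContinuousAt.log (by fun_prop) (by norm_num)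
    have := (hc.tendsto.mono_left (nhdsWithin_le_nhds (s := Set.Ioi 0))).const_add
      (∑' j, Real.log (1 - ‖schurParam f j‖ ^ 2))
    simpa using this
  refine le_of_tendsto hlim ?_
  filter_upwards [Ioo_mem_nhdsGT one_pos] with δ hδ' using hδ δ hδ'

end SzegoTheorem

/-! ### Boundary representation and the quotient of Szegő functions -/

/-- Real parts of functions in `H²` converge in `L¹` to their radial limits. -/
theorem MemHardy.tendsto_integral_abs_sub {L : ℂ → ℂ} (hL : MemHardy 2 L) {g : Circle → ℝ}
    (ht : ∀ᵐ ζ : Circle ∂arc, Tendsto (fun n => (L (radius n * ζ)).re) atTop (𝓝 (g ζ))) :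
    Integrable g arc ∧
      Tendsto (fun n => ∫ ζ : Circle, |(L (radius n * ζ)).re - g ζ| ∂arc) atTop (𝓝 0) := by
  obtain ⟨hLa, K, hK⟩ := hL
  have hc := fun n => continuous_dilate hLa.continuousOn (radius_nonneg n) (radius_lt_one n)
  have hcre := fun n => Complex.continuous_re.comp (hc n)
  refine OPUC.tendsto_integral_abs_sub (h := fun n (ζ : Circle) => (L (radius n * ζ)).re)
    (fun n => integrable_of_continuous (hcre n))
    (fun n => integrable_of_continuous ((hcre n).pow 2)) (K := K) (fun n => ?_) ht
  refine le_trans (integral_mono (integrable_of_continuous ((hcre n).pow 2))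
    (integrable_of_continuous (continuous_norm_rpow_dilate hLa two_pos.le (radius_nonneg n)
      (radius_lt_one n))) fun ζ => ?_) (hK _ (radius_nonneg n) (radius_lt_one n))
  simp only [Real.rpow_two]
  rw [← sq_abs]
  gcongr
  exact Complex.abs_re_le_norm _

/-- Functions in `H²` are Schwarz integrals of the boundary values of their real parts. -/
theorem MemHardy.eq_schwarz_integral {L : ℂ → ℂ} (hL : MemHardy 2 L) {g : Circle → ℝ}
    (ht : ∀ᵐ ζ : Circle ∂arc, Tendsto (fun n => (L (radius n * ζ)).re) atTop (𝓝 (g ζ))) {z : ℂ}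
    (hz : z ∈ Metric.ball (0 : ℂ) 1) :
    L z = (L 0).im * Complex.I +
      ∫ ζ : Circle, ((ζ : ℂ) + z) / ((ζ : ℂ) - z) * (g ζ : ℂ) ∂arc := by
  obtain ⟨hg, hlim⟩ := hL.tendsto_integral_abs_sub ht
  have hd := hL.1.differentiableOn
  have hk := continuous_herglotz hz
  obtain ⟨C, hC⟩ := isCompact_univ.exists_bound_of_continuousOn hk.continuousOn
  have hcre := fun n => Complex.continuous_re.comp
    (continuous_dilate hd.continuousOn (radius_nonneg n) (radius_lt_one n))
  have hi1 : ∀ n, Integrable (fun ζ : Circle =>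
      ((ζ : ℂ) + z) / ((ζ : ℂ) - z) * ((L (radius n * ζ)).re : ℂ)) arc := fun n =>
    integrable_of_continuous (hk.mul (Complex.continuous_ofReal.comp (hcre n)))
  have hi2 : Integrable (fun ζ : Circle => ((ζ : ℂ) + z) / ((ζ : ℂ) - z) * (g ζ : ℂ)) arc :=
    hg.ofReal.bdd_mul hk.aestronglyMeasurable (.of_forall fun ζ => hC ζ trivial)
  have h1 : Tendsto (fun n => ∫ ζ : Circle,
      ((ζ : ℂ) + z) / ((ζ : ℂ) - z) * ((L (radius n * ζ)).re : ℂ) ∂arc) atTop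
      (𝓝 (∫ ζ : Circle, ((ζ : ℂ) + z) / ((ζ : ℂ) - z) * (g ζ : ℂ) ∂arc)) := by
    rw [tendsto_iff_norm_sub_tendsto_zero]
    refine squeeze_zero (fun n => norm_nonneg _) (fun n => ?_) (by simpa using hlim.const_mul C)
    rw [← integral_sub (hi1 n) hi2, ← integral_const_mul]
    refine norm_integral_le_of_norm_le
      (((integrable_of_continuous (hcre n)).sub hg).abs.const_mul C) (.of_forall fun ζ => ?_)
    rw [← mul_sub, norm_mul, ← Complex.ofReal_sub, Complex.norm_real, Real.norm_eq_abs]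
    exact mul_le_mul_of_nonneg_right (hC ζ trivial) (abs_nonneg _)
  refine tendsto_nhds_unique (tendsto_dilate hd.continuousOn hz)
    ((h1.const_add ((L 0).im * Complex.I)).congr fun n => ?_)
  have := schwarz_formula (diffContOnCl_dilate hd (radius_nonneg n) (radius_lt_one n)) hz
  simpa using this.symm

/-- Szegő's theorem: if the Verblunsky coefficients are square summable, then `log w` is
integrable. -/
theorem IsNontrivialProb.logWeightIntegrable {μ : Measure Circle} (hμ : IsNontrivialProb μ)
    (hsum : Summable fun j => ‖verblunsky μ j‖ ^ 2) : LogWeightIntegrable μ := by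
  have := hμ.isProb
  have hpar : schurParam (schur μ) = verblunsky μ := funext hμ.schurParam_eq
  have hα : ∀ n, ‖schurParam (schur μ) n‖ < 1 := hpar ▸ hμ.norm_verblunsky_lt_one
  have hS := isSchur_schur μ
  have hbound := fun n => tsum_log_le_integral (f := schur μ) hμ.isSchur_iterate hα
    (by rwa [hpar]) (radius_nonneg n) (radius_lt_one n)
  set K := ∑' j, Real.log (1 - ‖schurParam (schur μ) j‖ ^ 2)
  have hlt : ∀ z ∈ Metric.ball (0 : ℂ) 1, ‖schur μ z‖ < 1 := fun z hz => hS.norm_lt_one (hα 0) hz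
  have hcont : ∀ n, Continuous fun ζ : Circle =>
      -Real.log (1 - ‖schur μ (radius n * ζ)‖ ^ 2) := fun n =>
    (continuous_log_one_sub hS.diff.continuousOn hlt (radius_nonneg n) (radius_lt_one n)).neg
  have hnn : ∀ n (ζ : Circle), 0 ≤ -Real.log (1 - ‖schur μ (radius n * ζ)‖ ^ 2) := fun n ζ => by
    have h1 := hlt _ (smul_circle_mem_ball (radius_nonneg n) (radius_lt_one n) ζ)
    rw [neg_nonneg]
    exact Real.log_nonpos (one_sub_sq_pos (norm_nonneg _) h1).le
      (by linarith [sq_nonneg ‖schur μ (radius n * ζ)‖])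
  have hle : ∀ n, ∫⁻ ζ : Circle, ENNReal.ofReal (-Real.log (1 - ‖schur μ (radius n * ζ)‖ ^ 2)) ∂arc
      ≤ ENNReal.ofReal (-K) := fun n => by
    rw [← ofReal_integral_eq_lintegral_ofReal (integrable_of_continuous (hcont n))
      (.of_forall (hnn n)), integral_neg]
    exact ENNReal.ofReal_le_ofReal (neg_le_neg (hbound n))
  obtain ⟨b, hb⟩ := (ae_schur_boundary μ).choice
  -- If `|b| = 1`, then `-log (1 - |f|²)` blows up along the radius, which the uniform bound on its
  -- means forbids outside a null set.
  have hb1 : ∀ᵐ ζ : Circle ∂arc, ‖b ζ‖ < 1 := by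
    filter_upwards [hb, ae_not_tendsto_atTop (ν := arc) (fun n => (hcont n).measurable)
      ENNReal.ofReal_ne_top hle] with ζ ⟨ht, h1, _, _⟩ hnot
    refine lt_of_le_of_ne h1 fun h2 => hnot ?_
    refine tendsto_neg_atBot_atTop.comp (Real.tendsto_log_nhdsGT_zero.comp ?_)
    refine tendsto_nhdsWithin_iff.2 ⟨?_, .of_forall fun n => one_sub_sq_pos (norm_nonneg _)
      (hlt _ (smul_circle_mem_ball (radius_nonneg n) (radius_lt_one n) ζ))⟩
    have h3 := ((ht.comp tendsto_radius).norm.pow 2).const_sub 1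
    rwa [h2, one_pow, sub_self] at h3
  have hi1 : Integrable (fun ζ => -Real.log (1 - ‖b ζ‖ ^ 2)) arc := by
    refine integrable_of_tendsto_ae (fun n => (hcont n).aemeasurable) hnn ENNReal.ofReal_ne_top
      hle ?_
    filter_upwards [hb, hb1] with ζ ⟨ht, _, _, _⟩ h1
    exact ((((ht.comp tendsto_radius).norm.pow 2).const_sub 1).log
      (one_sub_sq_pos (norm_nonneg _) h1).ne').neg
  have hi2 : Integrable (fun ζ : Circle => Real.log ‖1 - ζ * b ζ‖) arc := by
    refine ((memHardy_log hS.mul_diff (fun z hz => hS.re_one_sub_mul_pos hz)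
      two_pos).tendsto_integral_abs_sub ?_).1
    filter_upwards [hb] with ζ ⟨ht, _, hne, _⟩
    simp only [Complex.log_re]
    exact ((((tendsto_smul_circle ζ).mul ht).const_sub 1).comp tendsto_radius).norm.log
      (norm_ne_zero_iff.2 hne)
  constructor
  · filter_upwards [hb, hb1] with ζ ⟨_, _, hne, hw⟩ h1
    rw [hw]
    exact div_ne_zero (one_sub_sq_pos (norm_nonneg _) h1).ne'
      (pow_ne_zero 2 (norm_ne_zero_iff.2 hne))
  -- Here `log w = log (1 - |b|²) - 2 log |1 - ζ b|`, where the second term is integrable as a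
  -- boundary value of an `H²` function.
  · refine (hi1.neg.sub (hi2.const_mul 2)).congr ?_
    filter_upwards [hb, hb1] with ζ ⟨_, _, hne, hw⟩ h1
    rw [hw, Real.log_div (one_sub_sq_pos (norm_nonneg _) h1).ne'
      (pow_ne_zero 2 (norm_ne_zero_iff.2 hne)), Real.log_pow]
    simp

/-- The relative Szegő function is the quotient of the Szegő functions. -/
theorem IsStripped.relSzego_eq_div {μ μ₁ : Measure Circle} (hμ : IsNontrivialProb μ)
    (h : IsStripped μ μ₁) (hw : LogWeightIntegrable μ) (hw₁ : LogWeightIntegrable μ₁) {z : ℂ}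
    (hz : z ∈ Metric.ball (0 : ℂ) 1) : relSzego μ μ₁ z = szego μ z / szego μ₁ z := by
  have := hμ.isProb
  have := h.nontrivial.isProb
  have hα := hμ.norm_verblunsky_lt_one 0
  have ht : ∀ᵐ ζ : Circle ∂arc, Tendsto (fun n => (logRelSzego μ μ₁ (radius n * ζ)).re) atTop
      (𝓝 (1 / 2 * (Real.log (weight μ ζ) - Real.log (weight μ₁ ζ)))) := by
    filter_upwards [h.ae_tendsto_re_log hμ, hw.1, hw₁.1] with ζ h1 h2 h3
    rw [← Real.log_div h2 h3]
    exact h1 h3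
  have h1 := (memHardy_logRelSzego hα two_pos).eq_schwarz_integral ht hz
  -- The Schwarz integral fixes a function only up to an imaginary constant. It vanishes because
  -- `f(0) = α₀` makes all factors at the origin positive.
  have h0 : (logRelSzego μ μ₁ 0).im = 0 := by
    have h2 : schur μ 0 = verblunsky μ 0 := hμ.schurParam_eq 0
    have h3 : (0 : ℝ) ≤ 1 - ‖verblunsky μ 0‖ ^ 2 := (one_sub_sq_pos (norm_nonneg _) hα).le
    have h4 : 1 - conj (verblunsky μ 0) * schur μ 0 = ((1 - ‖verblunsky μ 0‖ ^ 2 : ℝ) : ℂ) := by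
      rw [h2, Complex.conj_mul']
      push_cast
      ring
    rw [logRelSzego, h4, ← Complex.ofReal_log h3, ← Complex.ofReal_log (Real.sqrt_nonneg _)]
    simp
  have hk := continuous_herglotz hz
  obtain ⟨C, hC⟩ := isCompact_univ.exists_bound_of_continuousOn hk.continuousOn
  have hint : ∀ ν : Measure Circle, LogWeightIntegrable ν → Integrable (fun ζ : Circle =>
      ((ζ : ℂ) + z) / ((ζ : ℂ) - z) * ((Real.log (weight ν ζ) : ℝ) : ℂ)) arc := fun ν hν =>
    hν.2.ofReal.bdd_mul hk.aestronglyMeasurable (.of_forall fun ζ => hC ζ trivial)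
  have h5 : ∫ ζ : Circle, ((ζ : ℂ) + z) / ((ζ : ℂ) - z) *
      ((1 / 2 * (Real.log (weight μ ζ) - Real.log (weight μ₁ ζ)) : ℝ) : ℂ) ∂arc =
      1 / 2 * ∫ ζ : Circle, ((ζ : ℂ) + z) / ((ζ : ℂ) - z) * ((Real.log (weight μ ζ) : ℝ) : ℂ) ∂arc -
      1 / 2 * ∫ ζ : Circle, ((ζ : ℂ) + z) / ((ζ : ℂ) - z) *
        ((Real.log (weight μ₁ ζ) : ℝ) : ℂ) ∂arc := by
    rw [← mul_sub, ← integral_sub (hint μ hw) (hint μ₁ hw₁), ← integral_const_mul]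
    congr 1
    ext ζ
    push_cast
    ring
  rw [← exp_logRelSzego hα hz, h1, h0, h5, szego, szego, ← Complex.exp_sub]
  simp

end OPUC

/-! ### Assembly of the theorem -/

theorem theorem2p2 (μ : Measure Circle) (hμ : OPUC.IsNontrivialProb μ) :
    -- the measure with the shifted Verblunsky coefficients exists
    (∃ μ₁ : Measure Circle, OPUC.IsStripped μ μ₁) ∧
    ∀ μ₁ : Measure Circle, OPUC.IsStripped μ μ₁ →
      -- analyticity and absence of zeros
      (AnalyticOnNhd ℂ (OPUC.relSzego μ μ₁) (Metric.ball 0 1) ∧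
        ∀ z ∈ Metric.ball (0 : ℂ) 1, OPUC.relSzego μ μ₁ z ≠ 0) ∧
      -- analytic logarithms exist, and each of them is in every `H^p`
      ((∃ L : ℂ → ℂ, AnalyticOnNhd ℂ L (Metric.ball 0 1) ∧
          ∀ z ∈ Metric.ball (0 : ℂ) 1, Complex.exp (L z) = OPUC.relSzego μ μ₁ z) ∧
        ∀ L : ℂ → ℂ, AnalyticOnNhd ℂ L (Metric.ball 0 1) →
          (∀ z ∈ Metric.ball (0 : ℂ) 1, Complex.exp (L z) = OPUC.relSzego μ μ₁ z) →
          ∀ p : ℝ, 1 ≤ p → OPUC.MemHardy p L) ∧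
      -- boundary values
      ((∀ᵐ ζ ∂OPUC.arc, OPUC.weight μ ζ ≠ 0 ↔ OPUC.weight μ₁ ζ ≠ 0) ∧
        (∀ᵐ ζ ∂OPUC.arc, OPUC.weight μ ζ ≠ 0 →
          ∃ b : ℂ,
            Tendsto (fun r : ℝ => OPUC.relSzego μ μ₁ ((r : ℂ) * (ζ : ℂ))) (𝓝[<] 1) (𝓝 b) ∧
            OPUC.weight μ ζ / OPUC.weight μ₁ ζ = ‖b‖ ^ 2) ∧
        ∀ p : ℝ, 1 ≤ p →
          IntegrableOn
            (fun ζ => |Real.log (OPUC.weight μ ζ / OPUC.weight μ₁ ζ)| ^ p)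
            {ζ | OPUC.weight μ₁ ζ ≠ 0} OPUC.arc) ∧
      -- the quotient of Szegő functions
      (Summable (fun j : ℕ => ‖OPUC.verblunsky μ j‖ ^ 2) →
        OPUC.LogWeightIntegrable μ ∧ OPUC.LogWeightIntegrable μ₁ ∧
        ∀ z ∈ Metric.ball (0 : ℂ) 1,
          OPUC.relSzego μ μ₁ z = OPUC.szego μ z / OPUC.szego μ₁ z) ∧
      -- the limit of ratios of reversed orthonormal polynomials
      (∀ z ∈ Metric.ball (0 : ℂ) 1,
        Tendsto
          (fun n : ℕ =>
            (OPUC.starPoly n (OPUC.orthoPoly μ₁ n)).eval z /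
              (OPUC.starPoly (n + 1) (OPUC.orthoPoly μ (n + 1))).eval z)
          atTop (𝓝 (OPUC.relSzego μ μ₁ z))) := by
  have := hμ.isProb
  refine ⟨hμ.exists_isStripped, fun μ₁ h => ?_⟩
  have := h.nontrivial.isProb
  have hα := hμ.norm_verblunsky_lt_one 0
  refine ⟨⟨OPUC.analyticOnNhd_relSzego, fun z hz => OPUC.relSzego_ne_zero hα hz⟩,
    ⟨⟨OPUC.logRelSzego μ μ₁, (OPUC.memHardy_logRelSzego hα one_pos).1,
        fun z hz => OPUC.exp_logRelSzego hα hz⟩,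
      fun L hL hexp p hp => OPUC.memHardy_of_exp_eq_relSzego hα hL hexp (by linarith)⟩,
    ⟨h.ae_weight_ne_zero_iff hμ, h.ae_weight_div hμ,
      fun p hp => h.integrableOn_log_weight hμ (by linarith)⟩,
    fun hsum => ?_, fun z hz => h.tendsto_ratio hμ hz⟩
  have hsum₁ : Summable (fun j => ‖OPUC.verblunsky μ₁ j‖ ^ 2) := by
    simp only [h.shift]
    exact (summable_nat_add_iff 1).2 hsum
  have hw := hμ.logWeightIntegrable hsum
  have hw₁ := h.nontrivial.logWeightIntegrable hsum₁
  exact ⟨hw, hw₁, fun z hz => h.relSzego_eq_div hμ hw hw₁ hz⟩
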